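/- Let $F_0$ be a finite extension of $\mathbf{Q}_p$ with uniformizer $\pi$, let $L$ be the completion of the maximal unramified extension of $F_0$, with ring of integers $O_L$ and residue field $\mathbf{F}$, and let $\sigma$ be the relative Frobenius automorphism of $L/F_0$. Let $(N,F)$ be an isocrystal of dimension $n\ge 1$, that is, an $n$-dimensional $L$-vector space $N$ with a $\sigma$-linear bijection $F:N\to N$. Let $\nu(F)=(\nu_1\ge\dots\ge\nu_n)\in\mathbf{Q}^n$ be its slope vector: $N$ is the direct sum of $F$-stable subspaces $N_s$ ($s\in\mathbf{Q}$), where $s$ occurs $\dim N_s$ times in $\nu(F)$ and where $N_s$ is isoclinic of slope $s$, i.e. if $s=d/h$ in lowest terms with $h>0$, then $N_s$ contains an $O_L$-lattice $M$ with $F^hM=\pi^dM$. Fix an integer $0\le r\le n$. Call $F$ minuscule of weight $r$ if $0\le\nu_i\le 1$ for all $i$ and $\sum_i\nu_i=r$ (equivalently, $\nu(F)\le\omega_r=(1^r,0^{n-r})$ in the dominance order). For a nonempty subset $\bar I\subset\mathbf{Z}/n\mathbf{Z}$ with inverse image $I\subset\mathbf{Z}$, a periodic lattice chain of type $\bar I$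 is a family $(M_i)_{i\in I}$ of $O_L$-lattices in $N$ such that $M_i\subset M_j$ with $\mathrm{length}(M_j/M_i)=j-i$ for all $i<j$ in $I$, and $M_{i+n}=\pi^{-1}M_i$ for all $i\in I$. Let $X(\omega_r,F)_{\bar I}$ be the set of those chains for which $\pi M_i\subset FM_i\subset M_i$ and $\dim_{\mathbf{F}}M_i/FM_i=r$ for all $i\in I$ (equivalently, the relative position $\mathrm{inv}(M_i,FM_i)$ is $\omega_r$ for all $i\in I$). **Proposition 1.1.** (i) For every nonempty $\bar I\subset\mathbf{Z}/n\mathbf{Z}$, the set $X(\omega_r,F)_{\bar I}$ is nonempty if and only if $F$ is minuscule of weight $r$. (ii) For all nonempty subsets $\bar J\subset\bar I$ of $\mathbf{Z}/n\mathbf{Z}$, the forgetful map $X(\omega_r,F)_{\bar I}\to X(\omega_r,F)_{\bar J}$, $(M_i)_{i\in I}\mapsto(M_i)_{i\in J}$, is surjective. -/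

import Mathlib

noncomputable section

namespace KR

/-! ### The ground field `K`, its completed maximal unramified extension `L`, and Frobenius

The ground field is a finite extension `K` of `ℚ_[p]` inside the fixed algebraic closure
`PadicAlgCl p`, whose norm is the unique extension of the `p`-adic norm. -/

section Fields

variable {p : ℕ} [Fact p.Prime]

/-- A finite extension `E / K` (inside the algebraic closure) is unramified if it has the same value
group as `K`. (The residue fields are finite, so residue field extensions are separable.) -/
def IsFiniteUnramified (K : IntermediateField ℚ_[p] (PadicAlgCl p))
    (E : IntermediateField K (PadicAlgCl p)) : Prop :=
  FiniteDimensional K E ∧ ∀ x ∈ E, ∃ y : K, ‖x‖ = ‖(y : PadicAlgCl p)‖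

/-- The maximal unramified extension of `K`: the compositum of all its finite unramified
extensions. -/
def maxUnramified (K : IntermediateField ℚ_[p] (PadicAlgCl p)) :
    IntermediateField K (PadicAlgCl p) :=
  sSup {E | IsFiniteUnramified K E}

/-- The completion `L` of the maximal unramified extension of `K`: its topological closure in the
complete field `ℂ_[p]`. -/
def L (K : IntermediateField ℚ_[p] (PadicAlgCl p)) : Subfield ℂ_[p] :=
  ((maxUnramified K).toSubfield.map (algebraMap (PadicAlgCl p) ℂ_[p])).topologicalClosure

/-- The inclusion of `K` in `L`. -/
def inclL (K : IntermediateField ℚ_[p] (PadicAlgCl p)) : K →+* L K :=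
  ((algebraMap (PadicAlgCl p) ℂ_[p]).comp (algebraMap K (PadicAlgCl p))).codRestrict (L K)
    fun x => Subfield.le_topologicalClosure _
      ⟨(x : PadicAlgCl p), (maxUnramified K).algebraMap_mem x, rfl⟩

/-- The ring of integers `O_K` of `K`. -/
abbrev OK (K : IntermediateField ℚ_[p] (PadicAlgCl p)) : ValuationSubring K :=
  (NormedField.valuation (K := K)).valuationSubring

/-- The ring of integers `O_L` of `L`. -/
abbrev OL (K : IntermediateField ℚ_[p] (PadicAlgCl p)) : ValuationSubring (L K) :=
  (NormedField.valuation (K := L K)).valuationSubring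

/-- `π` is a uniformizer of `K`: a nonzero element generating the maximal ideal of `O_K`. -/
def IsUniformizer {K : IntermediateField ℚ_[p] (PadicAlgCl p)} (π : K) : Prop :=
  π ≠ 0 ∧ ‖π‖ < 1 ∧ ∀ x : K, ‖x‖ < 1 → ‖x‖ ≤ ‖π‖

/-- The relative Frobenius automorphism of `L / K`: the automorphism of the field `L` which is the
identity on `K` and induces `x ↦ x ^ q` on the residue field of `O_L`, with `q` the number of
elements of the residue field of `K`. -/
structure RelFrobenius (K : IntermediateField ℚ_[p] (PadicAlgCl p)) where
  /-- the underlying automorphism -/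
  toEquiv : L K ≃+* L K
  fixes : ∀ a : K, toEquiv (inclL K a) = inclL K a
  residue : ∀ x : L K, ‖x‖ ≤ 1 →
    ‖toEquiv x - x ^ Nat.card (IsLocalRing.ResidueField (OK K))‖ < 1

/-- `σ` as a ring homomorphism `L → L`. -/
abbrev RelFrobenius.hom {K : IntermediateField ℚ_[p] (PadicAlgCl p)} (σ : RelFrobenius K) :
    L K →+* L K := σ.toEquiv

theorem mem_OL {K : IntermediateField ℚ_[p] (PadicAlgCl p)} (x : L K) : x ∈ OL K ↔ ‖x‖ ≤ 1 :=
  Iff.rfl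

end Fields

/-! ### Existence of the relative Frobenius

The facts in this section are used only to show that `RelFrobenius K` is not empty. -/

section Existence
variable {p : ℕ} [Fact p.Prime] (K : IntermediateField ℚ_[p] (PadicAlgCl p))

/-- The ring of integers of the algebraic closure. -/
abbrev OC (p : ℕ) [Fact p.Prime] : ValuationSubring (PadicAlgCl p) :=
  (NormedField.valuation (K := PadicAlgCl p)).valuationSubring

theorem mem_OC (x : PadicAlgCl p) : x ∈ OC p ↔ ‖x‖ ≤ 1 := Iff.rfl

theorem norm_gal (g : Gal(PadicAlgCl p/K)) (x : PadicAlgCl p) : ‖g x‖ = ‖x‖ :=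
  (spectralNorm_eq_of_equiv (g.restrictScalars ℚ_[p]) x).symm

theorem max_iff {F : Type*} [NormedField F] [IsUltrametricDist F]
    (x : (NormedField.valuation (K := F)).valuationSubring) :
    x ∈ IsLocalRing.maximalIdeal (NormedField.valuation (K := F)).valuationSubring ↔
      ‖(x : F)‖ < 1 := by
  rw [IsLocalRing.mem_maximalIdeal, mem_nonunits_iff]
  have hx : ‖(x:F)‖ ≤ 1 := x.2
  constructor
  · intro h
    refine lt_of_le_of_ne hx fun h1 => h ?_
    refine IsUnit.of_mul_eq_one ⟨(x:F)⁻¹, ?_⟩ ?_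
    · change ‖(x:F)⁻¹‖ ≤ 1
      rw [norm_inv, h1, inv_one]
    · ext
      change (x:F) * (x:F)⁻¹ = 1
      refine mul_inv_cancel₀ ?_
      rintro h0
      simp [h0] at h1
  · intro h hu
    obtain ⟨y, hy⟩ := hu.exists_right_inv
    have h2 : (x:F) * (y:F) = 1 := congrArg Subtype.val hy
    have h3 : ‖(y:F)‖ ≤ 1 := y.2
    have h4 : ‖(x:F)‖ * ‖(y:F)‖ = 1 := by rw [← norm_mul, h2, norm_one]
    nlinarith [norm_nonneg (x:F), norm_nonneg (y:F)]

theorem finite_res [FiniteDimensional ℚ_[p] K] : Finite (IsLocalRing.ResidueField (OK K)) := by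
  have : ProperSpace K := FiniteDimensional.proper ℚ_[p] K
  have hc : IsCompact (Metric.closedBall (0:K) 1) := isCompact_closedBall _ _
  obtain ⟨t, htsub, htf, ht⟩ := hc.finite_cover_balls (e := 1) one_pos
  have := htf.to_subtype
  let f : t → IsLocalRing.ResidueField (OK K) := fun x =>
    IsLocalRing.residue (OK K) ⟨x.1, mem_closedBall_zero_iff.mp (htsub x.2)⟩
  refine Finite.of_surjective f ?_
  intro y
  obtain ⟨y, rfl⟩ := IsLocalRing.residue_surjective y
  have hy : (y:K) ∈ Metric.closedBall (0:K) 1 := mem_closedBall_zero_iff.mpr y.2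
  have := ht hy
  simp only [Set.mem_iUnion] at this
  obtain ⟨x, hx, hxy⟩ := this
  refine ⟨⟨x, hx⟩, ?_⟩
  refine (Ideal.Quotient.eq (I := IsLocalRing.maximalIdeal (OK K))).mpr ?_
  rw [max_iff]
  rw [Metric.mem_ball, dist_comm, dist_eq_norm] at hxy
  exact hxy

local instance algAB : Algebra (OK K) (OC p) :=
  RingHom.toAlgebra
    { toFun := fun x => ⟨(x : K), (x.2 : ‖(x:K)‖ ≤ 1)⟩
      map_one' := rfl
      map_mul' := fun _ _ => rfl
      map_zero' := rfl
      map_add' := fun _ _ => rfl }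

theorem algAB_coe (x : OK K) : ((algebraMap (OK K) (OC p) x : OC p) : PadicAlgCl p) = (x : K) := rfl

local instance actB : MulSemiringAction Gal(PadicAlgCl p/K) (OC p) where
  smul g x := ⟨g x, by rw [mem_OC, norm_gal]; exact x.2⟩
  one_smul _ := rfl
  mul_smul _ _ _ := rfl
  smul_zero g := Subtype.ext (map_zero g)
  smul_add g _ _ := Subtype.ext (map_add g _ _)
  smul_one g := Subtype.ext (map_one g)
  smul_mul g _ _ := Subtype.ext (map_mul g _ _)

theorem smulB_coe (g : Gal(PadicAlgCl p/K)) (x : OC p) : ((g • x : OC p) : PadicAlgCl p) = g x := rfl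

local instance : SMulCommClass Gal(PadicAlgCl p/K) (OK K) (OC p) where
  smul_comm g a b := by
    ext
    rw [Algebra.smul_def, Algebra.smul_def, smulB_coe]
    change g ((((a : K) : PadicAlgCl p)) * b) = ((a : K) : PadicAlgCl p) * g b
    rw [map_mul]
    congr 1
    exact g.commutes _

local instance : TopologicalSpace (OC p) := ⊥
local instance : DiscreteTopology (OC p) := ⟨rfl⟩

local instance galK : IsGalois K (PadicAlgCl p) := by
  have : Algebra.IsAlgebraic K (PadicAlgCl p) := Algebra.IsAlgebraic.tower_top (K := ℚ_[p]) K
  have : IsAlgClosure K (PadicAlgCl p) := ⟨inferInstance, inferInstance⟩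
  infer_instance

local instance : ContinuousSMul Gal(PadicAlgCl p/K) (OC p) where
  continuous_smul := by
    rw [continuous_prod_of_discrete_right]
    intro b
    rw [continuous_discrete_rng]
    intro c
    rw [isOpen_iff_mem_nhds]
    rintro g rfl
    have ho := stabilizer_isOpen_of_isIntegral (K := K) (L := PadicAlgCl p) (b : PadicAlgCl p)
    have := ho.leftCoset g
    refine Filter.mem_of_superset (this.mem_nhds ⟨1, one_mem _, by simp⟩) ?_
    rintro _ ⟨h, hh, rfl⟩
    simp only [Set.mem_preimage, Set.mem_singleton_iff, smul_eq_mul, mul_smul]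
    congr 1
    exact Subtype.ext hh

local instance : Algebra.IsInvariant (OK K) (OC p) Gal(PadicAlgCl p/K) where
  isInvariant b hb := by
    have : (b : PadicAlgCl p) ∈ Set.range (algebraMap K (PadicAlgCl p)) := by
      rw [InfiniteGalois.mem_range_algebraMap_iff_fixed]
      exact fun g => congrArg Subtype.val (hb g)
    obtain ⟨a, ha⟩ := this
    refine ⟨⟨a, ?_⟩, Subtype.ext ha⟩
    have hb : ‖(b : PadicAlgCl p)‖ ≤ 1 := b.2
    rw [← ha] at hb
    exact hb

theorem exists_gal [FiniteDimensional ℚ_[p] K] : ∃ g : Gal(PadicAlgCl p/K),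
    ∀ x : PadicAlgCl p, ‖x‖ ≤ 1 →
    ‖g x - x ^ Nat.card (IsLocalRing.ResidueField (OK K))‖ < 1 := by
  set q := Nat.card (IsLocalRing.ResidueField (OK K)) with hq
  have := finite_res K
  let P := IsLocalRing.maximalIdeal (OK K)
  let Q := IsLocalRing.maximalIdeal (OC p)
  have : Q.LiesOver P := ⟨by
    ext x
    rw [Ideal.mem_comap, max_iff, max_iff]
    rfl⟩
  let _ : Field ((OC p) ⧸ Q) := Ideal.Quotient.field Q
  let _ : Field ((OK K) ⧸ P) := Ideal.Quotient.field P
  have hfin : Finite (OK K ⧸ P) := finite_res K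
  let _ : Fintype (OK K ⧸ P) := Fintype.ofFinite _
  have hq' : Fintype.card (OK K ⧸ P) = q := (Nat.card_eq_fintype_card).symm
  let φ : ((OC p) ⧸ Q) →ₐ[(OK K) ⧸ P] ((OC p) ⧸ Q) := FiniteField.frobeniusAlgHom _ _
  have hφ : ∀ x, φ x = x ^ q := fun x => by
    rw [← hq']; rfl
  have hq0 : q ≠ 0 := by rw [← hq']; exact Fintype.card_ne_zero
  have hbij : Function.Bijective φ := by
    refine ⟨φ.toRingHom.injective, fun y => ?_⟩
    obtain ⟨y, rfl⟩ := Ideal.Quotient.mk_surjective y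
    obtain ⟨z, hz⟩ := IsAlgClosed.exists_pow_nat_eq (y : PadicAlgCl p) (Nat.pos_of_ne_zero hq0)
    have hz1 : ‖z‖ ≤ 1 := by
      have : ‖z‖ ^ q ≤ 1 := by rw [← norm_pow, hz]; exact y.2
      exact (pow_le_one_iff_of_nonneg (norm_nonneg _) hq0).mp this
    refine ⟨Ideal.Quotient.mk Q ⟨z, hz1⟩, ?_⟩
    rw [hφ, ← map_pow]
    congr 1
    exact Subtype.ext hz
  obtain ⟨g, hg⟩ := Ideal.Quotient.stabilizerHom_surjective_of_profinite
    (G := Gal(PadicAlgCl p/K)) P Q (AlgEquiv.ofBijective φ hbij)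
  refine ⟨g.1, fun x hx => ?_⟩
  have h := DFunLike.congr_fun hg (Ideal.Quotient.mk Q ⟨x, hx⟩)
  rw [Ideal.Quotient.stabilizerHom_apply, AlgEquiv.ofBijective_apply, hφ, ← map_pow] at h
  have h2 := (Ideal.Quotient.eq (I := Q)).mp h
  rw [max_iff] at h2
  exact h2

theorem map_unram (g : Gal(PadicAlgCl p/K)) (x) (hx : x ∈ maxUnramified K) :
    g x ∈ maxUnramified K := by
  have : maxUnramified K ≤ (maxUnramified K).comap (g : PadicAlgCl p →ₐ[K] PadicAlgCl p) := by
    refine sSup_le fun E hE => ?_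
    rw [← IntermediateField.map_le_iff_le_comap]
    refine le_sSup ⟨?_, ?_⟩
    · have := hE.1
      exact (IntermediateField.equivMap E _).toLinearEquiv.finiteDimensional
    · rintro _ ⟨y, hy, rfl⟩
      obtain ⟨z, hz⟩ := hE.2 y hy
      exact ⟨z, (norm_gal K g y).trans hz⟩
  exact this hx

/-- The relative Frobenius automorphism exists. -/
theorem RelFrobenius.nonempty [FiniteDimensional ℚ_[p] K] : Nonempty (RelFrobenius K) := by
  obtain ⟨g, hg⟩ := exists_gal K
  have hiso : ∀ g : Gal(PadicAlgCl p/K), Isometry g := fun g =>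
    AddMonoidHomClass.isometry_of_norm g (norm_gal K g)
  let s : ℂ_[p] ≃+* ℂ_[p] := UniformSpace.Completion.mapRingEquiv g.toRingEquiv
    (hiso g).continuous (hiso g.symm).continuous
  have hs : ∀ x : PadicAlgCl p, s x = ((g x : PadicAlgCl p) : ℂ_[p]) := fun x =>
    UniformSpace.Completion.map_coe (hiso g).uniformContinuous x
  have hs' : ∀ x : PadicAlgCl p, s.symm x = ((g.symm x : PadicAlgCl p) : ℂ_[p]) := fun x =>
    UniformSpace.Completion.map_coe (hiso g.symm).uniformContinuous x
  have hsc : Continuous s := UniformSpace.Completion.continuous_map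
  have hsc' : Continuous s.symm := UniformSpace.Completion.continuous_map
  have hL : ∀ x ∈ L K, s x ∈ L K := by
    intro x hx
    refine map_mem_closure hsc hx ?_
    rintro _ ⟨y, hy, rfl⟩
    exact ⟨g y, map_unram K g y hy, (hs y).symm⟩
  have hL' : ∀ x ∈ L K, s.symm x ∈ L K := by
    intro x hx
    refine map_mem_closure hsc' hx ?_
    rintro _ ⟨y, hy, rfl⟩
    exact ⟨g.symm y, map_unram K g.symm y hy, (hs' y).symm⟩
  refine ⟨⟨⟨⟨fun x => ⟨s x, hL x x.2⟩, fun x => ⟨s.symm x, hL' x x.2⟩,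
    fun x => by simp, fun x => by simp⟩, fun x y => by ext; simp, fun x y => by ext; simp⟩, ?_, ?_⟩⟩
  · intro a
    ext
    change s ((a : PadicAlgCl p) : ℂ_[p]) = ((a : PadicAlgCl p) : ℂ_[p])
    rw [hs]
    congr 1
    exact g.commutes a
  · intro x hx
    set q := Nat.card (IsLocalRing.ResidueField (OK K))
    change ‖s x - (x : ℂ_[p]) ^ q‖ < 1
    have hx : ‖(x : ℂ_[p])‖ ≤ 1 := hx
    have hcont : Continuous fun z : ℂ_[p] => s z - z ^ q := by fun_prop
    have hd := UniformSpace.Completion.denseRange_coe (α := PadicAlgCl p)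
    have hU : IsOpen ((fun z : ℂ_[p] => (s z - z ^ q) - (s x - (x : ℂ_[p]) ^ q)) ⁻¹'
        Metric.ball 0 1 ∩ Metric.ball (x : ℂ_[p]) 1) :=
      (Metric.isOpen_ball.preimage (by fun_prop)).inter Metric.isOpen_ball
    obtain ⟨z, hz1, hz2⟩ := hd.exists_mem_open hU ⟨(x : ℂ_[p]), by simp⟩
    rw [Set.mem_preimage, mem_ball_zero_iff, hs] at hz1
    rw [Metric.mem_ball, dist_eq_norm] at hz2
    have hz : ‖z‖ ≤ 1 := by
      rw [← PadicComplex.norm_extends p z]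
      have := IsUltrametricDist.norm_add_le_max ((z : ℂ_[p]) - x) x
      rw [sub_add_cancel] at this
      exact this.trans (max_le hz2.le hx)
    have h3 := hg z hz
    rw [← PadicComplex.norm_extends p] at h3
    have h4 : ((g z - z ^ q : PadicAlgCl p) : ℂ_[p]) = ((g z : PadicAlgCl p) : ℂ_[p]) - (z : ℂ_[p]) ^ q := by
      simp only [PadicComplex.coe_eq, map_sub, map_pow]
    rw [h4] at h3
    have hum : ∀ a b : ℂ_[p], ‖a - b‖ ≤ max ‖a‖ ‖b‖ := fun a b => by
      simpa [sub_eq_add_neg] using IsUltrametricDist.norm_add_le_max a (-b)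
    have := hum (((g z : PadicAlgCl p) : ℂ_[p]) - (z : ℂ_[p]) ^ q)
      ((((g z : PadicAlgCl p) : ℂ_[p]) - (z : ℂ_[p]) ^ q) - (s x - (x : ℂ_[p]) ^ q))
    rw [sub_sub_cancel] at this
    exact this.trans_lt (max_lt h3 hz1)

end Existence

/-! ### Isocrystals, lattices and slopes -/

section Isocrystals

variable {p : ℕ} [Fact p.Prime] {K : IntermediateField ℚ_[p] (PadicAlgCl p)}

/-- If `σ x` is integral, then so is `x`. -/
theorem RelFrobenius.mem_OL_of_map_mem (σ : RelFrobenius K) (x : L K)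
    (h : σ.toEquiv x ∈ OL K) : x ∈ OL K := by
  have hq : Nat.card (IsLocalRing.ResidueField (OK K)) ≠ 0 := by
    intro hq
    have h0 := σ.residue 0 (by simp)
    rw [hq] at h0
    simp at h0
  rw [mem_OL] at h ⊢
  by_contra! hx
  have hy : ‖x⁻¹‖ < 1 := by
    rw [norm_inv]
    exact inv_lt_one_of_one_lt₀ hx
  have h1 : ‖(x⁻¹) ^ Nat.card (IsLocalRing.ResidueField (OK K))‖ < 1 := by
    rw [norm_pow]
    exact pow_lt_one₀ (norm_nonneg _) hy hq
  have h2 : ‖σ.toEquiv x⁻¹‖ < 1 := by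
    have := IsUltrametricDist.norm_add_le_max
      (σ.toEquiv x⁻¹ - (x⁻¹) ^ Nat.card (IsLocalRing.ResidueField (OK K)))
      ((x⁻¹) ^ Nat.card (IsLocalRing.ResidueField (OK K)))
    rw [sub_add_cancel] at this
    exact this.trans_lt (max_lt (σ.residue _ hy.le) h1)
  rw [map_inv₀, norm_inv] at h2
  have hx0 : σ.toEquiv x ≠ 0 := by
    rw [Ne, map_eq_zero_iff _ σ.toEquiv.injective]
    rintro rfl
    simp at hx
    linarith
  have h3 := (inv_lt_one₀ (norm_pos_iff.mpr hx0)).mp h2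
  linarith

/-- The structure of an isocrystal on a vector space `N` over `L`: a `σ`-linear bijective
endomorphism. -/
structure Isocrystal (σ : RelFrobenius K) (N : Type*) [AddCommGroup N] [Module (L K) N] where
  /-- the `σ`-linear endomorphism -/
  toMap : N →ₛₗ[σ.hom] N
  bijective : Function.Bijective toMap

variable {σ : RelFrobenius K} {N : Type*} [AddCommGroup N] [Module (L K) N]

/-- The image `F M` of an `O_L`-submodule `M` of `N` under the Frobenius `F` of an isocrystal. -/
def Isocrystal.image (F : Isocrystal σ N) (M : Submodule (OL K) N) : Submodule (OL K) N where
  carrier := F.toMap '' M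
  zero_mem' := ⟨0, M.zero_mem, map_zero _⟩
  add_mem' := by
    rintro _ _ ⟨x, hx, rfl⟩ ⟨y, hy, rfl⟩
    exact ⟨x + y, M.add_mem hx hy, map_add _ _ _⟩
  smul_mem' := by
    rintro c _ ⟨x, hx, rfl⟩
    refine ⟨(⟨σ.toEquiv.symm c, σ.mem_OL_of_map_mem _ (by simp)⟩ : OL K) • x,
      M.smul_mem _ hx, ?_⟩
    change F.toMap (σ.toEquiv.symm (c : L K) • x) = (c : L K) • F.toMap x
    rw [map_smulₛₗ]
    simp [RelFrobenius.hom]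

/-- The multiple `c M` of an `O_L`-submodule `M` of `N` by an element `c` of `L`. -/
def scale (c : L K) (M : Submodule (OL K) N) : Submodule (OL K) N :=
  M.map ((LinearMap.lsmul (L K) N c).restrictScalars (OL K))

theorem mem_scale (c : L K) (M : Submodule (OL K) N) (x : N) :
    x ∈ scale c M ↔ ∃ y ∈ M, c • y = x :=
  Iff.rfl

/-- The subspace `W` of `N` is a sub-isocrystal which is isoclinic of slope `s = d / h` (in lowest
terms, `h > 0`): there is an `O_L`-lattice `M` in `W` with `F ^ h M = π ^ d M`. -/
def IsIsoclinic (π : K) (F : Isocrystal σ N) (W : Submodule (L K) N) (s : ℚ) : Prop :=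
  (∀ x ∈ W, F.toMap x ∈ W) ∧
    ∃ M : Submodule (OL K) N, M.FG ∧ Submodule.span (L K) (M : Set N) = W ∧
      F.image^[s.den] M = scale (inclL K π ^ s.num) M

/-- `ν` is the slope vector of the isocrystal `(N, F)`: its entries are in decreasing order, and `N`
is the direct sum of isoclinic sub-isocrystals `W s` of slope `s`, for `s` in `ℚ`, such that the
dimension of `W s` is the number of times that `s` occurs in `ν`. -/
def IsSlopeVector (π : K) (F : Isocrystal σ N) {n : ℕ} (ν : Fin n → ℚ) : Prop :=
  Antitone ν ∧ ∃ W : ℚ → Submodule (L K) N, DirectSum.IsInternal W ∧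
    ∀ s : ℚ, IsIsoclinic π F (W s) s ∧
      Module.finrank (L K) (W s) = (Finset.univ.filter fun i => ν i = s).card

/-- The isocrystal `(N, F)` of dimension `n` is minuscule of weight `r`: its slopes lie between `0`
and `1`, and their sum is `r`. -/
def IsMinuscule (π : K) (F : Isocrystal σ N) (n r : ℕ) : Prop :=
  ∃ ν : Fin n → ℚ, IsSlopeVector π F ν ∧ (∀ i, 0 ≤ ν i ∧ ν i ≤ 1) ∧ ∑ i, ν i = r

end Isocrystals

/-! ### Periodic lattice chains -/

section Chains

variable {p : ℕ} [Fact p.Prime] {K : IntermediateField ℚ_[p] (PadicAlgCl p)}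
  {N : Type*} [AddCommGroup N] [Module (L K) N]

/-- The length of the `O_L`-module `M / M'`, for submodules `M' ≤ M` of `N`. -/
def colength (M' M : Submodule (OL K) N) : ℕ∞ :=
  Module.length (OL K) (M ⧸ M'.submoduleOf M)

/-- The inverse image `I` in `ℤ` of a subset of `ℤ / n`. -/
abbrev Idx {n : ℕ} (I : Set (ZMod n)) : Type := {i : ℤ // (i : ZMod n) ∈ I}

/-- Periodic lattice chains of type `I ⊆ ℤ / n` in `N`. -/
@[ext]
structure Chain (π : K) (N : Type*) [AddCommGroup N] [Module (L K) N] {n : ℕ}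
    (I : Set (ZMod n)) where
  /-- the lattices `M i` -/
  M : Idx I → Submodule (OL K) N
  isLattice : ∀ i, (M i).IsLattice (L K)
  mono : ∀ i j : Idx I, i < j → M i ≤ M j
  length : ∀ i j : Idx I, i < j → colength (M i) (M j) = (((j : ℤ) - i).toNat : ℕ∞)
  periodic : ∀ i j : Idx I, (j : ℤ) = i + n → M j = scale (inclL K π)⁻¹ (M i)

/-- The forgetful map on periodic lattice chains. -/
def Chain.restrict {π : K} {n : ℕ} {I J : Set (ZMod n)} (h : J ⊆ I) (C : Chain π N I) :
    Chain π N J where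
  M i := C.M ⟨i, h i.2⟩
  isLattice _ := C.isLattice _
  mono _ _ hij := C.mono _ _ hij
  length _ _ hij := C.length _ _ hij
  periodic _ _ hij := C.periodic _ _ hij

/-- The set `X(ω_r, F)_I` of periodic lattice chains of type `I` with `π M_i ⊆ F M_i ⊆ M_i` and
`dim (M_i / F M_i) = r` for all `i`. Since `π` kills `M_i / F M_i`, its dimension over the residue
field of `O_L` is its length as an `O_L`-module. -/
def X (π : K) {σ : RelFrobenius K} (F : Isocrystal σ N) (r : ℕ) {n : ℕ} (I : Set (ZMod n)) :
    Set (Chain π N I) :=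
  {C | ∀ i, scale (inclL K π) (C.M i) ≤ F.image (C.M i) ∧ F.image (C.M i) ≤ C.M i ∧
    colength (F.image (C.M i)) (C.M i) = r}

/-- The forgetful map `X(ω_r, F)_I → X(ω_r, F)_J` for `J ⊆ I`. -/
def X.forget (π : K) {σ : RelFrobenius K} (F : Isocrystal σ N) (r : ℕ) {n : ℕ}
    {I J : Set (ZMod n)} (h : J ⊆ I) : X π F r I → X π F r J :=
  fun C => ⟨C.1.restrict h, fun i => C.2 ⟨i, h i.2⟩⟩

end Chains

end KR

end

/-!
Write `f` for the Frobenius of the isocrystal, acting on `O_L`-submodules, and `ϖ` for the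
uniformizer of `L`. A lattice `M` with `ϖ M ≤ f M ≤ M` is called stable; equivalently, `M` is stable
under `f` and under the Verschiebung `ϖ f⁻¹`. The length of `M / f M` is the same for all
`f`-stable lattices `M` spanning a given subspace (`KR.colength_smul_eq_of_span_eq`).

*Surjectivity of the forgetful maps.* It suffices to insert, between two successive members
`D < M` of a periodic chain of stable lattices, a stable lattice containing `D` with colength one
(`KR.exists_stable_step`). A minimal stable lattice above `D` gives a simple module over the residue
field with a Frobenius-linear map `f` and an inverse-Frobenius-linear map `ϖ f⁻¹` whose products
vanish. Over an algebraically closed field the two maps have a common eigenvector with eigenvalues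
`0` or `1`, by Lang's argument (`KR.exists_common_eigenvector`), so that the simple module has
length one. Iterating and extending by periodicity yields a full chain (`KR.exists_full_flag`). In
particular one stable lattice of the right colength gives chains of every type
(`KR.X.nonempty_of_lattice`). That the residue field of `L` is algebraically closed, and that `L`
has the value group of `K`, is deduced from Teichmüller representatives.

*Chains give minuscule isocrystals.* A stable lattice is in particular `f`-stable, and this makes
the slope decomposition elementary. For `s = d / h` the part of slope `s` is the union of the
lattices fixed by `ϖ⁻ᵈ fʰ`. If `s` is the mean slope of an `f`-stable subspace `U`, then either `U`
is bounded under `g = ϖ⁻ᵈ fʰ`, in which case comparing colengths produces a lattice with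
`fʰ M = ϖᵈ M`, or `U` is the sum of the proper subspaces bounded under `g` and under
`ϖ⁻¹ g⁻ᵏ` for some `k` (`KR.exists_le_boundedPart_sup`); the latter rests on the linear compactness
of lattices (`KR.exists_le_smul_sup_iInf`). Induction on the dimension shows that the slope parts
span (`KR.le_iSup_slopePart`), and they are independent because a lattice on which an
operator is bijective contains no nonzero vector contracted by that operator
(`KR.iSupIndep_slopePart`). The intersection of a stable lattice with a part `W` of slope `s` has
colength `s * dim W` under `f`, and this number lies between `0` and `dim W`
(`KR.isMinuscule_of_lattice`).

*Minuscule isocrystals have chains.* If `0 ≤ d / h ≤ 1` and `fʰ M = ϖᵈ M`, the sum of the lattices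
`fⁱ M` and `(ϖ f⁻¹)ⁱ M` for `i < h` is stable; the direct sum over the slopes is a stable
lattice of colength `r` (`KR.IsMinuscule.exists_lattice`).
-/

noncomputable section

namespace KR

/-! ### Roots of unity and ultrametric approximation -/

section
open Polynomial

/-- A root of unity of order prime to `p` is a fixed point of some power of `x ↦ x ^ p`. -/
theorem pow_pow_totient_mul_eq_self {p N : ℕ} (hN : p.Coprime N) {F : Type*} [NormedField F] {ζ : F} (hζ : ζ ^ N = 1) (k : ℕ) :
    ζ ^ p ^ (N.totient * k) = ζ := by
  by_cases hN0 : N = 1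
  · subst hN0
    rw [pow_one] at hζ
    rw [hζ, one_pow]
  have h := (Nat.ModEq.pow k (Nat.ModEq.pow_totient hN))
  rw [← pow_mul, one_pow] at h
  have : ζ ^ p ^ (N.totient * k) = ζ ^ 1 := by
    rw [← Nat.mod_add_div (p ^ (N.totient * k)) N, h, pow_add, pow_mul, hζ, one_pow, mul_one]
    conv_rhs => rw [← Nat.mod_add_div 1 N, pow_add, pow_mul, hζ, one_pow, mul_one]
  rw [this, pow_one]

theorem norm_eq_one_of_pow_eq_one' {N : ℕ} (hN : N ≠ 0) {F : Type*} [NormedField F] {ζ : F} (hζ : ζ ^ N = 1) : ‖ζ‖ = 1 := by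
  have : ‖ζ‖ ^ N = 1 := by rw [← norm_pow, hζ, norm_one]
  exact (pow_eq_one_iff_of_nonneg (norm_nonneg _) hN).mp this

section Ultrametric

variable {F : Type*} [NormedField F] [IsUltrametricDist F]

theorem norm_sub_le_max' (a b : F) : ‖a - b‖ ≤ max ‖a‖ ‖b‖ := by
  simpa [sub_eq_add_neg] using IsUltrametricDist.norm_add_le_max a (-b)

theorem norm_pow_prime_sub_le {p : ℕ} (hp : p.Prime) {a b : F} (hb : ‖b‖ ≤ 1)
    {c : ℝ} (hc : c ≤ 1) (hpc : ‖(p : F)‖ ≤ c) (hab : ‖a - b‖ ≤ c) :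
    ‖a ^ p - b ^ p‖ ≤ c * ‖a - b‖ := by
  have hc0 : 0 ≤ c := (norm_nonneg _).trans hpc
  have hd : ‖a - b‖ ≤ 1 := hab.trans hc
  obtain ⟨r, hr⟩ := exists_add_pow_prime_eq hp
    (⟨a - b, hd⟩ : (NormedField.valuation (K := F)).valuationSubring) ⟨b, hb⟩
  have hr' := congrArg Subtype.val hr
  push_cast at hr'
  simp only [sub_add_cancel] at hr'
  have hrn : ‖(r : F)‖ ≤ 1 := r.2
  have : a ^ p - b ^ p = (a - b) ^ p + p * (a - b) * b * r := by rw [hr']; ring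
  rw [this]
  refine (IsUltrametricDist.norm_add_le_max _ _).trans (max_le ?_ ?_)
  · obtain ⟨m, hm⟩ : ∃ m, p = m + 2 := ⟨p - 2, by have := hp.two_le; omega⟩
    rw [hm, norm_pow, pow_succ]
    refine mul_le_mul_of_nonneg_right ?_ (norm_nonneg _)
    rw [pow_succ]
    calc ‖a - b‖ ^ m * ‖a - b‖ ≤ 1 * c :=
          mul_le_mul (pow_le_one₀ (norm_nonneg _) hd) hab (norm_nonneg _) zero_le_one
      _ = c := one_mul c
  · rw [norm_mul, norm_mul, norm_mul]
    calc ‖(p : F)‖ * ‖a - b‖ * ‖b‖ * ‖(r : F)‖ ≤ ‖(p : F)‖ * ‖a - b‖ * 1 * 1 := by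
          gcongr
      _ ≤ c * ‖a - b‖ := by
          rw [mul_one, mul_one]; gcongr

/-- Raising to `p`-th powers repeatedly brings congruent integral elements together. -/
theorem tendsto_pow_prime_pow_sub {p : ℕ} (hp : p.Prime) (hpF : ‖(p : F)‖ < 1) {a b : F}
    (hb : ‖b‖ ≤ 1) (hab : ‖a - b‖ < 1) :
    Filter.Tendsto (fun k : ℕ => a ^ p ^ k - b ^ p ^ k) Filter.atTop (nhds 0) := by
  set c := max ‖(p : F)‖ ‖a - b‖ with hc
  have hc1 : c < 1 := max_lt hpF hab
  have hc0 : 0 ≤ c := (norm_nonneg _).trans (le_max_left _ _)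
  have key : ∀ k : ℕ, ‖a ^ p ^ k - b ^ p ^ k‖ ≤ c ^ (k + 1) := by
    intro k
    induction k with
    | zero => simp [hc]
    | succ k ih =>
      have h1 : ‖a ^ p ^ k - b ^ p ^ k‖ ≤ c :=
        ih.trans (pow_le_of_le_one hc0 hc1.le (Nat.succ_ne_zero k))
      have hb' : ‖b ^ p ^ k‖ ≤ 1 := by
        rw [norm_pow]; exact pow_le_one₀ (norm_nonneg _) hb
      have := norm_pow_prime_sub_le hp hb' hc1.le (le_max_left _ _) h1
      rw [pow_succ p k, pow_mul, pow_mul]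
      refine this.trans ?_
      rw [pow_succ c (k + 1), mul_comm]
      gcongr
  refine squeeze_zero_norm key ?_
  exact (tendsto_pow_atTop_nhds_zero_of_lt_one hc0 hc1).comp (Filter.tendsto_add_atTop_nat 1)

/-- The root of unity congruent to `z` is a limit of powers of `z`, so that it lies in every closed
subfield containing `z`. -/
theorem tendsto_pow_of_near_root {p : ℕ} (hp : p.Prime) (hpF : ‖(p : F)‖ < 1) {N : ℕ}
    (hN0 : N ≠ 0) (hN : p.Coprime N) {ζ z : F} (hζ : ζ ^ N = 1) (hz : ‖z - ζ‖ < 1) :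
    Filter.Tendsto (fun k : ℕ => z ^ p ^ (N.totient * k)) Filter.atTop (nhds ζ) := by
  have h := tendsto_pow_prime_pow_sub hp hpF (norm_eq_one_of_pow_eq_one' hN0 hζ).le hz
  have h2 := h.comp (Filter.tendsto_id.const_mul_atTop'
    (Nat.totient_pos.mpr (Nat.pos_of_ne_zero hN0)))
  have h3 := h2.add_const ζ
  rw [zero_add] at h3
  refine h3.congr fun k => ?_
  simp [pow_pow_totient_mul_eq_self hN hζ]

/-- Distinct roots of unity of order prime to `p` are not congruent. -/
theorem eq_of_roots_near {p : ℕ} (hp : p.Prime) (hpF : ‖(p : F)‖ < 1) {N : ℕ}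
    (hN0 : N ≠ 0) (hN : p.Coprime N) {ζ z : F} (hζ : ζ ^ N = 1) (hz' : z ^ N = 1)
    (hz : ‖z - ζ‖ < 1) : z = ζ := by
  have h := tendsto_pow_of_near_root hp hpF hN0 hN hζ hz
  simp only [pow_pow_totient_mul_eq_self hN hz'] at h
  exact tendsto_nhds_unique tendsto_const_nhds h

end Ultrametric

section LocalFields

variable {p : ℕ} [hp : Fact p.Prime]

theorem norm_p_lt_one : ‖(p : PadicAlgCl p)‖ < 1 := by
  have := PadicAlgCl.norm_extends p (p : ℚ_[p])
  rw [Padic.norm_p] at this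
  rw [map_natCast] at this
  rw [this]
  exact inv_lt_one_of_one_lt₀ (by exact_mod_cast hp.1.one_lt)

theorem prod_norm_lt_one {ι : Type*} {s : Multiset ι} {f : ι → ℝ} (h : (s.map f).prod < 1) : ∃ i ∈ s, f i < 1 := by
  by_contra! hh
  have : 1 ≤ (s.map f).prod := by
    refine Multiset.one_le_prod fun a ha => ?_
    obtain ⟨i, hi, rfl⟩ := Multiset.mem_map.mp ha
    exact hh i hi
  linarith

/-- If a monic polynomial takes a value of norm less than `1` at `z`, then `z` is congruent to one
of its roots. -/
theorem exists_root_near {F : Type*} [NormedField F] [IsAlgClosed F] {P : F[X]}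
    (hP : P.Monic) {z : F}
    (h : ‖P.eval z‖ < 1) : ∃ w ∈ P.roots, ‖z - w‖ < 1 := by
  have hs := (IsAlgClosed.splits P).eq_prod_roots_of_monic hP
  have : ‖P.eval z‖ = (P.roots.map fun w => ‖z - w‖).prod := by
    conv_lhs => rw [hs]
    rw [eval_multiset_prod, Multiset.map_map]
    have := map_multiset_prod (normHom : F →*₀ ℝ)
      (P.roots.map (fun w => z - w))
    rw [Multiset.map_map] at this
    simpa using this
  rw [this] at h
  exact prod_norm_lt_one h

theorem exists_root_of_unity_near_of_pow {F : Type*} [NormedField F] [IsAlgClosed F] {N : ℕ}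
    (hN : N ≠ 0) {z : F} (h : ‖z ^ N - 1‖ < 1) : ∃ ζ : F, ζ ^ N = 1 ∧ ‖z - ζ‖ < 1 := by
  have hm : (Polynomial.X ^ N - C 1 : F[X]).Monic := monic_X_pow_sub_C 1 hN
  have hev : (Polynomial.X ^ N - C 1 : F[X]).eval z = z ^ N - 1 := by
    rw [eval_sub, eval_pow, eval_X, eval_C]
  obtain ⟨w, hw, hzw⟩ := exists_root_near hm (hev ▸ h)
  refine ⟨w, ?_, hzw⟩
  have hr := (mem_roots'.mp hw).2
  rwa [IsRoot, eval_sub, eval_pow, eval_X, eval_C, sub_eq_zero] at hr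

/-- In a field with finite residue field, every unit of the ring of integers has a power of exponent
prime to the residue characteristic which is congruent to `1`. -/
theorem exists_pow_near_one {F : Type*} [NormedField F] [IsUltrametricDist F]
    [Finite (IsLocalRing.ResidueField (NormedField.valuation (K := F)).valuationSubring)]
    (hpF : ‖(p : F)‖ < 1) {z : F} (hz : ‖z‖ = 1) :
    ∃ N : ℕ, N ≠ 0 ∧ p.Coprime N ∧ ‖z ^ N - 1‖ < 1 := by
  set O := (NormedField.valuation (K := F)).valuationSubring with hO
  let z' : O := ⟨z, hz.le⟩
  let _ : Fintype (IsLocalRing.ResidueField O) := Fintype.ofFinite _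
  have hz0 : IsLocalRing.residue O z' ≠ 0 := by
    rw [Ne, IsLocalRing.residue_eq_zero_iff, max_iff]
    change ¬ ‖z‖ < 1
    rw [hz]; simp
  have hpow := FiniteField.pow_card_sub_one_eq_one _ hz0
  set q := Fintype.card (IsLocalRing.ResidueField O) with hq
  have hq2 : 1 < q := Fintype.one_lt_card
  have hqp : p ∣ q := by
    have h0 : (q : IsLocalRing.ResidueField O) = 0 := FiniteField.cast_card_eq_zero _
    rw [← map_natCast (IsLocalRing.residue O), IsLocalRing.residue_eq_zero_iff, max_iff] at h0
    by_contra hd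
    have hcop : IsCoprime (p : ℤ) q := by
      rw [Nat.isCoprime_iff_coprime]
      exact (Nat.Prime.coprime_iff_not_dvd hp.1).mpr hd
    obtain ⟨u, v, huv⟩ := hcop
    have h1 : ‖(q : F)‖ < 1 := h0
    have hint : ∀ m : ℤ, ‖(m : F)‖ ≤ 1 := fun m =>
      IsUltrametricDist.norm_intCast_le_one _ m
    have h3 : ((u * p + v * q : ℤ) : F) = 1 := by rw [huv]; simp
    push_cast at h3
    have h4 : ‖(u : F) * p + v * q‖ < 1 := by
      refine (IsUltrametricDist.norm_add_le_max _ _).trans_lt (max_lt ?_ ?_) <;> rw [norm_mul]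
      · exact (mul_le_of_le_one_left (norm_nonneg _) (hint u)).trans_lt hpF
      · exact (mul_le_of_le_one_left (norm_nonneg _) (hint v)).trans_lt h1
    rw [h3, norm_one] at h4
    exact lt_irrefl _ h4
  have hcop : p.Coprime (q - 1) := by
    rw [Nat.Prime.coprime_iff_not_dvd hp.1]
    intro hd
    have : p ∣ 1 := by
      have := (Nat.dvd_sub hqp hd)
      rwa [Nat.sub_sub_self hq2.le] at this
    exact hp.1.one_lt.ne' (Nat.dvd_one.mp this)
  refine ⟨q - 1, by omega, hcop, ?_⟩
  rw [← map_pow, ← map_one (IsLocalRing.residue O)] at hpow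
  have := (Ideal.Quotient.eq (I := IsLocalRing.maximalIdeal O)).mp hpow
  rw [max_iff] at this
  exact this

/-- Every unit of the ring of integers of the algebraic closure is congruent to a root of unity of
order prime to `p`. -/
theorem exists_root_of_unity_near {z : PadicAlgCl p} (hz : ‖z‖ = 1) :
    ∃ N : ℕ, N ≠ 0 ∧ p.Coprime N ∧ ∃ ζ : PadicAlgCl p, ζ ^ N = 1 ∧ ‖z - ζ‖ < 1 := by
  obtain ⟨E, hfd, hzE⟩ : ∃ E : IntermediateField ℚ_[p] (PadicAlgCl p),
      FiniteDimensional ℚ_[p] E ∧ z ∈ E :=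
    ⟨IntermediateField.adjoin ℚ_[p] {z},
      IntermediateField.adjoin.finiteDimensional (Algebra.IsIntegral.isIntegral z),
      IntermediateField.mem_adjoin_simple_self _ _⟩
  have hfin := finite_res E
  obtain ⟨N, hN0, hN, hnear⟩ := exists_pow_near_one (F := E) (p := p)
    (z := ⟨z, hzE⟩) (norm_p_lt_one (p := p)) hz
  exact ⟨N, hN0, hN, exists_root_of_unity_near_of_pow hN0 hnear⟩

end LocalFields

end

/-! ### Value groups of cyclotomic extensions -/

section
open Polynomial

section Cyclotomic

variable {p : ℕ} [hp : Fact p.Prime]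

/-- If no monic polynomial of degree less than `d` with integral coefficients is small at `ζ`, then a
polynomial of degree less than `d` with integral coefficients which is small at `ζ` has small
coefficients. -/
theorem coeff_lt_one_of_eval_lt_one {k F : Type*} [NormedField k] [NormedField F]
    [IsUltrametricDist F] [Algebra k F]
    (hnorm : ∀ a : k, ‖algebraMap k F a‖ = ‖a‖) {ζ : F} (hζ : ‖ζ‖ ≤ 1) {d : ℕ}
    (hd : ∀ P : k[X], P.Monic → (∀ i, ‖P.coeff i‖ ≤ 1) → P.natDegree < d → 1 ≤ ‖aeval ζ P‖)
    (s : k[X]) (hs : s.natDegree < d) (hs1 : ∀ i, ‖s.coeff i‖ ≤ 1) (hev : ‖aeval ζ s‖ < 1) (i : ℕ) :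
    ‖s.coeff i‖ < 1 := by
  induction hn : s.support.card using Nat.strong_induction_on generalizing s i with
  | _ n ih =>
  by_cases hs0 : s = 0
  · simp [hs0]
  have hlead : ‖s.leadingCoeff‖ < 1 := by
    refine lt_of_le_of_ne (hs1 _) fun h1 => ?_
    have hl0 : s.leadingCoeff ≠ 0 := leadingCoeff_ne_zero.mpr hs0
    have h2 := hd (C s.leadingCoeff⁻¹ * s) (by
      rw [Monic, leadingCoeff_mul, leadingCoeff_C, inv_mul_cancel₀ hl0]) (fun i => by
      rw [coeff_C_mul, norm_mul, norm_inv, h1, inv_one, one_mul]; exact hs1 i)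
      (by rwa [natDegree_C_mul (inv_ne_zero hl0)])
    rw [map_mul, aeval_C, norm_mul, hnorm, norm_inv, h1, inv_one, one_mul] at h2
    exact absurd hev (not_lt.mpr h2)
  by_cases hi : i = s.natDegree
  · rw [hi]; exact hlead
  have hrec : ‖aeval ζ s.eraseLead‖ < 1 := by
    have h3 := congrArg (aeval ζ) (eraseLead_add_C_mul_X_pow s)
    rw [map_add, map_mul, aeval_C, map_pow, aeval_X] at h3
    rw [← eq_sub_iff_add_eq] at h3
    rw [h3]
    refine (norm_sub_le_max' _ _).trans_lt (max_lt hev ?_)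
    rw [norm_mul, norm_pow, hnorm]
    exact (mul_le_of_le_one_right (norm_nonneg _) (pow_le_one₀ (norm_nonneg _) hζ)).trans_lt hlead
  have h4 := ih _ (hn ▸ eraseLead_support_card_lt hs0) s.eraseLead
    ((eraseLead_natDegree_le s).trans_lt (by omega)) (fun j => by
      rw [eraseLead_coeff]; split_ifs
      · simp
      · exact hs1 j) hrec i rfl
  rwa [eraseLead_coeff_of_ne _ hi] at h4

/-- Under the same assumption, the powers of `ζ` are orthonormal: the values at `ζ` of polynomials of
degree less than `d` have norms in the value group of the base field. -/
theorem exists_norm_aeval_eq {k F : Type*} [NormedField k] [NormedField F]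
    [IsUltrametricDist F] [Algebra k F]
    (hnorm : ∀ a : k, ‖algebraMap k F a‖ = ‖a‖) {ζ : F} (hζ : ‖ζ‖ ≤ 1) {d : ℕ}
    (hd : ∀ P : k[X], P.Monic → (∀ i, ‖P.coeff i‖ ≤ 1) → P.natDegree < d → 1 ≤ ‖aeval ζ P‖)
    (s : k[X]) (hs : s.natDegree < d) : ∃ y : k, ‖aeval ζ s‖ = ‖y‖ := by
  by_cases hs0 : s = 0
  · exact ⟨0, by simp [hs0]⟩
  obtain ⟨j, hj, hmax⟩ := s.support.exists_max_image (fun i => ‖s.coeff i‖)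
    (support_nonempty.mpr hs0)
  have hj0 : s.coeff j ≠ 0 := mem_support_iff.mp hj
  have hmax' : ∀ i, ‖s.coeff i‖ ≤ ‖s.coeff j‖ := fun i => by
    by_cases hi : i ∈ s.support
    · exact hmax i hi
    · rw [notMem_support_iff.mp hi, norm_zero]; exact norm_nonneg _
  refine ⟨s.coeff j, ?_⟩
  set t := C (s.coeff j)⁻¹ * s with ht
  have htc : ∀ i, ‖t.coeff i‖ ≤ 1 := fun i => by
    rw [ht, coeff_C_mul, norm_mul, norm_inv]
    exact inv_mul_le_one_of_le₀ (hmax' i) (norm_nonneg _)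
  have htd : t.natDegree < d := by rwa [ht, natDegree_C_mul (inv_ne_zero hj0)]
  have h1 : ¬ ‖aeval ζ t‖ < 1 := fun h => by
    have := coeff_lt_one_of_eval_lt_one hnorm hζ hd t htd htc h j
    rw [ht, coeff_C_mul, inv_mul_cancel₀ hj0, norm_one] at this
    exact lt_irrefl _ this
  have h2 : ‖aeval ζ t‖ ≤ 1 := by
    rw [aeval_eq_sum_range]
    refine IsUltrametricDist.norm_sum_le_of_forall_le_of_nonneg zero_le_one fun i _ => ?_
    rw [Algebra.smul_def, norm_mul, norm_pow, hnorm]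
    exact mul_le_one₀ (htc i) (by positivity) (pow_le_one₀ (norm_nonneg _) hζ)
  have h3 : ‖aeval ζ t‖ = 1 := le_antisymm h2 (not_lt.mp h1)
  rw [ht, map_mul, aeval_C, norm_mul, hnorm, norm_inv] at h3
  have h4 : ‖s.coeff j‖ ≠ 0 := norm_ne_zero_iff.mpr hj0
  field_simp at h3
  exact h3

variable (K : IntermediateField ℚ_[p] (PadicAlgCl p))

theorem norm_algebraMap_K (a : K) : ‖algebraMap K (PadicAlgCl p) a‖ = ‖a‖ := rfl

/-- The degree over `K` of a root of unity `ζ` of order prime to `p` is at most the degree of any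
monic integral polynomial which is small at `ζ`. Indeed the conjugates of `ζ` are
pairwise incongruent, and each is congruent to a root of that polynomial. -/
theorem natDegree_minpoly_le {N : ℕ} (hN0 : N ≠ 0) (hN : p.Coprime N) {ζ : PadicAlgCl p}
    (hζ : ζ ^ N = 1) {P : K[X]} (hP : P.Monic) (h : ‖aeval ζ P‖ < 1) :
    (minpoly K ζ).natDegree ≤ P.natDegree := by
  classical
  have := galK K
  have hint : IsIntegral K ζ := Algebra.IsIntegral.isIntegral ζ
  have hsep : (minpoly K ζ).Separable := Algebra.IsSeparable.isSeparable K ζ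
  have hcard := card_rootSet_eq_natDegree hsep (IsAlgClosed.splits ((minpoly K ζ).map
    (algebraMap K (PadicAlgCl p))))
  rw [← hcard]
  have hroot : ∀ ξ : (minpoly K ζ).rootSet (PadicAlgCl p),
      (ξ : PadicAlgCl p) ^ N = 1 ∧ ∃ w ∈ (P.map (algebraMap K (PadicAlgCl p))).roots,
        ‖(ξ : PadicAlgCl p) - w‖ < 1 := by
    rintro ⟨ξ, hξ⟩
    obtain ⟨τ, hτ⟩ := ((isConjRoot_iff_mem_minpoly_rootSet hint).mpr hξ).symm.exists_algEquiv
    change ξ ^ N = 1 ∧ ∃ w ∈ _, ‖ξ - w‖ < 1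
    refine ⟨by rw [← hτ, ← map_pow, hζ, map_one], exists_root_near (hP.map _) ?_⟩
    rw [eval_map_algebraMap, ← hτ]
    have : aeval (τ ζ) P = τ (aeval ζ P) := aeval_algHom_apply τ.toAlgHom ζ P
    rwa [this, norm_gal]
  choose hξN g hg hgn using hroot
  have hinj : Function.Injective fun ξ : (minpoly K ζ).rootSet (PadicAlgCl p) =>
      (⟨g ξ, Multiset.mem_toFinset.mpr (hg ξ)⟩ :
        (P.map (algebraMap K (PadicAlgCl p))).roots.toFinset) := by
    intro ξ ξ' h
    have h' : g ξ = g ξ' := congrArg Subtype.val h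
    refine Subtype.ext (eq_of_roots_near hp.1 norm_p_lt_one hN0 hN (hξN ξ') (hξN ξ) ?_)
    have : (ξ : PadicAlgCl p) - ξ' = (ξ - g ξ) - (ξ' - g ξ') := by rw [h']; ring
    rw [this]
    exact (norm_sub_le_max' _ _).trans_lt (max_lt (hgn _) (hgn _))
  refine (Fintype.card_le_of_injective _ hinj).trans ?_
  rw [Fintype.card_coe]
  refine (Multiset.toFinset_card_le _).trans ((card_roots' _).trans ?_)
  rw [hP.natDegree_map]

/-- The extension of `K` generated by a root of unity of order prime to `p` has the value group
of `K`. -/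
theorem exists_norm_eq_of_mem_adjoin_root {N : ℕ} (hN0 : N ≠ 0) (hN : p.Coprime N)
    {ζ : PadicAlgCl p} (hζ : ζ ^ N = 1) {x : PadicAlgCl p}
    (hx : x ∈ IntermediateField.adjoin K {ζ}) : ∃ y : K, ‖x‖ = ‖(y : PadicAlgCl p)‖ := by
  classical
  have hint : IsIntegral K ζ := Algebra.IsIntegral.isIntegral ζ
  have hζ1 : ‖ζ‖ ≤ 1 := (norm_eq_one_of_pow_eq_one' hN0 hζ).le
  have hex : ∃ d : ℕ, ∃ P : K[X], P.Monic ∧ (∀ i, ‖P.coeff i‖ ≤ 1) ∧ ‖aeval ζ P‖ < 1 ∧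
      P.natDegree = d := by
    refine ⟨_, (Polynomial.X ^ N - C 1 : K[X]), monic_X_pow_sub_C 1 hN0, fun i => ?_, ?_, rfl⟩
    · rw [coeff_sub, coeff_X_pow, coeff_C]
      refine (norm_sub_le_max' _ _).trans (max_le ?_ ?_) <;> split_ifs <;> simp
    · rw [map_sub, map_pow, aeval_X, aeval_C, map_one, hζ, sub_self, norm_zero]
      exact one_pos
  obtain ⟨P, hP, hP1, hPev, hPd⟩ := Nat.find_spec hex
  have hd : ∀ Q : K[X], Q.Monic → (∀ i, ‖Q.coeff i‖ ≤ 1) → Q.natDegree < Nat.find hex →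
      1 ≤ ‖aeval ζ Q‖ := by
    intro Q hQ hQ1 hQd
    by_contra! hlt
    exact Nat.find_min hex hQd ⟨Q, hQ, hQ1, hlt, rfl⟩
  have hdeg := natDegree_minpoly_le K hN0 hN hζ hP hPev
  have hx' : x ∈ Algebra.adjoin K {ζ} := by
    rw [← IntermediateField.adjoin_simple_toSubalgebra_of_isAlgebraic hint.isAlgebraic]
    exact hx
  rw [Algebra.adjoin_singleton_eq_range_aeval] at hx'
  obtain ⟨s, rfl⟩ := hx'
  have hmod := modByMonic_add_div s (minpoly K ζ)
  have hev : aeval ζ s = aeval ζ (s %ₘ minpoly K ζ) := by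
    conv_lhs => rw [← hmod]
    rw [map_add, map_mul, minpoly.aeval, zero_mul, add_zero]
  have hlt : (s %ₘ minpoly K ζ).natDegree < Nat.find hex :=
    (natDegree_modByMonic_lt _ (minpoly.monic hint) (minpoly.ne_one K ζ)).trans_le
      (hdeg.trans hPd.le)
  obtain ⟨y, hy⟩ := exists_norm_aeval_eq (norm_algebraMap_K K) hζ1 hd _ hlt
  exact ⟨y, (congrArg norm hev).trans hy⟩

/-- The roots of unity of order prime to `p`. -/
def primeRoots (p : ℕ) [Fact p.Prime] : Set (PadicAlgCl p) :=
  {ζ | ∃ N : ℕ, N ≠ 0 ∧ p.Coprime N ∧ ζ ^ N = 1}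

theorem primeRoots_subset_maxUnramified : primeRoots p ⊆ maxUnramified K := by
  rintro ζ ⟨N, hN0, hN, hζ⟩
  have : IntermediateField.adjoin K {ζ} ≤ maxUnramified K := by
    refine le_sSup ⟨?_, fun x hx => exists_norm_eq_of_mem_adjoin_root K hN0 hN hζ hx⟩
    exact IntermediateField.adjoin.finiteDimensional (Algebra.IsIntegral.isIntegral ζ)
  exact this (IntermediateField.mem_adjoin_simple_self _ _)

theorem exists_common_exponent {F : Type*} [Field F] {p : ℕ} (T : Finset F)
    (hT : ∀ ζ ∈ T, ∃ N : ℕ, N ≠ 0 ∧ p.Coprime N ∧ ζ ^ N = 1) :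
    ∃ m : ℕ, m ≠ 0 ∧ p.Coprime m ∧ ∀ ζ ∈ T, ζ ^ m = 1 := by
  classical
  induction T using Finset.induction_on with
  | empty => exact ⟨1, one_ne_zero, Nat.coprime_one_right p, by simp⟩
  | insert ζ T _ ih =>
    obtain ⟨m, hm0, hm, h⟩ := ih fun z hz => hT z (Finset.mem_insert_of_mem hz)
    obtain ⟨N, hN0, hN, hζ⟩ := hT ζ (Finset.mem_insert_self _ _)
    refine ⟨m * N, mul_ne_zero hm0 hN0, hm.mul_right hN, fun z hz => ?_⟩
    rcases Finset.mem_insert.mp hz with rfl | hz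
    · rw [mul_comm, pow_mul, hζ, one_pow]
    · rw [pow_mul, h z hz, one_pow]

theorem exists_norm_eq_of_mem_adjoin_primeRoots {x : PadicAlgCl p}
    (hx : x ∈ IntermediateField.adjoin K (primeRoots p)) :
    ∃ y : K, ‖x‖ = ‖(y : PadicAlgCl p)‖ := by
  classical
  obtain ⟨T, hT, hxT⟩ := IntermediateField.exists_finset_of_mem_adjoin hx
  -- all elements of `T` are powers of one root of unity of order prime to `p`
  obtain ⟨m, hm0, hm, hTm⟩ := exists_common_exponent T fun ζ hζ => hT hζ
  have : NeZero m := ⟨hm0⟩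
  have : NeZero (m : PadicAlgCl p) := ⟨Nat.cast_ne_zero.mpr hm0⟩
  obtain ⟨ζ, hζ⟩ := HasEnoughRootsOfUnity.exists_primitiveRoot (PadicAlgCl p) m
  have hmem : x ∈ IntermediateField.adjoin K {ζ} := by
    have hle : IntermediateField.adjoin K (T : Set (PadicAlgCl p)) ≤
        IntermediateField.adjoin K {ζ} := by
      rw [IntermediateField.adjoin_le_iff]
      intro z hz
      obtain ⟨i, -, rfl⟩ := hζ.eq_pow_of_pow_eq_one (hTm z hz)
      exact pow_mem (IntermediateField.mem_adjoin_simple_self _ _) i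
    exact hle hxT
  have h1 : ζ ^ m = 1 := hζ.pow_eq_one
  clear hT hTm hxT hx hζ
  exact exists_norm_eq_of_mem_adjoin_root K hm0 hm h1 hmem

end Cyclotomic

end

/-! ### The value group and the residue field of `L` -/

section
open Polynomial

section Unramified

variable {p : ℕ} [hp : Fact p.Prime] {K : IntermediateField ℚ_[p] (PadicAlgCl p)}

/-- The value group of `K` is generated by the norm of a uniformizer. -/
theorem IsUniformizer.exists_norm_eq_zpow {π : K} (hπ : IsUniformizer π) {x : K} (hx : x ≠ 0) :
    ∃ k : ℤ, ‖x‖ = ‖π‖ ^ k := by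
  obtain ⟨h0, h1, h2⟩ := hπ
  have hπ0 : 0 < ‖π‖ := norm_pos_iff.mpr h0
  obtain ⟨k, hk1, hk2⟩ := exists_mem_Ico_zpow (norm_pos_iff.mpr hx) ((one_lt_inv₀ hπ0).mpr h1)
  rw [inv_zpow] at hk1 hk2
  refine ⟨-k, ?_⟩
  rw [zpow_neg]
  refine le_antisymm ?_ hk1
  by_contra! hlt
  -- `x π ^ (k + 1)` has norm strictly between `‖π‖` and `1`
  have hn : ‖x * π ^ (k + 1)‖ < 1 := by
    rw [norm_mul, norm_zpow]
    rwa [← one_div, lt_div_iff₀ (zpow_pos hπ0 _)] at hk2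
  have h3 := h2 _ hn
  rw [norm_mul, norm_zpow, zpow_add_one₀ hπ0.ne', ← mul_assoc] at h3
  have h4 : ‖x‖ * ‖π‖ ^ k ≤ 1 := by
    by_contra! h
    nlinarith
  rw [← le_div_iff₀ (zpow_pos hπ0 _), one_div] at h4
  exact absurd h4 (not_le.mpr hlt)

theorem isClosed_of_finiteDimensional [FiniteDimensional ℚ_[p] K]
    (E : IntermediateField K (PadicAlgCl p)) [FiniteDimensional K E] :
    IsClosed (E : Set (PadicAlgCl p)) := by
  have h : FiniteDimensional ℚ_[p] E := FiniteDimensional.trans ℚ_[p] K E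
  let S : Submodule ℚ_[p] (PadicAlgCl p) :=
    (Subalgebra.toSubmodule E.toSubalgebra).restrictScalars ℚ_[p]
  have hS : FiniteDimensional ℚ_[p] S := h
  exact S.closed_of_finiteDimensional

/-- A finite unramified extension is generated by roots of unity of order prime to `p`: every
integral element has a Teichmüller expansion in the powers of `π`. -/
theorem IsFiniteUnramified.le_adjoin [FiniteDimensional ℚ_[p] K] {π : K} (hπ : IsUniformizer π)
    {E : IntermediateField K (PadicAlgCl p)} (hE : IsFiniteUnramified K E) :
    E ≤ IntermediateField.adjoin K (primeRoots p) := by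
  have hfd := hE.1
  have hEc := isClosed_of_finiteDimensional E
  set E' := E ⊓ IntermediateField.adjoin K (primeRoots p) with hE'
  have hE'fd : FiniteDimensional K E' :=
    Submodule.finiteDimensional_of_le (S₁ := Subalgebra.toSubmodule E'.toSubalgebra)
      (S₂ := Subalgebra.toSubmodule E.toSubalgebra) (inf_le_left : E' ≤ E)
  have hE'c := isClosed_of_finiteDimensional E'
  have hπ0 : 0 < ‖π‖ := norm_pos_iff.mpr hπ.1
  have hπm : ∀ k : ℤ, (π : PadicAlgCl p) ^ k ∈ E' := fun k => zpow_mem (E'.algebraMap_mem π) k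
  have hπ0' : (π : PadicAlgCl p) ≠ 0 := by simpa using hπ.1
  -- a first approximation by `0` or by a root of unity
  have step : ∀ z ∈ E, ‖z‖ ≤ 1 → ∃ t ∈ E', ‖z - t‖ ≤ ‖π‖ := by
    intro z hz hz1
    have hsmall : ∀ w ∈ E, ‖w‖ < 1 → ‖w‖ ≤ ‖π‖ := by
      intro w hw hw1
      obtain ⟨y, hy⟩ := hE.2 w hw
      rw [hy] at hw1 ⊢
      exact hπ.2.2 y hw1
    rcases lt_or_eq_of_le hz1 with h | h
    · exact ⟨0, zero_mem _, by rw [sub_zero]; exact hsmall z hz h⟩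
    · obtain ⟨N, hN0, hN, ζ, hζ, hzζ⟩ := exists_root_of_unity_near h
      have hlim := tendsto_pow_of_near_root hp.1 norm_p_lt_one hN0 hN hζ hzζ
      have hζE : ζ ∈ E := hEc.mem_of_tendsto hlim (Filter.Eventually.of_forall fun k =>
        pow_mem hz _)
      refine ⟨ζ, ⟨hζE, IntermediateField.subset_adjoin _ _ ⟨N, hN0, hN, hζ⟩⟩, ?_⟩
      exact hsmall _ (sub_mem hz hζE) hzζ
  have key : ∀ x ∈ E, ‖x‖ ≤ 1 → ∀ k : ℕ, ∃ y ∈ E', ‖x - y‖ ≤ ‖π‖ ^ k := by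
    intro x hx hx1 k
    induction k with
    | zero => exact ⟨0, zero_mem _, by simpa using hx1⟩
    | succ k ih =>
      obtain ⟨y, hy, hxy⟩ := ih
      have hm : ((π : PadicAlgCl p) ^ (k : ℤ))⁻¹ * (x - y) ∈ E :=
        mul_mem (inv_mem (hπm k).1) (sub_mem hx hy.1)
      obtain ⟨t, ht, hzt⟩ := step _ hm (by
        rw [norm_mul, norm_inv, zpow_natCast, norm_pow]
        exact inv_mul_le_one_of_le₀ hxy (by positivity))
      refine ⟨y + (π : PadicAlgCl p) ^ (k : ℤ) * t, add_mem hy (mul_mem (hπm _) ht), ?_⟩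
      have : x - (y + (π : PadicAlgCl p) ^ (k : ℤ) * t) = (π : PadicAlgCl p) ^ (k : ℤ) *
          (((π : PadicAlgCl p) ^ (k : ℤ))⁻¹ * (x - y) - t) := by
        rw [mul_sub, mul_inv_cancel_left₀ (zpow_ne_zero _ hπ0')]; ring
      rw [this, norm_mul, pow_succ, zpow_natCast, norm_pow]
      rw [zpow_natCast] at hzt
      exact mul_le_mul_of_nonneg_left hzt (by positivity)
  have key2 : ∀ x ∈ E, ‖x‖ ≤ 1 → x ∈ E' := by
    intro x hx hx1
    choose y hy hxy using key x hx hx1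
    refine hE'c.mem_of_tendsto (f := y) (b := Filter.atTop) ?_ (Filter.Eventually.of_forall hy)
    rw [tendsto_iff_norm_sub_tendsto_zero]
    refine squeeze_zero (fun _ => norm_nonneg _) (fun k => ?_)
      (tendsto_pow_atTop_nhds_zero_of_lt_one hπ0.le hπ.2.1)
    rw [norm_sub_rev]; exact hxy k
  intro x hx
  by_cases hx0 : x = 0
  · rw [hx0]; exact zero_mem _
  have hx0' : 0 < ‖x‖ := norm_pos_iff.mpr hx0
  obtain ⟨k, hk⟩ := exists_pow_lt_of_lt_one (inv_pos.mpr hx0') hπ.2.1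
  have h1 : ‖(π : PadicAlgCl p) ^ (k : ℤ) * x‖ ≤ 1 := by
    rw [norm_mul, zpow_natCast, norm_pow]
    rw [← one_div, lt_div_iff₀ hx0'] at hk
    exact hk.le
  have h2 := (key2 _ (mul_mem (hπm k).1 hx) h1).2
  have h3 := mul_mem (inv_mem (hπm k).2) h2
  rwa [inv_mul_cancel_left₀ (zpow_ne_zero _ hπ0')] at h3

theorem exists_norm_eq_of_mem_maxUnramified [FiniteDimensional ℚ_[p] K] {π : K}
    (hπ : IsUniformizer π) {x : PadicAlgCl p} (hx : x ∈ maxUnramified K) :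
    ∃ y : K, ‖x‖ = ‖(y : PadicAlgCl p)‖ :=
  exists_norm_eq_of_mem_adjoin_primeRoots K ((sSup_le fun _ hE =>
    IsFiniteUnramified.le_adjoin hπ hE : maxUnramified K ≤ _) hx)

theorem norm_inclL (a : K) : ‖inclL K a‖ = ‖a‖ := PadicComplex.norm_extends p (a : PadicAlgCl p)

/-- The extension `L` of `K` has the value group of `K`. -/
theorem exists_norm_L_eq [FiniteDimensional ℚ_[p] K] {π : K} (hπ : IsUniformizer π) {x : L K}
    (hx : x ≠ 0) : ∃ k : ℤ, ‖x‖ = ‖inclL K π‖ ^ k := by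
  have hx0 : 0 < ‖(x : ℂ_[p])‖ := norm_pos_iff.mpr (by simpa using hx)
  obtain ⟨_, ⟨y, hy, rfl⟩, hxy⟩ := Metric.mem_closure_iff.mp
    (show (x : ℂ_[p]) ∈ closure _ from x.2) _ hx0
  rw [dist_eq_norm] at hxy
  have h1 : ‖(x : ℂ_[p])‖ = ‖algebraMap (PadicAlgCl p) ℂ_[p] y‖ := by
    refine le_antisymm ?_ ?_
    · by_contra! hlt
      have := IsUltrametricDist.norm_add_le_max ((x : ℂ_[p]) - algebraMap (PadicAlgCl p) ℂ_[p] y)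
        (algebraMap (PadicAlgCl p) ℂ_[p] y)
      rw [sub_add_cancel] at this
      exact lt_irrefl _ (this.trans_lt (max_lt hxy hlt))
    · have := norm_sub_le_max' (x : ℂ_[p]) ((x : ℂ_[p]) - algebraMap (PadicAlgCl p) ℂ_[p] y)
      rw [sub_sub_cancel, max_eq_left hxy.le] at this
      exact this
  have h2 : ‖algebraMap (PadicAlgCl p) ℂ_[p] y‖ = ‖y‖ := PadicComplex.norm_extends p y
  obtain ⟨w, hw⟩ := exists_norm_eq_of_mem_maxUnramified hπ hy
  have h3 : ‖x‖ = ‖w‖ := h1.trans (h2.trans hw)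
  have hw0 : w ≠ 0 := by
    rintro rfl
    rw [norm_zero] at h3
    exact hx (norm_eq_zero.mp h3)
  obtain ⟨k, hk⟩ := hπ.exists_norm_eq_zpow hw0
  exact ⟨k, by rw [h3, hk, norm_inclL]⟩

/-- An integral element of the algebraic closure is congruent to an element of `L`. -/
theorem exists_L_near {w : PadicAlgCl p} (hw : ‖w‖ ≤ 1) :
    ∃ x : L K, ‖x‖ ≤ 1 ∧ ‖algebraMap (PadicAlgCl p) ℂ_[p] w - x‖ < 1 := by
  rcases lt_or_eq_of_le hw with h | h
  · refine ⟨0, by simp, ?_⟩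
    rw [ZeroMemClass.coe_zero, sub_zero]
    exact (PadicComplex.norm_extends p w).trans_lt h
  · obtain ⟨N, hN0, hN, ζ, hζ, hzζ⟩ := exists_root_of_unity_near h
    have hm := primeRoots_subset_maxUnramified K ⟨N, hN0, hN, hζ⟩
    refine ⟨⟨algebraMap (PadicAlgCl p) ℂ_[p] ζ, Subfield.le_topologicalClosure _ ⟨ζ, hm, rfl⟩⟩,
      ?_, ?_⟩
    · exact ((PadicComplex.norm_extends p ζ).trans (norm_eq_one_of_pow_eq_one' hN0 hζ)).le
    · change ‖algebraMap (PadicAlgCl p) ℂ_[p] w - algebraMap (PadicAlgCl p) ℂ_[p] ζ‖ < 1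
      rw [← map_sub]
      exact (PadicComplex.norm_extends p _).trans_lt hzζ

/-- The residue field of `L` is algebraically closed, as it is that of `ℂ_[p]`. -/
instance isAlgClosed_residueField : IsAlgClosed (IsLocalRing.ResidueField (OL K)) := by
  refine IsAlgClosed.of_exists_root _ fun f hf hirr => ?_
  obtain ⟨g, hg, hgd, hgm⟩ := lifts_and_natDegree_eq_and_monic
    (mem_lifts_of_surjective IsLocalRing.residue_surjective f) hf
  let O : ValuationSubring ℂ_[p] := (NormedField.valuation (K := ℂ_[p])).valuationSubring
  let ψ : OL K →+* O := ((L K).subtype.comp (OL K).subtype).codRestrict O fun a => a.2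
  have hd0 : ((g.map ψ).map (algebraMap O ℂ_[p])).degree ≠ 0 := by
    rw [(hgm.map ψ).degree_map, hgm.degree_map, degree_eq_natDegree hgm.ne_zero, hgd]
    have := hirr.natDegree_pos
    exact_mod_cast this.ne'
  obtain ⟨z, hz⟩ := IsAlgClosed.exists_root _ hd0
  rw [IsRoot, eval_map] at hz
  obtain ⟨z, rfl⟩ := IsIntegrallyClosed.isIntegral_iff.mp (⟨_, hgm.map ψ, hz⟩ : IsIntegral O z)
  rw [eval₂_at_apply] at hz
  replace hz : (g.map ψ).eval z = 0 := Subtype.ext hz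
  obtain ⟨w, hw⟩ := UniformSpace.Completion.denseRange_coe.exists_dist_lt (z : ℂ_[p]) one_pos
  rw [dist_eq_norm] at hw
  replace hw : ‖(z : ℂ_[p]) - algebraMap (PadicAlgCl p) ℂ_[p] w‖ < 1 := hw
  have hw1 : ‖w‖ ≤ 1 := by
    have h1 := norm_sub_le_max' (z : ℂ_[p]) ((z : ℂ_[p]) - algebraMap (PadicAlgCl p) ℂ_[p] w)
    rw [sub_sub_cancel] at h1
    have h2 : ‖(z : ℂ_[p])‖ ≤ 1 := z.2
    exact (PadicComplex.norm_extends p w).symm.le.trans (h1.trans (max_le h2 hw.le))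
  obtain ⟨x, hx1, hx⟩ := exists_L_near (K := K) hw1
  let x' : OL K := ⟨x, hx1⟩
  have hzx : ‖((ψ x' : O) : ℂ_[p]) - z‖ < 1 := by
    have : ((ψ x' : O) : ℂ_[p]) - z = -((z : ℂ_[p]) - algebraMap (PadicAlgCl p) ℂ_[p] w)
        - (algebraMap (PadicAlgCl p) ℂ_[p] w - x) := by
      change (x : ℂ_[p]) - z = _
      ring
    rw [this]
    refine (norm_sub_le_max' _ _).trans_lt (max_lt ?_ hx)
    rwa [norm_neg]
  obtain ⟨c, hc⟩ := sub_dvd_eval_sub (ψ x') z (g.map ψ)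
  rw [hz, sub_zero, eval_map, eval₂_at_apply] at hc
  refine ⟨IsLocalRing.residue (OL K) x', ?_⟩
  rw [← hg, eval_map, eval₂_at_apply, IsLocalRing.residue_eq_zero_iff, max_iff]
  have hc' : ((ψ (g.eval x') : O) : ℂ_[p]) = (((ψ x' : O) : ℂ_[p]) - z) * c :=
    congrArg Subtype.val hc
  change ‖((ψ (g.eval x') : O) : ℂ_[p])‖ < 1
  rw [hc', norm_mul]
  exact (mul_le_of_le_one_right (norm_nonneg _) c.2).trans_lt hzx

end Unramified

end

/-! ### The ring of integers of `L` -/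

section IntegersOfL

variable {p : ℕ} [hp : Fact p.Prime] {K : IntermediateField ℚ_[p] (PadicAlgCl p)}

instance completeSpace_L : CompleteSpace (L K) :=
  (Subfield.isClosed_topologicalClosure _ : IsClosed ((L K : Subfield ℂ_[p]) : Set ℂ_[p])).completeSpace_coe

/-- `ϖ` is a uniformizer of `L`: the value group of `L` is generated by `‖ϖ‖ < 1`. -/
class IsLUniformizer (ϖ : L K) : Prop where
  ne_zero : ϖ ≠ 0
  norm_lt_one : ‖ϖ‖ < 1
  exists_zpow : ∀ x : L K, x ≠ 0 → ∃ k : ℤ, ‖x‖ = ‖ϖ‖ ^ k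

theorem IsUniformizer.isLUniformizer [FiniteDimensional ℚ_[p] K] {π : K} (hπ : IsUniformizer π) :
    IsLUniformizer (inclL K π) where
  ne_zero := (map_ne_zero _).mpr hπ.1
  norm_lt_one := by rw [norm_inclL]; exact hπ.2.1
  exists_zpow _ hx := exists_norm_L_eq hπ hx

section
variable (ϖ : L K) [hϖ : IsLUniformizer ϖ]

theorem norm_unif_pos : 0 < ‖ϖ‖ := norm_pos_iff.mpr hϖ.ne_zero

theorem exists_eq_unif_zpow_mul {x : L K} (hx : x ≠ 0) :
    ∃ (k : ℤ) (u : L K), ‖u‖ = 1 ∧ x = ϖ ^ k * u := by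
  obtain ⟨k, hk⟩ := hϖ.exists_zpow x hx
  refine ⟨k, (ϖ ^ k)⁻¹ * x, ?_, ?_⟩
  · rw [norm_mul, norm_inv, norm_zpow, hk, inv_mul_cancel₀]
    exact (zpow_pos (norm_unif_pos ϖ) k).ne'
  · rw [mul_inv_cancel_left₀ (zpow_ne_zero _ hϖ.ne_zero)]

theorem norm_le_of_norm_lt_one {x : L K} (hx : ‖x‖ < 1) : ‖x‖ ≤ ‖ϖ‖ := by
  by_cases hx0 : x = 0
  · simp [hx0]
  obtain ⟨k, hk⟩ := hϖ.exists_zpow x hx0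
  rw [hk] at hx ⊢
  have h0 := norm_unif_pos ϖ
  have hk0 : 0 < k := by
    by_contra! h
    have := zpow_le_zpow_right_of_le_one₀ h0 hϖ.norm_lt_one.le h
    rw [zpow_zero] at this
    linarith
  have := zpow_le_zpow_right_of_le_one₀ h0 hϖ.norm_lt_one.le (show (1 : ℤ) ≤ k by omega)
  rwa [zpow_one] at this

/-- A uniformizer of `L` as an element of the ring of integers. -/
def unif : OL K := ⟨ϖ, hϖ.norm_lt_one.le⟩

theorem dvd_of_norm_le {x y : OL K} (h : ‖(x : L K)‖ ≤ ‖(y : L K)‖) : y ∣ x := by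
  by_cases hy : (y : L K) = 0
  · have : (x : L K) = 0 := by simpa [hy] using h
    exact ⟨0, Subtype.ext (by simp [this])⟩
  refine ⟨⟨(y : L K)⁻¹ * x, ?_⟩, Subtype.ext ?_⟩
  · change ‖(y : L K)⁻¹ * x‖ ≤ 1
    rw [norm_mul, norm_inv]
    exact inv_mul_le_one_of_le₀ h (norm_nonneg _)
  · exact (mul_inv_cancel_left₀ hy _).symm

theorem mem_maximalIdeal_iff_unif_dvd {x : OL K} :
    x ∈ IsLocalRing.maximalIdeal (OL K) ↔ unif ϖ ∣ x := by
  rw [max_iff]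
  constructor
  · intro h
    exact dvd_of_norm_le (norm_le_of_norm_lt_one ϖ h)
  · rintro ⟨y, rfl⟩
    change ‖ϖ * (y : L K)‖ < 1
    rw [norm_mul]
    exact (mul_le_of_le_one_right (norm_nonneg _) y.2).trans_lt hϖ.norm_lt_one

theorem maximalIdeal_eq_span_unif :
    IsLocalRing.maximalIdeal (OL K) = Ideal.span {unif ϖ} := by
  ext x
  rw [mem_maximalIdeal_iff_unif_dvd ϖ, Ideal.mem_span_singleton]

theorem isDiscreteValuationRing_OL (ϖ : L K) [hϖ : IsLUniformizer ϖ] : IsDiscreteValuationRing (OL K) := by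
  have hϖ0 : unif ϖ ≠ 0 := fun h => hϖ.ne_zero (congrArg Subtype.val h)
  have hprime : Prime (unif ϖ) := by
    rw [← Ideal.span_singleton_prime hϖ0, ← maximalIdeal_eq_span_unif]
    infer_instance
  refine IsDiscreteValuationRing.ofHasUnitMulPowIrreducibleFactorization
    ⟨unif ϖ, hprime.irreducible, fun {x} hx => ?_⟩
  have hx0 : (x : L K) ≠ 0 := fun h => hx (Subtype.ext h)
  obtain ⟨k, hk⟩ := hϖ.exists_zpow x hx0
  have hk0 : 0 ≤ k := by
    by_contra! h
    have h1 : ‖(x : L K)‖ ≤ 1 := x.2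
    rw [hk] at h1
    have := one_lt_zpow_of_neg₀ (norm_unif_pos ϖ) hϖ.norm_lt_one h
    linarith
  lift k to ℕ using hk0
  have h1 : ‖((unif ϖ ^ k : OL K) : L K)‖ = ‖(x : L K)‖ := by
    rw [hk, zpow_natCast, ← norm_pow]; rfl
  exact ⟨k, associated_of_dvd_dvd (dvd_of_norm_le h1.ge) (dvd_of_norm_le h1.le)⟩

/-- Completeness of `O_L`: power series in `ϖ` converge. -/
theorem exists_tails {a : ℕ → OL K} :
    ∃ s : ℕ → OL K, ∀ j, s j = a j + unif ϖ * s (j + 1) := by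
  have hsum : ∀ j, Summable fun i : ℕ => ϖ ^ i * (a (j + i) : L K) := fun j =>
    Summable.of_norm_bounded (summable_geometric_of_lt_one (norm_nonneg ϖ) hϖ.norm_lt_one)
      fun i => by
        rw [norm_mul, norm_pow]
        exact mul_le_of_le_one_right (by positivity) (a (j + i)).2
  refine ⟨fun j => ⟨∑' i : ℕ, ϖ ^ i * (a (j + i) : L K), ?_⟩, fun j => Subtype.ext ?_⟩
  · refine IsUltrametricDist.norm_tsum_le_of_forall_le_of_nonneg zero_le_one fun i => ?_
    rw [norm_mul, norm_pow]
    exact mul_le_one₀ (pow_le_one₀ (norm_nonneg _) hϖ.norm_lt_one.le) (norm_nonneg _) (a (j + i)).2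
  · change ∑' i : ℕ, ϖ ^ i * (a (j + i) : L K) =
      (a j : L K) + ϖ * ∑' i : ℕ, ϖ ^ i * (a (j + 1 + i) : L K)
    rw [(hsum j).tsum_eq_zero_add, ← tsum_mul_left]
    simp only [pow_zero, one_mul, add_zero]
    congr 2
    funext i
    rw [← mul_assoc, ← pow_succ', add_assoc, add_comm 1 i]
end

theorem RelFrobenius.norm_le_one (σ : RelFrobenius K) {x : L K} (hx : ‖x‖ ≤ 1) :
    ‖σ.toEquiv x‖ ≤ 1 := by
  have h := IsUltrametricDist.norm_add_le_max
    (σ.toEquiv x - x ^ Nat.card (IsLocalRing.ResidueField (OK K)))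
    (x ^ Nat.card (IsLocalRing.ResidueField (OK K)))
  rw [sub_add_cancel] at h
  refine h.trans (max_le (σ.residue x hx).le ?_)
  rw [norm_pow]
  exact pow_le_one₀ (norm_nonneg _) hx

/-- The relative Frobenius is an isometry. -/
theorem RelFrobenius.norm_map (σ : RelFrobenius K) {π : K} [hϖ : IsLUniformizer (inclL K π)]
    (x : L K) : ‖σ.toEquiv x‖ = ‖x‖ := by
  by_cases hx : x = 0
  · simp [hx]
  obtain ⟨k, u, hu, rfl⟩ := exists_eq_unif_zpow_mul (inclL K π) hx
  have hu0 : u ≠ 0 := by rintro rfl; simp at hu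
  have h1 : ‖σ.toEquiv u‖ = 1 := by
    refine le_antisymm (σ.norm_le_one hu.le) ?_
    have h2 : ‖σ.toEquiv u⁻¹‖ ≤ 1 := σ.norm_le_one (by rw [norm_inv, hu, inv_one])
    rw [map_inv₀, norm_inv] at h2
    exact (inv_le_one₀ (norm_pos_iff.mpr ((map_ne_zero _).mpr hu0))).mp h2
  rw [map_mul, map_zpow₀, σ.fixes, norm_mul, norm_mul, h1, hu]

end IntegersOfL

/-! ### Semilinear automorphisms -/

section SemiAut

variable {p : ℕ} [hp : Fact p.Prime] {K : IntermediateField ℚ_[p] (PadicAlgCl p)}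

/-- The group of all bijections of `N` which are semilinear for some isometric automorphism of `L`
fixing `ϖ`. It contains the Frobenius of every isocrystal on `N` and the multiplication by `ϖ`. -/
def semiAut (ϖ : L K) (N : Type*) [AddCommGroup N] [Module (L K) N] :
    Subgroup (Equiv.Perm N) where
  carrier := {g | ∃ τ : L K ≃+* L K, (∀ c, ‖τ c‖ = ‖c‖) ∧ τ ϖ = ϖ ∧
    (∀ x y, g (x + y) = g x + g y) ∧ ∀ c x, g (c • x) = τ c • g x}
  one_mem' := ⟨RingEquiv.refl _, fun _ => rfl, rfl, fun _ _ => rfl, fun _ _ => rfl⟩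
  mul_mem' := by
    rintro g h ⟨τ, h1, h2, h3, h4⟩ ⟨τ', h1', h2', h3', h4'⟩
    refine ⟨τ'.trans τ, fun c => by simp [h1, h1'], by simp [h2, h2'], fun x y => ?_,
      fun c x => ?_⟩
    · simp [h3, h3']
    · simp [h4, h4']
  inv_mem' := by
    rintro g ⟨τ, h1, h2, h3, h4⟩
    refine ⟨τ.symm, fun c => by rw [← h1, RingEquiv.apply_symm_apply],
      by rw [RingEquiv.symm_apply_eq, h2], fun x y => ?_, fun c x => ?_⟩
    · rw [Equiv.Perm.inv_eq_iff_eq, h3, Equiv.Perm.inv_def, Equiv.apply_symm_apply,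
        Equiv.apply_symm_apply]
    · rw [Equiv.Perm.inv_eq_iff_eq, h4, Equiv.Perm.inv_def, Equiv.apply_symm_apply,
        RingEquiv.apply_symm_apply]

variable {ϖ : L K} {N : Type*} [AddCommGroup N] [Module (L K) N]

instance : DistribMulAction (semiAut ϖ N) N where
  smul_add g x y := by
    obtain ⟨τ, -, -, h, -⟩ := g.2
    exact h x y
  smul_zero g := by
    obtain ⟨τ, -, -, h, -⟩ := g.2
    have := h 0 0
    rw [add_zero] at this
    exact left_eq_add.mp this

theorem exists_semilinear (g : semiAut ϖ N) : ∃ τ : L K ≃+* L K, (∀ c, ‖τ c‖ = ‖c‖) ∧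
    ∀ (c : L K) (x : N), g • c • x = τ c • g • x := by
  obtain ⟨τ, h1, -, -, h4⟩ := g.2
  exact ⟨τ, h1, h4⟩

theorem exists_semilinear_OL (g : semiAut ϖ N) : ∃ τ : OL K ≃+* OL K,
    ∀ (c : OL K) (x : N), g • c • x = τ c • g • x := by
  obtain ⟨τ, h1, h4⟩ := exists_semilinear g
  refine ⟨⟨⟨fun c => ⟨τ c, by rw [mem_OL, h1]; exact c.2⟩,
    fun c => ⟨τ.symm c, by rw [mem_OL, ← h1, RingEquiv.apply_symm_apply]; exact c.2⟩,
    fun c => by simp, fun c => by simp⟩, fun a b => by ext; simp, fun a b => by ext; simp⟩,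
    fun c x => h4 c x⟩

/-- The action of a semilinear automorphism on `O_L`-submodules, by taking images. -/
instance : MulAction (semiAut ϖ N) (Submodule (OL K) N) where
  smul g M :=
    { carrier := {x | g⁻¹ • x ∈ M}
      zero_mem' := by simp
      add_mem' := fun {x y} hx hy => by
        change g⁻¹ • (x + y) ∈ M
        rw [smul_add]; exact M.add_mem hx hy
      smul_mem' := fun c x hx => by
        obtain ⟨τ, h⟩ := exists_semilinear_OL g⁻¹
        change g⁻¹ • c • x ∈ M
        rw [h]; exact M.smul_mem _ hx }
  one_smul M := by
    ext x
    change (1 : semiAut ϖ N)⁻¹ • x ∈ M ↔ x ∈ M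
    rw [inv_one, one_smul]
  mul_smul g h M := by
    ext x
    change (g * h)⁻¹ • x ∈ M ↔ h⁻¹ • g⁻¹ • x ∈ M
    rw [mul_inv_rev, mul_smul]

theorem mem_smul_iff {g : semiAut ϖ N} {M : Submodule (OL K) N} {x : N} :
    x ∈ g • M ↔ g⁻¹ • x ∈ M := Iff.rfl

theorem smul_mem_smul {g : semiAut ϖ N} {M : Submodule (OL K) N} {x : N} :
    g • x ∈ g • M ↔ x ∈ M := by rw [mem_smul_iff, inv_smul_smul]

theorem smul_le_smul {g : semiAut ϖ N} {M M' : Submodule (OL K) N} :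
    g • M ≤ g • M' ↔ M ≤ M' := by
  constructor
  · intro h x hx
    exact smul_mem_smul.mp (h (smul_mem_smul.mpr hx))
  · intro h x hx
    exact h hx

/-- The action on `O_L`-submodules by order automorphisms. -/
def smulIso (g : semiAut ϖ N) : Submodule (OL K) N ≃o Submodule (OL K) N where
  toEquiv := MulAction.toPerm g
  map_rel_iff' := smul_le_smul

theorem smul_sup' (g : semiAut ϖ N) (M M' : Submodule (OL K) N) :
    g • (M ⊔ M') = g • M ⊔ g • M' := (smulIso g).map_sup M M'

theorem smul_inf' (g : semiAut ϖ N) (M M' : Submodule (OL K) N) :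
    g • (M ⊓ M') = g • M ⊓ g • M' := (smulIso g).map_inf M M'

theorem smul_iSup' {ι : Sort*} (g : semiAut ϖ N) (M : ι → Submodule (OL K) N) :
    g • (⨆ i, M i) = ⨆ i, g • M i := (smulIso g).map_iSup M

theorem smul_bot' (g : semiAut ϖ N) : g • (⊥ : Submodule (OL K) N) = ⊥ := (smulIso g).map_bot

theorem smul_le_iff_le_inv_smul {g : semiAut ϖ N} {M M' : Submodule (OL K) N} :
    g • M ≤ M' ↔ M ≤ g⁻¹ • M' := by
  rw [← smul_le_smul (g := g) (M' := g⁻¹ • M'), smul_inv_smul]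

theorem smul_span' (g : semiAut ϖ N) (s : Set N) :
    g • Submodule.span (OL K) s = Submodule.span (OL K) ((fun x => g • x) '' s) := by
  refine le_antisymm ?_ (Submodule.span_le.mpr ?_)
  · rw [smul_le_iff_le_inv_smul, Submodule.span_le]
    intro x hx
    rw [SetLike.mem_coe, mem_smul_iff, inv_inv]
    exact Submodule.subset_span ⟨x, hx, rfl⟩
  · rintro _ ⟨x, hx, rfl⟩
    exact smul_mem_smul.mpr (Submodule.subset_span hx)

theorem fg_smul {g : semiAut ϖ N} {M : Submodule (OL K) N} (hM : M.FG) : (g • M).FG := by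
  classical
  obtain ⟨s, rfl⟩ := hM
  rw [smul_span']
  exact ⟨s.image fun x => g • x, by rw [Finset.coe_image]⟩

/-- Multiplication by `ϖ` as a semilinear automorphism. -/
def unifAut (ϖ : L K) [hϖ : IsLUniformizer ϖ] (N : Type*) [AddCommGroup N] [Module (L K) N] :
    semiAut ϖ N :=
  ⟨⟨fun x => ϖ • x, fun x => ϖ⁻¹ • x, fun x => inv_smul_smul₀ hϖ.ne_zero x,
    fun x => smul_inv_smul₀ hϖ.ne_zero x⟩,
    RingEquiv.refl _, fun _ => rfl, rfl, fun x y => smul_add ϖ x y,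
    fun c x => smul_comm ϖ c x⟩

section
variable [hϖ : IsLUniformizer ϖ]

theorem unifAut_smul (x : N) : unifAut ϖ N • x = ϖ • x := rfl

theorem unifAut_zpow_smul (k : ℤ) (x : N) : unifAut ϖ N ^ k • x = ϖ ^ k • x := by
  induction k using Int.induction_on with
  | zero => simp
  | succ k ih => rw [zpow_add_one, zpow_add_one₀ hϖ.ne_zero, (Commute.refl _).zpow_left _ |>.eq,
      mul_smul, ih, unifAut_smul, smul_smul, mul_comm]
  | pred k ih =>
    rw [zpow_sub_one, zpow_sub_one₀ hϖ.ne_zero, mul_comm (ϖ ^ _), mul_smul (ϖ⁻¹), ← ih,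
      ((Commute.refl (unifAut ϖ N)).inv_right.zpow_left _).eq, mul_smul]
    rfl

theorem unifAut_pow_smul (k : ℕ) (x : N) : unifAut ϖ N ^ k • x = ϖ ^ k • x := by
  have := unifAut_zpow_smul (ϖ := ϖ) (k : ℤ) x
  rwa [zpow_natCast, zpow_natCast] at this

theorem unifAut_commute (g : semiAut ϖ N) : Commute g (unifAut ϖ N) := by
  refine Subtype.ext (Equiv.ext fun x => ?_)
  obtain ⟨τ, -, h2, -, h4⟩ := g.2
  change (g : Equiv.Perm N) (ϖ • x) = ϖ • (g : Equiv.Perm N) x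
  rw [h4, h2]

theorem unifAut_smul_le (M : Submodule (OL K) N) : unifAut ϖ N • M ≤ M := by
  intro x hx
  have : x = unif ϖ • (unifAut ϖ N)⁻¹ • x := (smul_inv_smul (unifAut ϖ N) x).symm
  rw [this]
  exact M.smul_mem _ hx

theorem scale_unif (M : Submodule (OL K) N) : scale ϖ M = unifAut ϖ N • M := by
  ext x
  rw [mem_scale, mem_smul_iff]
  constructor
  · rintro ⟨y, hy, rfl⟩
    rwa [← unifAut_smul, inv_smul_smul]
  · intro h
    exact ⟨_, h, smul_inv_smul (unifAut ϖ N) x⟩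

theorem scale_unif_zpow (k : ℤ) (M : Submodule (OL K) N) :
    scale (ϖ ^ k) M = unifAut ϖ N ^ k • M := by
  ext x
  rw [mem_scale, mem_smul_iff]
  constructor
  · rintro ⟨y, hy, rfl⟩
    rwa [← unifAut_zpow_smul, inv_smul_smul]
  · intro h
    exact ⟨_, h, by rw [← unifAut_zpow_smul, smul_inv_smul]⟩

theorem scale_unif_inv (M : Submodule (OL K) N) : scale ϖ⁻¹ M = (unifAut ϖ N)⁻¹ • M := by
  have := scale_unif_zpow (ϖ := ϖ) (-1) M
  rwa [zpow_neg_one, zpow_neg_one] at this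

end

/-- The Frobenius of an isocrystal as a semilinear automorphism. -/
def Isocrystal.aut {π : K} [IsLUniformizer (inclL K π)] {σ : RelFrobenius K}
    (F : Isocrystal σ N) : semiAut (inclL K π) N :=
  ⟨Equiv.ofBijective F.toMap F.bijective, σ.toEquiv, σ.norm_map (π := π), σ.fixes π,
    fun x y => map_add F.toMap x y, fun c x => map_smulₛₗ F.toMap c x⟩

theorem Isocrystal.image_eq {π : K} [IsLUniformizer (inclL K π)] {σ : RelFrobenius K}
    (F : Isocrystal σ N) (M : Submodule (OL K) N) : F.image M = F.aut (π := π) • M := by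
  ext x
  constructor
  · rintro ⟨y, hy, rfl⟩
    exact smul_mem_smul.mpr hy
  · intro h
    exact ⟨_, h, smul_inv_smul (F.aut (π := π)) x⟩

theorem Isocrystal.image_iterate_eq {π : K} [IsLUniformizer (inclL K π)] {σ : RelFrobenius K}
    (F : Isocrystal σ N) (k : ℕ) (M : Submodule (OL K) N) :
    F.image^[k] M = F.aut (π := π) ^ k • M := by
  induction k with
  | zero => simp
  | succ k ih => rw [Function.iterate_succ_apply', ih, F.image_eq (π := π), pow_succ', mul_smul]

end SemiAut

/-! ### Colength of lattices -/

section Generic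

variable {R V : Type*} [CommRing R] [AddCommGroup V] [Module R V]

theorem length_submoduleOf_add {A B C : Submodule R V} (hAB : A ≤ B) (hBC : B ≤ C) :
    Module.length R (C ⧸ A.submoduleOf C) =
      Module.length R (B ⧸ A.submoduleOf B) + Module.length R (C ⧸ B.submoduleOf C) := by
  have h1 : A.submoduleOf B ≤ (A.submoduleOf C).comap (Submodule.inclusion hBC) := fun x hx => hx
  have h2 : A.submoduleOf C ≤ (B.submoduleOf C).comap LinearMap.id := fun x hx => hAB hx
  refine Module.length_eq_add_of_exact (Submodule.mapQ _ _ (Submodule.inclusion hBC) h1)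
    (Submodule.mapQ _ _ LinearMap.id h2) ?_ ?_ ?_
  · rw [injective_iff_map_eq_zero]
    intro x hx
    obtain ⟨x, rfl⟩ := Submodule.mkQ_surjective _ x
    rw [Submodule.mkQ_apply, Submodule.mapQ_apply, Submodule.Quotient.mk_eq_zero] at hx
    exact (Submodule.Quotient.mk_eq_zero _).mpr hx
  · intro x
    obtain ⟨x, rfl⟩ := Submodule.mkQ_surjective _ x
    exact ⟨Submodule.Quotient.mk x, Submodule.mapQ_apply _ _ _ _⟩
  · intro x
    obtain ⟨x, rfl⟩ := Submodule.mkQ_surjective _ x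
    rw [Submodule.mkQ_apply, Submodule.mapQ_apply, Submodule.Quotient.mk_eq_zero]
    constructor
    · intro hx
      exact ⟨Submodule.Quotient.mk ⟨x, hx⟩, Submodule.mapQ_apply _ _ _ _⟩
    · rintro ⟨y, hy⟩
      obtain ⟨y, rfl⟩ := Submodule.mkQ_surjective _ y
      rw [Submodule.mkQ_apply, Submodule.mapQ_apply, Submodule.Quotient.eq] at hy
      have h3 := B.sub_mem y.2 (hAB hy)
      change (x : V) ∈ B
      simpa using h3

/-- Here `S` is the submodule `t V`, and `t` generates the maximal ideal. -/
theorem length_quotient_smul_eq_finrank [IsDomain R] [IsLocalRing R] [Module.Free R V]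
    [Module.Finite R V] {t : R} (ht : IsLocalRing.maximalIdeal R = Ideal.span {t})
    {S : Submodule R V} (hS : ∀ x, x ∈ S ↔ ∃ y, t • y = x) :
    Module.length R (V ⧸ S) = Module.finrank R V := by
  let b := Module.Free.chooseBasis R V
  have hmap : S.map (b.equivFun : V →ₗ[R] (Module.Free.ChooseBasisIndex R V → R)) =
      Submodule.pi Set.univ fun _ => IsLocalRing.maximalIdeal R := by
    ext f
    simp only [Submodule.mem_map, Submodule.mem_pi, Set.mem_univ, true_implies, ht,
      Ideal.mem_span_singleton, hS]
    constructor
    · rintro ⟨_, ⟨y, rfl⟩, rfl⟩ i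
      exact ⟨b.equivFun y i, by simp⟩
    · intro h
      choose g hg using h
      have hfg : f = t • g := funext hg
      refine ⟨_, ⟨b.equivFun.symm g, rfl⟩, ?_⟩
      rw [LinearEquiv.coe_coe, map_smul, LinearEquiv.apply_symm_apply, hfg]
  have e1 := Submodule.Quotient.equiv _ _ b.equivFun hmap
  have e2 := Submodule.quotientPi fun _ : Module.Free.ChooseBasisIndex R V =>
    IsLocalRing.maximalIdeal R
  have h1 : Module.length R (R ⧸ IsLocalRing.maximalIdeal R) = 1 := by
    rw [Module.length_eq_one_iff, isSimpleModule_iff_isCoatom]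
    exact Ideal.isMaximal_def.mp inferInstance
  rw [(e1.trans e2).length_eq, Module.length_pi, h1, Module.finrank_eq_card_chooseBasisIndex]
  simp

theorem finrank_eq_finrank_span {E : Type*} [Field E] [Algebra R E] [IsDomain R]
    [IsFractionRing R E] [Module E V] [IsScalarTower R E V] {M : Submodule R V}
    [Module.Free R M] [Module.Finite R M] :
    Module.finrank R M = Module.finrank E (Submodule.span E (M : Set V)) := by
  let b := Module.Free.chooseBasis R M
  have hli : LinearIndependent E fun i => (b i : V) := by
    rw [← LinearIndependent.iff_fractionRing (R := R)]
    exact b.linearIndependent.map' M.subtype M.ker_subtype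
  have h1 : Submodule.span R (Set.range fun i => (b i : V)) = M := by
    have := congrArg (Submodule.map M.subtype) b.span_eq
    rw [Submodule.map_span, ← Set.range_comp, Submodule.map_top, Submodule.range_subtype] at this
    exact this
  have hsp : Submodule.span E (Set.range fun i => (b i : V)) =
      Submodule.span E (M : Set V) := by
    rw [← Submodule.span_span_of_tower R E (Set.range fun i => (b i : V)), h1]
  rw [← hsp, finrank_span_eq_card hli, Module.finrank_eq_card_chooseBasisIndex]

end Generic

section Colength

variable {p : ℕ} [hp : Fact p.Prime] {K : IntermediateField ℚ_[p] (PadicAlgCl p)}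
  {N : Type*} [AddCommGroup N] [Module (L K) N]

/-- The submodules of the quotient `B / A` are the submodules between `A` and `B`. -/
def quotientIccIso {A B : Submodule (OL K) N} (h : A ≤ B) :
    Submodule (OL K) (B ⧸ A.submoduleOf B) ≃o Set.Icc A B where
  toFun P := ⟨(P.comap (A.submoduleOf B).mkQ).map B.subtype, by
    constructor
    · intro x hx
      refine ⟨⟨x, h hx⟩, ?_, rfl⟩
      change (A.submoduleOf B).mkQ ⟨x, h hx⟩ ∈ P
      rw [show (A.submoduleOf B).mkQ ⟨x, h hx⟩ = 0 from
        (Submodule.Quotient.mk_eq_zero _).mpr hx]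
      exact P.zero_mem
    · exact Submodule.map_subtype_le _ _⟩
  invFun C := (C.1.submoduleOf B).map (A.submoduleOf B).mkQ
  left_inv P := by
    change (((P.comap (A.submoduleOf B).mkQ).map B.subtype).comap B.subtype).map _ = P
    rw [Submodule.comap_map_eq_of_injective B.injective_subtype,
      Submodule.map_comap_eq_of_surjective (Submodule.mkQ_surjective _)]
  right_inv C := by
    refine Subtype.ext ?_
    change (((C.1.submoduleOf B).map (A.submoduleOf B).mkQ).comap
      (A.submoduleOf B).mkQ).map B.subtype = C.1
    rw [Submodule.comap_map_mkQ, sup_eq_right.mpr (Submodule.comap_mono C.2.1)]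
    exact Submodule.map_comap_eq_self (by rw [Submodule.range_subtype]; exact C.2.2)
  map_rel_iff' {P Q} := by
    change (P.comap (A.submoduleOf B).mkQ).map B.subtype ≤
      (Q.comap (A.submoduleOf B).mkQ).map B.subtype ↔ P ≤ Q
    rw [Submodule.map_le_map_iff_of_injective B.injective_subtype,
      Submodule.comap_le_comap_iff_of_surjective (Submodule.mkQ_surjective _)]

theorem colength_eq_krullDim {A B : Submodule (OL K) N} (h : A ≤ B) :
    (colength A B : WithBot ℕ∞) = Order.krullDim (Set.Icc A B) := by
  rw [colength, Module.coe_length]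
  exact Order.krullDim_eq_of_orderIso (quotientIccIso h)

/-- Colengths are invariant under semilinear automorphisms, as they only depend on the lattice of
submodules between the two given ones. -/
theorem colength_smul {ϖ : L K} (g : semiAut ϖ N) {A B : Submodule (OL K) N} (h : A ≤ B) :
    colength (g • A) (g • B) = colength A B := by
  have : (colength (g • A) (g • B) : WithBot ℕ∞) = colength A B := by
    rw [colength_eq_krullDim h, colength_eq_krullDim (smul_le_smul.mpr h)]
    refine (Order.krullDim_eq_of_orderIso ?_).symm
    exact
      { toFun := fun C => ⟨g • C.1, smul_le_smul.mpr C.2.1, smul_le_smul.mpr C.2.2⟩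
        invFun := fun C => ⟨g⁻¹ • C.1, smul_le_iff_le_inv_smul.mp C.2.1, by
          rw [smul_le_iff_le_inv_smul, inv_inv]; exact C.2.2⟩
        left_inv := fun C => Subtype.ext (inv_smul_smul g C.1)
        right_inv := fun C => Subtype.ext (smul_inv_smul g C.1)
        map_rel_iff' := smul_le_smul }
  exact_mod_cast this

theorem colength_add {A B C : Submodule (OL K) N} (hAB : A ≤ B) (hBC : B ≤ C) :
    colength A C = colength A B + colength B C :=
  length_submoduleOf_add hAB hBC

theorem colength_inf_left (A B : Submodule (OL K) N) :
    colength (A ⊓ B) A = colength B (A ⊔ B) :=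
  (LinearMap.quotientInfEquivSupQuotient A B).length_eq

theorem colength_eq_zero_iff {A B : Submodule (OL K) N} : colength A B = 0 ↔ B ≤ A := by
  rw [colength, Module.length_eq_zero_iff, Submodule.Quotient.subsingleton_iff,
    Submodule.submoduleOf_eq_top]

theorem colength_self (A : Submodule (OL K) N) : colength A A = 0 :=
  colength_eq_zero_iff.mpr le_rfl

instance faithfulSMul_OL : FaithfulSMul (OL K) (L K) :=
  (faithfulSMul_iff_algebraMap_injective _ _).mpr Subtype.val_injective

theorem isTorsionFree_OL : Module.IsTorsionFree (OL K) N :=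
  Module.IsTorsionFree.trans_faithfulSMul (OL K) (L K) N

variable {ϖ : L K} [hϖ : IsLUniformizer ϖ]

theorem mem_unifAut_smul_iff {M : Submodule (OL K) N} {x : N} :
    x ∈ unifAut ϖ N • M ↔ ∃ y ∈ M, ϖ • y = x := by
  rw [← scale_unif, mem_scale]

variable [IsDiscreteValuationRing (OL K)]

/-- If `M` is a lattice in a space of dimension `m`, then `M / ϖ M` has length `m`. -/
theorem colength_unifAut_smul {M : Submodule (OL K) N} (hM : M.FG) :
    colength (unifAut ϖ N • M) M =
      Module.finrank (L K) (Submodule.span (L K) (M : Set N)) := by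
  have : Module.Finite (OL K) M := Module.Finite.iff_fg.mpr hM
  have : Module.IsTorsionFree (OL K) N := isTorsionFree_OL
  rw [colength, ← finrank_eq_finrank_span (R := OL K) (E := L K) (V := N)]
  refine length_quotient_smul_eq_finrank (maximalIdeal_eq_span_unif ϖ) fun x => ?_
  change (x : N) ∈ unifAut ϖ N • M ↔ _
  rw [mem_unifAut_smul_iff]
  constructor
  · rintro ⟨y, hy, h⟩
    exact ⟨⟨y, hy⟩, Subtype.ext h⟩
  · rintro ⟨y, h⟩
    exact ⟨y, y.2, congrArg Subtype.val h⟩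

end Colength

/-! ### Lattices in a vector space over `L` -/

section Lattices

variable {p : ℕ} [hp : Fact p.Prime] {K : IntermediateField ℚ_[p] (PadicAlgCl p)}
  {N : Type*} [AddCommGroup N] [Module (L K) N] {ϖ : L K}

theorem pow_smul_le {g : semiAut ϖ N} {M : Submodule (OL K) N} (h : g • M ≤ M) (k : ℕ) :
    g ^ k • M ≤ M := by
  induction k with
  | zero => simp
  | succ k ih =>
    rw [pow_succ, mul_smul]
    exact (smul_le_smul.mpr h).trans ih

theorem pow_smul_anti {g : semiAut ϖ N} {M : Submodule (OL K) N} (h : g • M ≤ M) {j k : ℕ}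
    (hjk : j ≤ k) : g ^ k • M ≤ g ^ j • M := by
  obtain ⟨i, rfl⟩ := Nat.exists_eq_add_of_le hjk
  rw [pow_add, mul_smul]
  exact smul_le_smul.mpr (pow_smul_le h i)

theorem colength_pow_smul {g : semiAut ϖ N} {M : Submodule (OL K) N} (h : g • M ≤ M) (k : ℕ) :
    colength (g ^ k • M) M = k * colength (g • M) M := by
  induction k with
  | zero => simp [colength_self]
  | succ k ih =>
    rw [colength_add (pow_smul_anti h k.le_succ) (pow_smul_le h k), ih, pow_succ, mul_smul,
      colength_smul _ h]
    push_cast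
    ring

theorem colength_mono_left {A B C : Submodule (OL K) N} (hAB : A ≤ B) (hBC : B ≤ C) :
    colength B C ≤ colength A C := by
  rw [colength_add hAB hBC]; exact le_add_self

theorem colength_mono_right {A B C : Submodule (OL K) N} (hAB : A ≤ B) (hBC : B ≤ C) :
    colength A B ≤ colength A C := by
  rw [colength_add hAB hBC]; exact le_self_add

theorem eq_of_colength_eq {A B C : Submodule (OL K) N} (hAB : A ≤ B) (hBC : B ≤ C)
    (h : colength A C = colength B C) (hf : colength B C ≠ ⊤) : A = B := by
  rw [colength_add hAB hBC] at h
  have h0 : colength A B = 0 := by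
    have : colength A B + colength B C = 0 + colength B C := by rw [h, zero_add]
    exact WithTop.add_right_cancel hf this
  exact le_antisymm hAB (colength_eq_zero_iff.mp h0)

variable [hϖ : IsLUniformizer ϖ]

theorem exists_pow_smul_mem {A : Submodule (OL K) N} {x : N}
    (hx : x ∈ Submodule.span (L K) (A : Set N)) : ∃ c : ℕ, ϖ ^ c • x ∈ A := by
  have hmono : ∀ {y : N} {c d : ℕ}, ϖ ^ c • y ∈ A → ϖ ^ (d + c) • y ∈ A := by
    intro y c d h
    rw [pow_add, mul_smul]
    exact A.smul_mem (unif ϖ ^ d) h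
  induction hx using Submodule.span_induction with
  | mem x hx => exact ⟨0, by simpa using hx⟩
  | zero => exact ⟨0, by simp⟩
  | add x y _ _ hx hy =>
    obtain ⟨c, hc⟩ := hx
    obtain ⟨d, hd⟩ := hy
    refine ⟨c + d, ?_⟩
    rw [smul_add]
    exact A.add_mem (add_comm c d ▸ hmono hc) (hmono hd)
  | smul a x _ hx =>
    obtain ⟨c, hc⟩ := hx
    obtain ⟨d, hd⟩ : ∃ d : ℕ, ‖ϖ ^ d * a‖ ≤ 1 := by
      by_cases ha : a = 0
      · exact ⟨0, by simp [ha]⟩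
      have ha' : 0 < ‖a‖ := norm_pos_iff.mpr ha
      obtain ⟨d, hd⟩ := exists_pow_lt_of_lt_one (inv_pos.mpr ha') hϖ.norm_lt_one
      refine ⟨d, ?_⟩
      rw [← one_div, lt_div_iff₀ ha'] at hd
      rw [norm_mul, norm_pow]; exact hd.le
    refine ⟨d + c, ?_⟩
    have : ϖ ^ (d + c) • a • x = (⟨ϖ ^ d * a, hd⟩ : OL K) • ϖ ^ c • x := by
      change _ = (ϖ ^ d * a) • ϖ ^ c • x
      rw [smul_smul, smul_smul, pow_add]; congr 1; ring
    rw [this]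
    exact A.smul_mem _ hc

theorem mem_unifAut_pow_smul_iff {M : Submodule (OL K) N} {x : N} {k : ℕ} :
    x ∈ unifAut ϖ N ^ k • M ↔ ∃ y ∈ M, ϖ ^ k • y = x := by
  constructor
  · intro h
    exact ⟨_, h, by rw [← unifAut_pow_smul, smul_inv_smul]⟩
  · rintro ⟨y, hy, rfl⟩
    rw [← unifAut_pow_smul]
    exact smul_mem_smul.mpr hy

/-- Lattices in the same space are commensurable. -/
theorem exists_unifAut_pow_smul_le {A B : Submodule (OL K) N} (hB : B.FG)
    (h : (B : Set N) ⊆ Submodule.span (L K) (A : Set N)) : ∃ c : ℕ, unifAut ϖ N ^ c • B ≤ A := by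
  classical
  obtain ⟨s, rfl⟩ := hB
  have hs : ∀ x ∈ s, ∃ c : ℕ, ϖ ^ c • x ∈ A := fun x hx =>
    exists_pow_smul_mem (h (Submodule.subset_span hx))
  choose! c hc using hs
  refine ⟨s.sup c, ?_⟩
  rw [smul_span', Submodule.span_le]
  rintro _ ⟨x, hx, rfl⟩
  change unifAut ϖ N ^ s.sup c • x ∈ A
  obtain ⟨d, hd⟩ := Nat.exists_eq_add_of_le' (Finset.le_sup (f := c) hx)
  rw [unifAut_pow_smul, hd, pow_add, mul_smul]
  exact A.smul_mem (unif ϖ ^ d) (hc x hx)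

/-- Finitely generated submodules are complete for the `ϖ`-adic topology. -/
theorem exists_limit {M : Submodule (OL K) N} (hM : M.FG) {x : ℕ → N}
    (hx0 : x 0 ∈ M) (hx : ∀ k, x (k + 1) - x k ∈ unifAut ϖ N ^ k • M) :
    ∃ y ∈ M, ∀ k, y - x k ∈ unifAut ϖ N ^ k • M := by
  classical
  obtain ⟨s, rfl⟩ := hM
  have h1 : ∀ k, ∃ f : N → OL K, x (k + 1) - x k = ϖ ^ k • ∑ i ∈ s, f i • i := by
    intro k
    obtain ⟨y, hy, h⟩ := mem_unifAut_pow_smul_iff.mp (hx k)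
    obtain ⟨f, -, hf⟩ := Submodule.mem_span_finset.mp hy
    exact ⟨f, by rw [hf, h]⟩
  choose f hf using h1
  choose t ht using fun i : N => exists_tails ϖ (a := fun k => f k i)
  have hmem : ∀ k, ∑ i ∈ s, t i k • i ∈ Submodule.span (OL K) (s : Set N) := fun k =>
    Submodule.sum_mem _ fun i hi => Submodule.smul_mem _ _ (Submodule.subset_span hi)
  have key : ∀ k, x 0 + ∑ i ∈ s, t i 0 • i - x k = ϖ ^ k • ∑ i ∈ s, t i k • i := by
    intro k
    induction k with
    | zero => simp
    | succ k ih =>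
      have h2 : ∑ i ∈ s, t i k • i = ∑ i ∈ s, f k i • i + ϖ • ∑ i ∈ s, t i (k + 1) • i := by
        rw [Finset.smul_sum, ← Finset.sum_add_distrib]
        refine Finset.sum_congr rfl fun i _ => ?_
        rw [ht i k, add_smul, mul_smul]
        rfl
      rw [h2, smul_add, ← hf, smul_smul, ← pow_succ] at ih
      rw [← add_right_inj (x (k + 1) - x k), ← ih]
      abel
  refine ⟨_, Submodule.add_mem _ hx0 (hmem 0), fun k => ?_⟩
  rw [key k]
  exact mem_unifAut_pow_smul_iff.mpr ⟨_, hmem k, rfl⟩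

variable [IsDiscreteValuationRing (OL K)]

theorem eq_zero_of_forall_mem_pow {M : Submodule (OL K) N} (hM : M.FG) {x : N}
    (h : ∀ k : ℕ, x ∈ unifAut ϖ N ^ k • M) : x = 0 := by
  have : Module.Finite (OL K) M := Module.Finite.iff_fg.mpr hM
  have hx : x ∈ M := by simpa using h 0
  have h1 : (⟨x, hx⟩ : M) ∈ (⨅ i : ℕ, IsLocalRing.maximalIdeal (OL K) ^ i • ⊤ : Submodule (OL K) M) := by
    rw [Submodule.mem_iInf]
    intro k
    obtain ⟨y, hy, h⟩ := mem_unifAut_pow_smul_iff.mp (h k)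
    have h2 : (⟨x, hx⟩ : M) = unif ϖ ^ k • ⟨y, hy⟩ := Subtype.ext h.symm
    rw [h2]
    refine Submodule.smul_mem_smul (Ideal.pow_mem_pow ?_ k) trivial
    exact (mem_maximalIdeal_iff_unif_dvd ϖ).mpr dvd_rfl
  rw [Ideal.iInf_pow_smul_eq_bot_of_isLocalRing _ (Ideal.IsPrime.ne_top inferInstance)] at h1
  exact congrArg Subtype.val h1

theorem colength_unifAut_pow_smul {M : Submodule (OL K) N} (hM : M.FG) (k : ℕ) :
    colength (unifAut ϖ N ^ k • M) M =
      k * Module.finrank (L K) (Submodule.span (L K) (M : Set N)) := by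
  rw [colength_pow_smul (unifAut_smul_le M), colength_unifAut_smul hM]

theorem colength_ne_top (ϖ : L K) [IsLUniformizer ϖ] {A B : Submodule (OL K) N} (hAB : A ≤ B) (hB : B.FG)
    (h : (B : Set N) ⊆ Submodule.span (L K) (A : Set N)) : colength A B ≠ ⊤ := by
  obtain ⟨c, hc⟩ := exists_unifAut_pow_smul_le (ϖ := ϖ) hB h
  refine ne_top_of_le_ne_top ?_ (colength_mono_left hc hAB)
  rw [colength_unifAut_pow_smul hB]
  exact_mod_cast ENat.natCast_ne_top (c * Module.finrank (L K) (Submodule.span (L K) (B : Set N)))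

theorem colength_smul_eq_of_le {f : semiAut ϖ N} {M S : Submodule (OL K) N} (hS : S.FG)
    (hMS : M ≤ S) (h : (S : Set N) ⊆ Submodule.span (L K) (M : Set N))
    (hfM : f • M ≤ M) (hfS : f • S ≤ S) : colength (f • M) M = colength (f • S) S := by
  have h1 := colength_add hfM hMS
  rw [colength_add (smul_le_smul.mpr hMS) hfS, colength_smul _ hMS, add_comm] at h1
  exact (WithTop.add_right_cancel (colength_ne_top ϖ hMS hS h) h1).symm

/-- The length of `M / f M` does not depend on the `f`-stable lattice `M` in a given space. -/
theorem colength_smul_eq_of_span_eq {f : semiAut ϖ N} {M M' : Submodule (OL K) N} (hM : M.FG)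
    (hM' : M'.FG) (h : Submodule.span (L K) (M : Set N) = Submodule.span (L K) (M' : Set N))
    (hfM : f • M ≤ M) (hfM' : f • M' ≤ M') : colength (f • M) M = colength (f • M') M' := by
  have hS : ((M ⊔ M' : Submodule (OL K) N) : Set N) ⊆ Submodule.span (L K) (M : Set N) := by
    change M ⊔ M' ≤ (Submodule.span (L K) (M : Set N)).restrictScalars (OL K)
    refine sup_le Submodule.subset_span ?_
    rw [h]
    exact Submodule.subset_span
  have hfS : f • (M ⊔ M') ≤ M ⊔ M' := by
    rw [smul_sup']; exact sup_le_sup hfM hfM'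
  rw [colength_smul_eq_of_le (hM.sup hM') le_sup_left hS hfM hfS,
    colength_smul_eq_of_le (hM.sup hM') le_sup_right (h ▸ hS) hfM' hfS]

end Lattices

/-! ### Eigenvectors of Frobenius-semilinear maps -/

section Eigenvector

open Polynomial

/-- Polynomials `P i` with `P i (t) = c i`, where `c 0 = t ^ q a 0`, `c (i+1) = c i ^ q + t ^ q a (i+1)`. -/
def cyclicPoly {k : Type*} [Field k] (q : ℕ) (a : ℕ → k) : ℕ → k[X]
  | 0 => C (a 0) * Polynomial.X ^ q
  | i + 1 => cyclicPoly q a i ^ q + C (a (i + 1)) * Polynomial.X ^ q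

theorem sq_dvd_cyclicPoly {k : Type*} [Field k] {q : ℕ} (hq : 2 ≤ q) (a : ℕ → k) (i : ℕ) :
    (Polynomial.X : k[X]) ^ 2 ∣ cyclicPoly q a i := by
  induction i with
  | zero => exact Dvd.dvd.mul_left (pow_dvd_pow _ hq) _
  | succ i ih =>
    refine dvd_add ?_ (Dvd.dvd.mul_left (pow_dvd_pow _ hq) _)
    exact ih.trans (dvd_pow_self _ (by omega))

theorem cyclicPoly_eq_zero {k : Type*} [Field k] {q : ℕ} (hq : 2 ≤ q) (a : ℕ → k) (i : ℕ)
    (h : cyclicPoly q a i = 0) : ∀ j ≤ i, a j = 0 := by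
  induction i with
  | zero =>
    intro j hj
    obtain rfl : j = 0 := by omega
    simpa [cyclicPoly] using h
  | succ i ih =>
    have h0 : cyclicPoly q a i = 0 := by
      by_contra hne
      have hdeg : 2 ≤ (cyclicPoly q a i).natDegree := by
        have := natDegree_le_of_dvd (sq_dvd_cyclicPoly hq a i) hne
        rwa [natDegree_X_pow] at this
      have h1 : cyclicPoly q a i ^ q = -(C (a (i + 1)) * Polynomial.X ^ q) :=
        eq_neg_of_add_eq_zero_left h
      have h2 := congrArg natDegree h1
      rw [natDegree_pow, natDegree_neg] at h2
      have h3 := natDegree_C_mul_X_pow_le (a (i + 1)) q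
      nlinarith
    intro j hj
    rcases Nat.lt_or_ge i j with hij | hij
    · obtain rfl : j = i + 1 := by omega
      have hq0 : q ≠ 0 := by omega
      simpa [cyclicPoly, h0, hq0] using h
    · exact ih h0 j hij

theorem exists_ne_zero_cyclicPoly_eval {k : Type*} [Field k] [IsAlgClosed k] {q : ℕ} (hq : 2 ≤ q)
    (a : ℕ → k) (i : ℕ) (ha : ∃ j ≤ i, a j ≠ 0) : ∃ t : k, t ≠ 0 ∧ (cyclicPoly q a i).eval t = t := by
  obtain ⟨j, hj, haj⟩ := ha
  have hne : cyclicPoly q a i ≠ 0 := fun h => haj (cyclicPoly_eq_zero hq a i h j hj)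
  obtain ⟨Q, hQ⟩ := sq_dvd_cyclicPoly hq a i
  have hQ0 : Q ≠ 0 := by rintro rfl; simp at hQ; exact hne hQ
  have hd : (Polynomial.X * Q - C 1).degree ≠ 0 := by
    rw [degree_sub_C]
    · rw [degree_mul, degree_X, degree_eq_natDegree hQ0]
      norm_cast; omega
    · rw [degree_mul, degree_X, degree_eq_natDegree hQ0]
      norm_cast; omega
  obtain ⟨t, ht⟩ := IsAlgClosed.exists_root _ hd
  rw [IsRoot, eval_sub, eval_mul, eval_X, eval_C, sub_eq_zero] at ht
  refine ⟨t, by rintro rfl; simp at ht, ?_⟩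
  rw [hQ, eval_mul, eval_pow, eval_X, pow_two, mul_assoc, ht, mul_one]

variable {R Q : Type*} [CommRing R] [IsLocalRing R] [AddCommGroup Q] [Module R Q]

/-- Over a local ring with algebraically closed residue field, a Frobenius-semilinear endomorphism
of a finitely generated module killed by the maximal ideal, which is not nilpotent on `x`, has a
nonzero fixed vector. -/
theorem exists_fixed_vector [IsAlgClosed (IsLocalRing.ResidueField R)] [IsNoetherian R Q]
    {σ : R → R} {q : ℕ} (hq : 2 ≤ q)
    (hσ : ∀ c, IsLocalRing.residue R (σ c) = IsLocalRing.residue R c ^ q)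
    (hQ : ∀ c ∈ IsLocalRing.maximalIdeal R, ∀ x : Q, c • x = 0)
    (f : Q →+ Q) (hf : ∀ (c : R) (x : Q), f (c • x) = σ c • f x) (x : Q)
    (hx : ∀ i, f^[i] x ≠ 0) : ∃ y, y ≠ 0 ∧ f y = y := by
  classical
  have hcongr : ∀ c d : R, IsLocalRing.residue R c = IsLocalRing.residue R d →
      ∀ z : Q, c • z = d • z := by
    intro c d h z
    rw [← sub_eq_zero, ← sub_smul]
    refine hQ _ ?_ z
    rw [← IsLocalRing.residue_eq_zero_iff, map_sub, h, sub_self]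
  let S : ℕ →o Submodule R Q :=
    ⟨fun m => Submodule.span R (((Finset.range m).image fun i => f^[i] x : Finset Q) : Set Q),
      fun m n h => Submodule.span_mono (by
        rw [Finset.coe_subset]
        exact Finset.image_subset_image (Finset.range_mono h))⟩
  have hSmem : ∀ i m, i < m → f^[i] x ∈ S m := fun i m h => Submodule.subset_span (by
    rw [Finset.mem_coe, Finset.mem_image]
    exact ⟨i, Finset.mem_range.mpr h, rfl⟩)
  have hex : ∃ m, f^[m] x ∈ S m := by
    obtain ⟨n, hn⟩ := monotone_stabilizes_iff_noetherian.mpr ‹IsNoetherian R Q› S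
    exact ⟨n, by rw [hn (n + 1) n.le_succ]; exact hSmem n _ n.lt_succ_self⟩
  obtain ⟨k, hk⟩ : ∃ k, Nat.find hex = k + 1 := by
    refine Nat.exists_eq_succ_of_ne_zero fun h0 => ?_
    have := Nat.find_spec hex
    rw [h0] at this
    exact hx 0 (by simpa [S] using this)
  have hkS := Nat.find_spec hex
  rw [hk] at hkS
  have hkmin : f^[k] x ∉ S k := Nat.find_min hex (by omega)
  have hSsum : ∀ m, ∀ z ∈ S m, ∃ a : ℕ → R, z = ∑ i ∈ Finset.range m, a i • f^[i] x := by
    intro m z hz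
    induction hz using Submodule.span_induction with
    | mem z hz =>
      rw [Finset.mem_coe, Finset.mem_image] at hz
      obtain ⟨i, hi, rfl⟩ := hz
      refine ⟨Pi.single i 1, ?_⟩
      rw [Finset.sum_eq_single i]
      · simp
      · intro j _ hj; simp [Pi.single_eq_of_ne hj]
      · intro h; exact absurd hi h
    | zero => exact ⟨0, by simp⟩
    | add y z _ _ hy hz =>
      obtain ⟨a, rfl⟩ := hy
      obtain ⟨b, rfl⟩ := hz
      exact ⟨a + b, by simp [add_smul, Finset.sum_add_distrib]⟩
    | smul c z _ hz =>
      obtain ⟨a, rfl⟩ := hz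
      exact ⟨c • a, by simp [Finset.smul_sum, mul_smul]⟩
  obtain ⟨a, ha⟩ := hSsum _ _ hkS
  obtain ⟨t', ht0, ht⟩ := exists_ne_zero_cyclicPoly_eval hq
      (fun i => IsLocalRing.residue R (a i)) k (by
    by_contra! h
    refine hx (k + 1) ?_
    rw [ha]
    refine Finset.sum_eq_zero fun i hi => hQ _ ?_ _
    rw [← IsLocalRing.residue_eq_zero_iff]
    exact h i (by have := Finset.mem_range.mp hi; omega))
  obtain ⟨t, rfl⟩ := IsLocalRing.residue_surjective t'
  let c : ℕ → R := fun i => Nat.rec (σ t * a 0) (fun i ci => σ ci + σ t * a (i + 1)) i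
  have hc0 : c 0 = σ t * a 0 := rfl
  have hcs : ∀ i, c (i + 1) = σ (c i) + σ t * a (i + 1) := fun _ => rfl
  have hcP : ∀ i, IsLocalRing.residue R (c i) =
      (cyclicPoly q (fun i => IsLocalRing.residue R (a i)) i).eval (IsLocalRing.residue R t) := by
    intro i
    induction i with
    | zero => rw [hc0, cyclicPoly, map_mul, hσ, eval_mul, eval_C, eval_pow, eval_X, mul_comm]
    | succ i ih =>
      rw [hcs, cyclicPoly, map_add, map_mul, hσ, hσ, eval_add, eval_mul, eval_C, eval_pow,
        eval_pow, eval_X, ih, mul_comm (_ ^ q)]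
  -- `c i` is the coefficient forced by the equation `f y = y`, starting from the coefficient `t` of
  -- the top term; the choice of `t` makes `c k` congruent to `t`
  refine ⟨∑ i ∈ Finset.range (k + 1), c i • f^[i] x, fun h0 => ?_, ?_⟩
  · -- the top coefficient is a unit
    have hu : IsUnit (c k) := by
      rw [← IsLocalRing.residue_ne_zero_iff_isUnit, hcP, ht]
      exact ht0
    rw [Finset.sum_range_succ] at h0
    apply hkmin
    rw [← (S k).smul_mem_iff_of_isUnit hu, eq_neg_of_add_eq_zero_right h0]
    refine (S k).neg_mem ((S k).sum_mem fun i hi => (S k).smul_mem _ ?_)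
    exact hSmem i k (Finset.mem_range.mp hi)
  · rw [map_sum]
    simp only [hf, ← Function.iterate_succ_apply' f]
    rw [Finset.sum_range_succ, ha, hcongr (σ (c k)) (σ t) (by rw [hσ, hσ, hcP, ht]),
      Finset.smul_sum, Finset.sum_range_succ', Finset.sum_range_succ' (fun i => c i • f^[i] x),
      ← add_assoc, ← Finset.sum_add_distrib]
    congr 1
    · refine Finset.sum_congr rfl fun i _ => ?_
      rw [hcs, add_smul, mul_smul]
    · rw [hc0, mul_smul]

/-- Simple modules over the Dieudonné ring modulo `FV = VF = 0` have a common eigenvector of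
`F` and `V`. -/
theorem exists_common_eigenvector [IsAlgClosed (IsLocalRing.ResidueField R)] [IsNoetherian R Q]
    [Nontrivial Q] {σ : R ≃+* R} {q : ℕ} (hq : 2 ≤ q)
    (hσ : ∀ c, IsLocalRing.residue R (σ c) = IsLocalRing.residue R c ^ q)
    (hQ : ∀ c ∈ IsLocalRing.maximalIdeal R, ∀ x : Q, c • x = 0)
    (f : Q →+ Q) (hf : ∀ (c : R) (x : Q), f (c • x) = σ c • f x)
    (g : Q →+ Q) (hg : ∀ (c : R) (x : Q), g (c • x) = σ.symm c • g x)
    (hfg : ∀ x, f (g x) = 0) (hgf : ∀ x, g (f x) = 0)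
    (hmin : ∀ P : Submodule R Q, P ≠ ⊥ → (∀ x ∈ P, f x ∈ P) → (∀ x ∈ P, g x ∈ P) → P = ⊤) :
    ∃ y : Q, y ≠ 0 ∧ (f y = 0 ∨ f y = y) ∧ (g y = 0 ∨ g y = y) := by
  let kf : Submodule R Q :=
    { carrier := {x | f x = 0}
      zero_mem' := map_zero f
      add_mem' := fun {x y} hx hy => by
        change f (x + y) = 0
        rw [map_add, show f x = 0 from hx, show f y = 0 from hy, add_zero]
      smul_mem' := fun c x hx => by
        change f (c • x) = 0
        rw [hf, show f x = 0 from hx, smul_zero] }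
  let kg : Submodule R Q :=
    { carrier := {x | g x = 0}
      zero_mem' := map_zero g
      add_mem' := fun {x y} hx hy => by
        change g (x + y) = 0
        rw [map_add, show g x = 0 from hx, show g y = 0 from hy, add_zero]
      smul_mem' := fun c x hx => by
        change g (c • x) = 0
        rw [hg, show g x = 0 from hx, smul_zero] }
  obtain ⟨x, hx⟩ := exists_ne (0 : Q)
  by_cases hkf : kf = ⊥
  · -- `f` is injective, so that `g = 0`
    have hf0 : ∀ z, f z = 0 → z = 0 := fun z hz => by
      have : z ∈ kf := hz
      rwa [hkf, Submodule.mem_bot] at this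
    obtain ⟨y, hy, hfy⟩ := exists_fixed_vector hq hσ hQ f hf x fun i => by
      induction i with
      | zero => exact hx
      | succ i ih => rw [Function.iterate_succ_apply']; exact fun h => ih (hf0 _ h)
    exact ⟨y, hy, Or.inr hfy, Or.inl (hf0 _ (hfg y))⟩
  have hf0 : ∀ z, f z = 0 := fun z => by
    have : z ∈ kf := by
      rw [hmin kf hkf (fun z hz => by rw [show f z = 0 from hz]; exact kf.zero_mem)
        (fun z _ => hfg z)]
      trivial
    exact this
  by_cases hkg : kg = ⊥
  · -- `g` is bijective and its inverse is `σ`-semilinear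
    have hg0 : ∀ z, g z = 0 → z = 0 := fun z hz => by
      have : z ∈ kg := hz
      rwa [hkg, Submodule.mem_bot] at this
    let rg : Submodule R Q :=
      { carrier := Set.range g
        zero_mem' := ⟨0, map_zero g⟩
        add_mem' := by
          rintro _ _ ⟨a, rfl⟩ ⟨b, rfl⟩
          exact ⟨a + b, map_add g a b⟩
        smul_mem' := by
          rintro c _ ⟨a, rfl⟩
          exact ⟨σ c • a, by rw [hg, RingEquiv.symm_apply_apply]⟩ }
    have hsurj : Function.Surjective g := fun z => by
      have : z ∈ rg := by
        rw [hmin rg (fun h => ?_) (fun z _ => by rw [hf0]; exact rg.zero_mem)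
          (fun z _ => ⟨z, rfl⟩)]
        · trivial
        · have h1 : g x ∈ rg := ⟨x, rfl⟩
          rw [h, Submodule.mem_bot] at h1
          exact hx (hg0 x h1)
      exact this
    let e : Q ≃+ Q := AddEquiv.ofBijective g ⟨(injective_iff_map_eq_zero g).mpr hg0, hsurj⟩
    have he : ∀ z, e z = g z := fun _ => rfl
    obtain ⟨y, hy, hfy⟩ := exists_fixed_vector hq hσ hQ e.symm.toAddMonoidHom (fun c z => by
      change e.symm (c • z) = σ c • e.symm z
      rw [AddEquiv.symm_apply_eq, he, hg, RingEquiv.symm_apply_apply, ← he,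
        AddEquiv.apply_symm_apply]) x fun i => by
      induction i with
      | zero => exact hx
      | succ i ih =>
        rw [Function.iterate_succ_apply']
        exact fun h => ih (e.symm.map_eq_zero_iff.mp h)
    refine ⟨y, hy, Or.inl (hf0 y), Or.inr ?_⟩
    rw [← he, ← AddEquiv.eq_symm_apply]
    exact hfy.symm
  · have hg0 : ∀ z, g z = 0 := fun z => by
      have : z ∈ kg := by
        rw [hmin kg hkg (fun z _ => hgf z)
          (fun z hz => by rw [show g z = 0 from hz]; exact kg.zero_mem)]
        trivial
      exact this
    exact ⟨x, hx, Or.inl (hf0 x), Or.inl (hg0 x)⟩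

end Eigenvector

/-! ### Stable lattices and elementary steps between them -/

section StableFlags

variable {p : ℕ} [hp : Fact p.Prime] {K : IntermediateField ℚ_[p] (PadicAlgCl p)}
  {N : Type*} [AddCommGroup N] [Module (L K) N]

section
variable {ϖ : L K}

theorem mem_quotientIccIso {A B : Submodule (OL K) N} (h : A ≤ B)
    {P : Submodule (OL K) (B ⧸ A.submoduleOf B)} {z : N} :
    z ∈ (quotientIccIso h P).1 ↔ ∃ hz : z ∈ B, (A.submoduleOf B).mkQ ⟨z, hz⟩ ∈ P := by
  constructor
  · rintro ⟨z, hz, rfl⟩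
    exact ⟨z.2, hz⟩
  · rintro ⟨hz, h⟩
    exact ⟨⟨z, hz⟩, h, rfl⟩

/-- The endomorphism of `B / A` induced by a semilinear automorphism under which `A` and `B` are
stable. -/
def quotientHom (g : semiAut ϖ N) {τ : OL K ≃+* OL K}
    (hτ : ∀ (c : OL K) (x : N), g • c • x = τ c • g • x) {A B : Submodule (OL K) N}
    (hA : g • A ≤ A) (hB : g • B ≤ B) :
    (B ⧸ A.submoduleOf B) →ₛₗ[(τ : OL K →+* OL K)] (B ⧸ A.submoduleOf B) :=
  Submodule.mapQ (A.submoduleOf B) (A.submoduleOf B)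
    { toFun := fun x => (⟨g • (x : N), hB (smul_mem_smul.mpr x.2)⟩ : B)
      map_add' := fun x y => Subtype.ext (smul_add g (x : N) (y : N))
      map_smul' := fun c x => Subtype.ext (hτ c x) }
    fun _ hx => hA (smul_mem_smul.mpr hx)

theorem quotientHom_mk (g : semiAut ϖ N) {τ : OL K ≃+* OL K}
    (hτ : ∀ (c : OL K) (x : N), g • c • x = τ c • g • x) {A B : Submodule (OL K) N}
    (hA : g • A ≤ A) (hB : g • B ≤ B) (x : B) :
    quotientHom g hτ hA hB ((A.submoduleOf B).mkQ x) =
      (A.submoduleOf B).mkQ ⟨g • (x : N), hB (smul_mem_smul.mpr x.2)⟩ :=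
  Submodule.mapQ_apply _ _ _ _

theorem mkQ_eq_zero_iff {A B : Submodule (OL K) N} {x : B} :
    (A.submoduleOf B).mkQ x = 0 ↔ (x : N) ∈ A := Submodule.Quotient.mk_eq_zero _

theorem mkQ_eq_iff {A B : Submodule (OL K) N} {x y : B} :
    (A.submoduleOf B).mkQ x = (A.submoduleOf B).mkQ y ↔ (x : N) - y ∈ A :=
  Submodule.Quotient.eq _

end

variable {ϖ : L K} [hϖ : IsLUniformizer ϖ]

/-- `M` is stable under `f` and `ϖ f⁻¹`. -/
def IsStable (f : semiAut ϖ N) (M : Submodule (OL K) N) : Prop :=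
  unifAut ϖ N • M ≤ f • M ∧ f • M ≤ M

/-- The Verschiebung `ϖ f⁻¹`. -/
def versch (f : semiAut ϖ N) : semiAut ϖ N := unifAut ϖ N * f⁻¹

theorem versch_eq (f : semiAut ϖ N) : versch f = f⁻¹ * unifAut ϖ N :=
  ((unifAut_commute f⁻¹).eq).symm

theorem isStable_iff {f : semiAut ϖ N} {M : Submodule (OL K) N} :
    IsStable f M ↔ versch f • M ≤ M ∧ f • M ≤ M := by
  rw [IsStable, versch_eq, mul_smul, smul_le_iff_le_inv_smul (g := f⁻¹), inv_inv]

theorem IsStable.smul {f g : semiAut ϖ N} {M : Submodule (OL K) N} (h : IsStable f M)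
    (hfg : Commute g f) : IsStable f (g • M) := by
  refine ⟨?_, ?_⟩
  · rw [smul_smul, smul_smul, ← (unifAut_commute g).eq, ← hfg.eq, mul_smul, mul_smul]
    exact smul_le_smul.mpr h.1
  · rw [smul_smul, ← hfg.eq, mul_smul]
    exact smul_le_smul.mpr h.2

theorem smul_mem_unifAut_smul {M : Submodule (OL K) N} {c : OL K}
    (hc : c ∈ IsLocalRing.maximalIdeal (OL K)) {x : N} (hx : x ∈ M) : c • x ∈ unifAut ϖ N • M := by
  obtain ⟨d, rfl⟩ := (mem_maximalIdeal_iff_unif_dvd ϖ).mp hc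
  rw [mul_smul]
  exact mem_unifAut_smul_iff.mpr ⟨_, M.smul_mem d hx, rfl⟩

theorem colength_sup_span_singleton [IsDiscreteValuationRing (OL K)] {D : Submodule (OL K) N} {y : N} (hy : y ∉ D)
    (hϖy : ϖ • y ∈ D) : colength D (D ⊔ Submodule.span (OL K) {y}) = 1 := by
  have hfg : (Submodule.span (OL K) {y}).FG := Submodule.fg_span_singleton y
  have h1 : unifAut ϖ N • Submodule.span (OL K) {y} ≤ Submodule.span (OL K) {y} ⊓ D := by
    refine le_inf (unifAut_smul_le _) ?_
    rw [smul_span', Set.image_singleton, Submodule.span_singleton_le_iff_mem]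
    exact hϖy
  have h2 := colength_mono_left h1 inf_le_left
  rw [colength_unifAut_smul hfg, Submodule.span_span_of_tower, colength_inf_left, sup_comm,
    finrank_span_singleton (by rintro rfl; exact hy D.zero_mem)] at h2
  refine le_antisymm h2 ?_
  rw [Order.one_le_iff_ne_zero]
  intro h0
  exact hy (colength_eq_zero_iff.mp h0 (Submodule.mem_sup_right
    (Submodule.mem_span_singleton_self y)))

theorem isStable_sup_span {f : semiAut ϖ N} {D : Submodule (OL K) N} {y : N}
    (hD : IsStable f D) (hf : f • y ∈ D ∨ f • y - y ∈ D)
    (hv : versch f • y ∈ D ∨ versch f • y - y ∈ D) :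
    IsStable f (D ⊔ Submodule.span (OL K) {y}) := by
  have key : ∀ g : semiAut ϖ N, g • D ≤ D → (g • y ∈ D ∨ g • y - y ∈ D) →
      g • (D ⊔ Submodule.span (OL K) {y}) ≤ D ⊔ Submodule.span (OL K) {y} := by
    intro g hgD hg
    rw [smul_sup', smul_span', Set.image_singleton]
    refine sup_le (hgD.trans le_sup_left) ?_
    rw [Submodule.span_singleton_le_iff_mem]
    rcases hg with h | h
    · exact Submodule.mem_sup_left h
    · have : g • y = (g • y - y) + y := by abel
      rw [this]
      exact Submodule.add_mem_sup h (Submodule.mem_span_singleton_self y)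
  rw [isStable_iff] at hD ⊢
  exact ⟨key _ hD.1 hv, key _ hD.2 hf⟩

/-- Above a stable lattice `D`, there is a minimal stable lattice. -/
theorem exists_minimal_stable [IsDiscreteValuationRing (OL K)] {f : semiAut ϖ N}
    {D M : Submodule (OL K) N} (hM : IsStable f M) (hDM : D < M)
    (hMfg : M.FG) (hϖ : unifAut ϖ N • M ≤ D) :
    ∃ P, IsStable f P ∧ D < P ∧ P ≤ M ∧
      ∀ P', IsStable f P' → D < P' → P' ≤ P → P' = P := by
  have hfin : colength D M ≠ ⊤ := by
    refine ne_top_of_le_ne_top ?_ (colength_mono_left hϖ hDM.le)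
    rw [colength_unifAut_smul hMfg]
    exact ENat.natCast_ne_top _
  obtain ⟨P, ⟨hP, hDP, hPM⟩, hPmin⟩ := WellFounded.has_min
    (InvImage.wf (fun P : Submodule (OL K) N => colength D P) wellFounded_lt)
    {P | IsStable f P ∧ D < P ∧ P ≤ M} ⟨M, hM, hDM, le_rfl⟩
  refine ⟨P, hP, hDP, hPM, fun P' h1 h2 h3 => ?_⟩
  refine le_antisymm h3 ?_
  have h4 := hPmin P' ⟨h1, h2, h3.trans hPM⟩
  have h5 : colength D P ≤ colength D P' := not_lt.mp h4
  rw [colength_add h2.le h3] at h5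
  have h6 : colength D P' ≠ ⊤ :=
    ne_top_of_le_ne_top hfin (colength_mono_right h2.le (h3.trans hPM))
  have h7 : colength D P' + colength P' P ≤ colength D P' + 0 := by rwa [add_zero]
  rw [ENat.add_le_add_iff_left h6] at h7
  exact colength_eq_zero_iff.mp (le_antisymm h7 zero_le)

set_option maxHeartbeats 400000 in
/-- Between two stable lattices `D < M` with `ϖ M ≤ D`, there is a stable lattice in which `D`
has colength one. -/
theorem exists_stable_step [IsDiscreteValuationRing (OL K)] {f : semiAut ϖ N} {τ : OL K ≃+* OL K} {q : ℕ} (hq : 2 ≤ q)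
    (hτ : ∀ c, IsLocalRing.residue (OL K) (τ c) = IsLocalRing.residue (OL K) c ^ q)
    (hf : ∀ (c : OL K) (x : N), f • c • x = τ c • f • x)
    {D M : Submodule (OL K) N} (hD : IsStable f D) (hM : IsStable f M) (hDM : D < M)
    (hMfg : M.FG) (hϖ : unifAut ϖ N • M ≤ D) :
    ∃ D', D ≤ D' ∧ D' ≤ M ∧ IsStable f D' ∧ colength D D' = 1 := by
  obtain ⟨P, hP, hDP, hPM, hPmin'⟩ := exists_minimal_stable hM hDM hMfg hϖ
  have hDv := isStable_iff.mp hD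
  have hPv := isStable_iff.mp hP
  have hϖP : unifAut ϖ N • P ≤ D := (smul_le_smul.mpr hPM).trans hϖ
  have hv : ∀ (c : OL K) (x : N), versch f • c • x = τ.symm c • versch f • x := by
    intro c x
    rw [versch_eq, mul_smul, mul_smul, ← smul_left_cancel_iff f, smul_inv_smul, hf,
      RingEquiv.apply_symm_apply, smul_inv_smul, unifAut_smul, unifAut_smul]
    exact smul_comm ϖ (c : L K) x
  -- by minimality of `P`, this quotient is simple as a module with the actions of `f` and `ϖ f⁻¹`
  let Q := P ⧸ D.submoduleOf P
  have : Nontrivial Q := Submodule.Quotient.nontrivial_iff.mpr fun h =>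
    not_le_of_gt hDP (Submodule.submoduleOf_eq_top.mp h)
  have : IsNoetherian (OL K) P := isNoetherian_of_fg_of_noetherian P (hMfg.of_le hPM)
  let F : Q →+ Q := (quotientHom f hf hDv.2 hPv.2).toAddMonoidHom
  let V : Q →+ Q := (quotientHom (versch f) hv hDv.1 hPv.1).toAddMonoidHom
  have hF : ∀ x : P, F ((D.submoduleOf P).mkQ x) =
      (D.submoduleOf P).mkQ ⟨f • (x : N), hPv.2 (smul_mem_smul.mpr x.2)⟩ :=
    quotientHom_mk f hf hDv.2 hPv.2
  have hV : ∀ x : P, V ((D.submoduleOf P).mkQ x) =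
      (D.submoduleOf P).mkQ ⟨versch f • (x : N), hPv.1 (smul_mem_smul.mpr x.2)⟩ :=
    quotientHom_mk (versch f) hv hDv.1 hPv.1
  obtain ⟨y, hy0, hfy, hvy⟩ := exists_common_eigenvector (Q := Q) hq hτ (fun c hc x => by
      obtain ⟨x, rfl⟩ := Submodule.mkQ_surjective _ x
      rw [← map_smul, mkQ_eq_zero_iff]
      exact hϖP (smul_mem_unifAut_smul hc x.2))
    F (fun c x => (quotientHom f hf hDv.2 hPv.2).map_smulₛₗ c x)
    V (fun c x => (quotientHom (versch f) hv hDv.1 hPv.1).map_smulₛₗ c x)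
    (fun x => by
      obtain ⟨x, rfl⟩ := Submodule.mkQ_surjective _ x
      rw [hV, hF, mkQ_eq_zero_iff]
      change f • versch f • (x : N) ∈ D
      rw [versch_eq, smul_smul, mul_inv_cancel_left]
      exact hϖP (smul_mem_smul.mpr x.2))
    (fun x => by
      obtain ⟨x, rfl⟩ := Submodule.mkQ_surjective _ x
      rw [hF, hV, mkQ_eq_zero_iff]
      change versch f • f • (x : N) ∈ D
      rw [versch, smul_smul, inv_mul_cancel_right]
      exact hϖP (smul_mem_smul.mpr x.2))
    (fun P' hP' h1 h2 => by
      have hlt : D < (quotientIccIso hDP.le P').1 := by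
        refine lt_of_le_of_ne (quotientIccIso hDP.le P').2.1 fun h => hP' ?_
        rw [eq_bot_iff]
        intro x hx
        obtain ⟨x, rfl⟩ := Submodule.mkQ_surjective _ x
        rw [Submodule.mem_bot, mkQ_eq_zero_iff, h, mem_quotientIccIso]
        exact ⟨x.2, hx⟩
      have hst : IsStable f (quotientIccIso hDP.le P').1 := by
        rw [isStable_iff]
        constructor
        · intro z hz
          obtain ⟨hz1, hz2⟩ := (mem_quotientIccIso hDP.le).mp (mem_smul_iff.mp hz)
          have := h2 _ hz2
          rw [hV] at this
          rw [mem_quotientIccIso]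
          simp only [smul_inv_smul] at this
          exact ⟨_, this⟩
        · intro z hz
          obtain ⟨hz1, hz2⟩ := (mem_quotientIccIso hDP.le).mp (mem_smul_iff.mp hz)
          have := h1 _ hz2
          rw [hF] at this
          rw [mem_quotientIccIso]
          simp only [smul_inv_smul] at this
          exact ⟨_, this⟩
      have heq := hPmin' _ hst hlt (quotientIccIso hDP.le P').2.2
      rw [eq_top_iff]
      intro x _
      obtain ⟨x, rfl⟩ := Submodule.mkQ_surjective _ x
      have hxP : (x : N) ∈ (quotientIccIso hDP.le P').1 := by rw [heq]; exact x.2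
      obtain ⟨_, hx⟩ := (mem_quotientIccIso hDP.le).mp hxP
      exact hx)
  obtain ⟨y, rfl⟩ := Submodule.mkQ_surjective _ y
  rw [Ne, mkQ_eq_zero_iff] at hy0
  have hfy' := hfy.imp (fun h => mkQ_eq_zero_iff.mp h) fun h => mkQ_eq_iff.mp h
  have hvy' := hvy.imp (fun h => mkQ_eq_zero_iff.mp h) fun h => mkQ_eq_iff.mp h
  refine ⟨D ⊔ Submodule.span (OL K) {(y : N)}, le_sup_left, sup_le hDM.le ?_,
    isStable_sup_span hD hfy' hvy', colength_sup_span_singleton (ϖ := ϖ) hy0 ?_⟩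
  · rw [Submodule.span_singleton_le_iff_mem]
    exact hPM y.2
  · exact hϖP (smul_mem_smul.mpr y.2)

end StableFlags

/-! ### Refinement of periodic chains -/

section FullFlags

variable {p : ℕ} [hp : Fact p.Prime] {K : IntermediateField ℚ_[p] (PadicAlgCl p)}
  {N : Type*} [AddCommGroup N] [Module (L K) N] {ϖ : L K} [hϖ : IsLUniformizer ϖ]

/-- A periodic chain of stable finitely generated submodules, of type `J`. -/
structure IsStableChain (f : semiAut ϖ N) {n : ℕ} {J : Set (ZMod n)}
    (M : Idx J → Submodule (OL K) N) : Prop where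
  fg : ∀ i, (M i).FG
  stable : ∀ i, IsStable f (M i)
  mono : ∀ i j : Idx J, i < j → M i ≤ M j
  length : ∀ i j : Idx J, i < j → colength (M i) (M j) = (((j : ℤ) - i).toNat : ℕ∞)
  periodic : ∀ i j : Idx J, (j : ℤ) = i + n → M j = (unifAut ϖ N)⁻¹ • M i

/-- The lattice `A` can be inserted at the place `k` in the chain `M`. -/
structure FitsAt (f : semiAut ϖ N) {n : ℕ} {J : Set (ZMod n)}
    (M : Idx J → Submodule (OL K) N) (k : ℤ) (A : Submodule (OL K) N) : Prop where
  stable : IsStable f A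
  lower : ∀ i : Idx J, (i : ℤ) ≤ k → M i ≤ A
  upper : ∀ j : Idx J, k ≤ (j : ℤ) → A ≤ M j
  length : ∀ j : Idx J, k ≤ (j : ℤ) → colength A (M j) = (((j : ℤ) - k).toNat : ℕ∞)

variable {f : semiAut ϖ N} {n : ℕ} {J : Set (ZMod n)} {M : Idx J → Submodule (OL K) N}

theorem IsStableChain.mono' (h : IsStableChain f M) {i j : Idx J} (hij : (i : ℤ) ≤ j) :
    M i ≤ M j := by
  rcases eq_or_lt_of_le hij with h1 | h1
  · rw [Subtype.ext h1]
  · exact h.mono i j h1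

theorem IsStableChain.fitsAt (h : IsStableChain f M) (i : Idx J) : FitsAt f M i (M i) where
  stable := h.stable i
  lower _ hij := h.mono' hij
  upper _ hij := h.mono' hij
  length j hij := by
    rcases eq_or_lt_of_le hij with h1 | h1
    · rw [← Subtype.ext h1, colength_self, sub_self]; rfl
    · exact h.length i j h1

theorem IsStableChain.zpow_smul (h : IsStableChain f M) (q : ℤ) :
    ∀ i j : Idx J, (j : ℤ) = i + n * q → M j = unifAut ϖ N ^ (-q) • M i := by
  induction q using Int.induction_on with
  | zero =>
    intro i j hij
    rw [show j = i from Subtype.ext (by simpa using hij)]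
    simp
  | succ q ih =>
    intro i j hij
    have hmem : (((i : ℤ) + n * q : ℤ) : ZMod n) ∈ J := by
      have := i.2; push_cast; simpa using this
    rw [h.periodic ⟨_, hmem⟩ j (by rw [hij]; ring), ih i ⟨_, hmem⟩ rfl, smul_smul]
    congr 1
    rw [neg_add_rev, zpow_add, zpow_neg_one]
  | pred q ih =>
    intro i j hij
    have hmem : (((j : ℤ) + n : ℤ) : ZMod n) ∈ J := by
      have := j.2; push_cast; simpa using this
    have h1 := h.periodic j ⟨_, hmem⟩ rfl
    rw [ih i ⟨_, hmem⟩ (by change (j : ℤ) + n = _; rw [hij]; ring)] at h1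
    rw [eq_inv_smul_iff, smul_smul] at h1
    rw [← h1]
    congr 1
    rw [← zpow_one_add]
    congr 1; ring

/-- The next index of a nonempty periodic set of integers. -/
theorem exists_next_index (hn : 0 < n) (hJ : J.Nonempty) (k : ℤ) :
    ∃ j : Idx J, k < j ∧ (j : ℤ) ≤ k + n ∧ ∀ i : Idx J, k < i → j ≤ i := by
  classical
  have : NeZero n := ⟨hn.ne'⟩
  have hex : ∃ m : ℕ, 0 < m ∧ ((k + m : ℤ) : ZMod n) ∈ J := by
    obtain ⟨x, hx⟩ := hJ
    refine ⟨(x - k).val + n, by omega, ?_⟩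
    push_cast
    simpa using hx
  obtain ⟨h1, h2⟩ := Nat.find_spec hex
  refine ⟨⟨_, h2⟩, by simp, ?_, fun i hi => ?_⟩
  · by_contra! h3
    have h4 : n < Nat.find hex := by
      have : k + n < k + (Nat.find hex : ℤ) := h3
      omega
    refine Nat.find_min hex (m := Nat.find hex - n) (by omega) ⟨by omega, ?_⟩
    rw [Nat.cast_sub h4.le]
    push_cast at h2 ⊢
    simpa using h2
  · have h5 : Nat.find hex ≤ ((i : ℤ) - k).toNat := by
      refine Nat.find_min' hex ⟨by omega, ?_⟩
      rw [Int.toNat_of_nonneg (by omega), add_sub_cancel]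
      exact i.2
    change k + (Nat.find hex : ℤ) ≤ (i : ℤ)
    omega

theorem FitsAt.eq {k : ℤ} {A : Submodule (OL K) N} (hA : FitsAt f M k A) (i : Idx J)
    (hi : (i : ℤ) = k) : A = M i :=
  le_antisymm (hA.upper i hi.ge) (hA.lower i hi.le)

theorem flag_mono {a : ℤ → Submodule (OL K) N} (h : ∀ i, a i ≤ a (i + 1)) : Monotone a :=
  monotone_int_of_le_succ h

theorem flag_colength {a : ℤ → Submodule (OL K) N} (h : ∀ i, a i ≤ a (i + 1))
    (h1 : ∀ i, colength (a i) (a (i + 1)) = 1) (i : ℤ) (t : ℕ) :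
    colength (a i) (a (i + t)) = t := by
  induction t with
  | zero => simp [colength_self]
  | succ t ih =>
    rw [Nat.cast_add, Nat.cast_one, ← add_assoc, colength_add (flag_mono h (by omega)) (h _), ih, h1]
    rfl

variable [IsDiscreteValuationRing (OL K)]

/-- A chain can be extended by one step, towards its next member. -/
theorem FitsAt.exists_succ {τ : OL K ≃+* OL K} {q : ℕ} (hq : 2 ≤ q)
    (hτ : ∀ c, IsLocalRing.residue (OL K) (τ c) = IsLocalRing.residue (OL K) c ^ q)
    (hf : ∀ (c : OL K) (x : N), f • c • x = τ c • f • x)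
    (hn : 0 < n) (hJ : J.Nonempty) (hM : IsStableChain f M) {k : ℤ} {A : Submodule (OL K) N}
    (hA : FitsAt f M k A) : ∃ A', A ≤ A' ∧ colength A A' = 1 ∧ FitsAt f M (k + 1) A' := by
  obtain ⟨j, hkj, hjn, hj⟩ := exists_next_index hn hJ k
  have hlen := hA.length j hkj.le
  have hlt : A < M j := by
    refine lt_of_le_of_ne (hA.upper j hkj.le) fun h => ?_
    rw [h, colength_self] at hlen
    have : (((j : ℤ) - k).toNat) = 0 := by exact_mod_cast hlen.symm
    omega
  have hmem : (((j : ℤ) - n : ℤ) : ZMod n) ∈ J := by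
    have := j.2; push_cast; simpa using this
  have hϖM : unifAut ϖ N • M j ≤ A := by
    rw [hM.periodic ⟨_, hmem⟩ j (by simp), smul_inv_smul]
    exact hA.lower _ (by change (j : ℤ) - n ≤ k; omega)
  obtain ⟨A', hAA', hA'M, hst, hlen'⟩ := exists_stable_step hq hτ hf hA.stable (hM.stable j) hlt
    (hM.fg j) hϖM
  have hupper : ∀ i : Idx J, k + 1 ≤ (i : ℤ) → A' ≤ M i := fun i hi =>
    hA'M.trans (hM.mono' (hj i (by omega)))
  have hlength : ∀ i : Idx J, k + 1 ≤ (i : ℤ) →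
      colength A' (M i) = (((i : ℤ) - (k + 1)).toNat : ℕ∞) := by
    intro i hi
    have h1 := hA.length i (by omega)
    rw [colength_add hAA' (hupper i hi), hlen'] at h1
    have h2 : ((i : ℤ) - k).toNat = 1 + ((i : ℤ) - (k + 1)).toNat := by omega
    rw [h2, Nat.cast_add, Nat.cast_one] at h1
    exact WithTop.add_left_cancel ENat.one_ne_top h1
  refine ⟨A', hAA', hlen', hst, fun i hi => ?_, hupper, hlength⟩
  rcases lt_or_eq_of_le hi with h | h
  · exact (hA.lower i (by omega)).trans hAA'
  · have := hlength i h.ge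
    rw [h, sub_self] at this
    exact colength_eq_zero_iff.mp this

theorem exists_flag_from {τ : OL K ≃+* OL K} {q : ℕ} (hq : 2 ≤ q)
    (hτ : ∀ c, IsLocalRing.residue (OL K) (τ c) = IsLocalRing.residue (OL K) c ^ q)
    (hf : ∀ (c : OL K) (x : N), f • c • x = τ c • f • x)
    (hn : 0 < n) (hJ : J.Nonempty) (hM : IsStableChain f M) (i : Idx J) :
    ∃ b : ℕ → Submodule (OL K) N, (∀ t, b t ≤ b (t + 1)) ∧
      (∀ t, colength (b t) (b (t + 1)) = 1) ∧ ∀ t : ℕ, FitsAt f M (i + t) (b t) := by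
  have hstep : ∀ (t : ℕ) (A : {A // FitsAt f M (i + t) A}),
      ∃ A' : {A // FitsAt f M (i + (t + 1 : ℕ)) A}, A.1 ≤ A'.1 ∧ colength A.1 A'.1 = 1 := by
    intro t A
    obtain ⟨A', h1, h2, h3⟩ := A.2.exists_succ hq hτ hf hn hJ hM
    refine ⟨⟨A', ?_⟩, h1, h2⟩
    rw [Nat.cast_add, Nat.cast_one, ← add_assoc]
    exact h3
  choose s hs1 hs2 using hstep
  let b : ∀ t : ℕ, {A // FitsAt f M (i + t) A} := fun t =>
    Nat.rec (motive := fun t => {A // FitsAt f M (i + (t : ℕ)) A})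
      ⟨M i, by simpa using hM.fitsAt i⟩ (fun t A => s t A) t
  exact ⟨fun t => (b t).1, fun t => hs1 t (b t), fun t => hs2 t (b t), fun t => (b t).2⟩

/-- Every periodic chain of stable lattices can be refined to a full one. -/
theorem exists_full_flag {τ : OL K ≃+* OL K} {q : ℕ} (hq : 2 ≤ q)
    (hτ : ∀ c, IsLocalRing.residue (OL K) (τ c) = IsLocalRing.residue (OL K) c ^ q)
    (hf : ∀ (c : OL K) (x : N), f • c • x = τ c • f • x)
    (hn : 0 < n) (hJ : J.Nonempty) (hM : IsStableChain f M) :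
    ∃ a : ℤ → Submodule (OL K) N, (∀ i, a i ≤ a (i + 1)) ∧
      (∀ i, colength (a i) (a (i + 1)) = 1) ∧ (∀ i, a (i + n) = (unifAut ϖ N)⁻¹ • a i) ∧
      (∀ i, IsStable f (a i)) ∧ ∀ i : Idx J, a i = M i := by
  obtain ⟨i₀, -, -, -⟩ := exists_next_index hn hJ 0
  obtain ⟨b, hb1, hb2, hb3⟩ := exists_flag_from hq hτ hf hn hJ hM i₀
  have hn' : (n : ℤ) ≠ 0 := by exact_mod_cast hn.ne'
  -- repeat one period of `b` periodically
  let a : ℤ → Submodule (OL K) N := fun i =>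
    unifAut ϖ N ^ (-((i - i₀) / n)) • b ((i - i₀) % n).toNat
  have hb0 : b 0 = M i₀ := (hb3 0).eq i₀ (by simp)
  have hmem : ∀ q : ℤ, (((i₀ : ℤ) + n * q : ℤ) : ZMod n) ∈ J := by
    intro q; have := i₀.2; push_cast; simpa using this
  have hbn : b n = (unifAut ϖ N)⁻¹ • b 0 := by
    rw [hb0, (hb3 n).eq ⟨_, hmem 1⟩ (by simp)]
    exact hM.periodic _ _ (by simp)
  have hform : ∀ (q : ℤ) (t : ℕ), t < n → a (i₀ + n * q + t) = unifAut ϖ N ^ (-q) • b t := by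
    intro q t ht
    have h1 : ((i₀ : ℤ) + n * q + t - i₀) = t + n * q := by ring
    have h2 : ((t : ℤ) + n * q) / n = q := by
      rw [Int.add_mul_ediv_left _ _ hn', Int.ediv_eq_zero_of_lt (by omega) (by omega), zero_add]
    have h3 : (((t : ℤ) + n * q) % n).toNat = t := by
      rw [Int.add_mul_emod_self_left, Int.emod_eq_of_lt (by omega) (by omega), Int.toNat_natCast]
    change unifAut ϖ N ^ (-((_ - (i₀ : ℤ)) / n)) • b ((_ - (i₀ : ℤ)) % n).toNat = _
    rw [h1, h2, h3]
  have hform' : ∀ (q : ℤ) (t : ℕ), t ≤ n → a (i₀ + n * q + t) = unifAut ϖ N ^ (-q) • b t := by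
    intro q t ht
    rcases lt_or_eq_of_le ht with h | rfl
    · exact hform q t h
    · have := hform (q + 1) 0 hn
      rw [show (i₀ : ℤ) + t * q + t = i₀ + t * (q + 1) + (0 : ℕ) by push_cast; ring, this, hbn,
        smul_smul]
      congr 1
      rw [neg_add_rev, ← zpow_neg_one, ← zpow_add, add_comm]
  have hrep : ∀ i : ℤ, ∃ (q : ℤ) (t : ℕ), t < n ∧ i = i₀ + n * q + t := by
    intro i
    have h0 := Int.emod_nonneg (i - i₀) hn'
    have h1 := Int.emod_lt_of_pos (i - i₀) (show (0 : ℤ) < n by exact_mod_cast hn)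
    refine ⟨(i - i₀) / n, ((i - i₀) % n).toNat, by omega, ?_⟩
    have := Int.emod_add_mul_ediv (i - i₀) n
    rw [Int.toNat_of_nonneg h0]
    linarith
  refine ⟨a, fun i => ?_, fun i => ?_, fun i => ?_, fun i => ?_, fun i => ?_⟩
  · obtain ⟨q, t, ht, rfl⟩ := hrep i
    have := hform' q (t + 1) ht
    rw [Nat.cast_add, Nat.cast_one, ← add_assoc] at this
    rw [this, hform q t ht]
    exact smul_le_smul.mpr (hb1 t)
  · obtain ⟨q, t, ht, rfl⟩ := hrep i
    have := hform' q (t + 1) ht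
    rw [Nat.cast_add, Nat.cast_one, ← add_assoc] at this
    rw [this, hform q t ht, colength_smul _ (hb1 t), hb2 t]
  · obtain ⟨q, t, ht, rfl⟩ := hrep i
    rw [show (i₀ : ℤ) + n * q + t + n = i₀ + n * (q + 1) + t by ring, hform _ t ht,
      hform q t ht, smul_smul]
    congr 1
    rw [neg_add_rev, ← zpow_neg_one, ← zpow_add]
  · obtain ⟨q, t, ht, rfl⟩ := hrep i
    rw [hform q t ht]
    exact (hb3 t).stable.smul ((unifAut_commute f).symm.zpow_left _)
  · obtain ⟨q, t, ht, hi⟩ := hrep i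
    have hmem' : (((i₀ : ℤ) + t : ℤ) : ZMod n) ∈ J := by
      have := i.2; rw [hi] at this; push_cast at this ⊢; simpa using this
    rw [hi, hform q t ht, (hb3 t).eq ⟨_, hmem'⟩ rfl]
    exact (hM.zpow_smul q ⟨_, hmem'⟩ i (by rw [hi]; ring)).symm

end FullFlags

/-! ### Chains of lattices in an isocrystal -/

section Refinement

variable {p : ℕ} [hp : Fact p.Prime] {K : IntermediateField ℚ_[p] (PadicAlgCl p)}
  {N : Type*} [AddCommGroup N] [Module (L K) N]
  {π : K} [hϖ : IsLUniformizer (inclL K π)] {σ : RelFrobenius K}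

/-- On `O_L` the Frobenius induces an automorphism which is `x ↦ x ^ q` on the residue field. -/
theorem Isocrystal.exists_integral_semilinear [FiniteDimensional ℚ_[p] K] (F : Isocrystal σ N) :
    ∃ (τ : OL K ≃+* OL K) (q : ℕ), 2 ≤ q ∧
      (∀ c, IsLocalRing.residue (OL K) (τ c) = IsLocalRing.residue (OL K) c ^ q) ∧
      ∀ (c : OL K) (x : N), F.aut (π := π) • c • x = τ c • F.aut (π := π) • x := by
  have hσ := σ.norm_map (π := π)
  let τ : OL K ≃+* OL K := ⟨⟨fun c => ⟨σ.toEquiv c, by rw [mem_OL, hσ]; exact c.2⟩,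
    fun c => ⟨σ.toEquiv.symm c, by rw [mem_OL, ← hσ, RingEquiv.apply_symm_apply]; exact c.2⟩,
    fun c => by simp, fun c => by simp⟩, fun a b => by ext; simp, fun a b => by ext; simp⟩
  have := finite_res K
  refine ⟨τ, Nat.card (IsLocalRing.ResidueField (OK K)), Finite.one_lt_card, fun c => ?_,
    fun c x => map_smulₛₗ F.toMap (c : L K) x⟩
  rw [← map_pow]
  refine (Ideal.Quotient.eq (I := IsLocalRing.maximalIdeal (OL K))).mpr ?_
  rw [max_iff]
  exact σ.residue c c.2

variable {F : Isocrystal σ N} {n r : ℕ} {J : Set (ZMod n)}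

theorem isStableChain_of_mem {C : Chain π N J} (hC : C ∈ X π F r J) :
    IsStableChain (F.aut (π := π)) C.M where
  fg i := (C.isLattice i).fg
  stable i := by
    obtain ⟨h1, h2, -⟩ := hC i
    rw [scale_unif, F.image_eq (π := π)] at h1
    rw [F.image_eq (π := π)] at h2
    exact ⟨h1, h2⟩
  mono := C.mono
  length := C.length
  periodic i j hij := by rw [C.periodic i j hij, scale_unif_inv]

theorem smul_mem_span_smul {ϖ : L K} {g : semiAut ϖ N} {M : Submodule (OL K) N} {x : N}
    (hx : x ∈ Submodule.span (L K) (M : Set N)) :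
    g • x ∈ Submodule.span (L K) ((g • M : Submodule (OL K) N) : Set N) := by
  obtain ⟨τ, -, hτ⟩ := exists_semilinear g
  induction hx using Submodule.span_induction with
  | mem y hy => exact Submodule.subset_span (smul_mem_smul.mpr hy)
  | zero => rw [smul_zero]; exact Submodule.zero_mem _
  | add y z _ _ hy hz => rw [smul_add]; exact Submodule.add_mem _ hy hz
  | smul c y _ hy => rw [hτ]; exact Submodule.smul_mem _ _ hy

theorem span_smul_top {ϖ : L K} {g : semiAut ϖ N} {M : Submodule (OL K) N}
    (hM : Submodule.span (L K) (M : Set N) = ⊤) :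
    Submodule.span (L K) ((g • M : Submodule (OL K) N) : Set N) = ⊤ := by
  refine eq_top_iff.mpr fun x _ => ?_
  rw [← smul_inv_smul g x]
  exact smul_mem_span_smul (hM ▸ Submodule.mem_top)

/-- Every chain of stable lattices of colength `r` is part of a full periodic chain. -/
theorem IsStableChain.exists_full_chain [FiniteDimensional ℚ_[p] K] (hn : 0 < n)
    (hJ : J.Nonempty) {M : Idx J → Submodule (OL K) N}
    (hM : IsStableChain (F.aut (π := π)) M)
    (hspan : ∀ i, Submodule.span (L K) (M i : Set N) = ⊤)
    (hr : ∀ i, colength (F.aut (π := π) • M i) (M i) = r) :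
    ∃ C : Chain π N (Set.univ : Set (ZMod n)), C ∈ X π F r Set.univ ∧
      ∀ i : Idx J, C.M ⟨i, Set.mem_univ _⟩ = M i := by
  have : IsDiscreteValuationRing (OL K) := isDiscreteValuationRing_OL (inclL K π)
  obtain ⟨τ, q, hq, hτ, hf⟩ := F.exists_integral_semilinear (π := π)
  obtain ⟨a, ha1, ha2, ha3, ha4, ha5⟩ := exists_full_flag hq hτ hf hn hJ hM
  have hmono := flag_mono ha1
  have hfg : ∀ i, (a i).FG := fun i => by
    obtain ⟨j, hj, -⟩ := exists_next_index hn hJ i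
    exact Submodule.FG.of_le (by rw [ha5 j]; exact hM.fg j) (hmono hj.le)
  have hsp : ∀ i, Submodule.span (L K) (a i : Set N) = ⊤ := fun i => by
    obtain ⟨j, -, hj, -⟩ := exists_next_index hn hJ (i - n)
    refine eq_top_iff.mpr ((hspan j).ge.trans (Submodule.span_mono ?_))
    rw [← ha5 j]
    exact hmono (by linarith)
  obtain ⟨i₀, -, -⟩ := exists_next_index hn hJ 0
  refine ⟨⟨fun i => a i, fun i => ⟨hfg i, hsp i⟩, fun i j hij => hmono hij.le, fun i j hij => ?_,
    fun i j hij => ?_⟩, fun i => ⟨?_, ?_, ?_⟩, fun i => ha5 i⟩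
  · have hij' : (i : ℤ) < j := hij
    have := flag_colength ha1 ha2 i ((j : ℤ) - i).toNat
    rwa [Int.toNat_of_nonneg (by omega), add_sub_cancel] at this
  · rw [hij, ha3, scale_unif_inv]
  · rw [scale_unif, F.image_eq (π := π)]; exact (ha4 i).1
  · rw [F.image_eq (π := π)]; exact (ha4 i).2
  · rw [F.image_eq (π := π), ← hr i₀]
    exact colength_smul_eq_of_span_eq (hfg i) (hM.fg i₀) ((hsp i).trans (hspan i₀).symm)
      (ha4 i).2 (hM.stable i₀).2

theorem X.forget_surjective [FiniteDimensional ℚ_[p] K] (hn : 0 < n) {I : Set (ZMod n)}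
    (h : J ⊆ I) (hJ : J.Nonempty) : Function.Surjective (X.forget π F r h) := by
  rintro ⟨C, hC⟩
  obtain ⟨D, hD, hDC⟩ := (isStableChain_of_mem hC).exists_full_chain hn hJ
    (fun i => (C.isLattice i).span_eq_top) (fun i => by rw [← F.image_eq]; exact (hC i).2.2)
  exact ⟨X.forget π F r (Set.subset_univ I) ⟨D, hD⟩, Subtype.ext (Chain.ext (funext hDC))⟩

/-- A single stable lattice of colength `r` gives chains of every type. -/
theorem X.nonempty_of_lattice [FiniteDimensional ℚ_[p] K] (hn : 0 < n)
    (hN : Module.finrank (L K) N = n) {M : Submodule (OL K) N} (hfg : M.FG)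
    (hspan : Submodule.span (L K) (M : Set N) = ⊤) (hM : IsStable (F.aut (π := π)) M)
    (hr : colength (F.aut (π := π) • M) M = r) (I : Set (ZMod n)) : (X π F r I).Nonempty := by
  have : IsDiscreteValuationRing (OL K) := isDiscreteValuationRing_OL (inclL K π)
  let w := unifAut (inclL K π) N
  have hn' : (n : ℤ) ≠ 0 := by exact_mod_cast hn.ne'
  have hidx : ∀ i : Idx ({0} : Set (ZMod n)), (i : ℤ) = n * ((i : ℤ) / n) := fun i => by
    have := i.2
    rw [Set.mem_singleton_iff, ZMod.intCast_zmod_eq_zero_iff_dvd] at this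
    exact (Int.mul_ediv_cancel' this).symm
  have hw : ∀ a b : ℤ, a ≤ b → w ^ (-a) • M = w ^ (-b) • w ^ (b - a).toNat • M := by
    intro a b hab
    rw [smul_smul, ← zpow_natCast, Int.toNat_of_nonneg (by omega), ← zpow_add]
    congr 2; ring
  have hdiv : ∀ i j : Idx ({0} : Set (ZMod n)), i < j → (i : ℤ) / n ≤ (j : ℤ) / n :=
    fun i j hij => Int.ediv_le_ediv (by omega) (le_of_lt hij)
  have hstab : ∀ k : ℤ, IsStable (F.aut (π := π)) (w ^ k • M) := fun k =>
    hM.smul ((unifAut_commute _).symm.zpow_left _)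
  have hchain : IsStableChain (F.aut (π := π)) (J := ({0} : Set (ZMod n)))
      fun i => w ^ (-((i : ℤ) / n)) • M := by
    refine ⟨fun i => fg_smul hfg, fun i => hstab _, fun i j hij => ?_, fun i j hij => ?_,
      fun i j hij => ?_⟩
    · rw [hw _ _ (hdiv i j hij)]
      exact smul_le_smul.mpr (pow_smul_le (unifAut_smul_le M) _)
    · rw [hw _ _ (hdiv i j hij), colength_smul _ (pow_smul_le (unifAut_smul_le M) _),
        colength_unifAut_pow_smul hfg, hspan, finrank_top, hN, ← Nat.cast_mul]
      congr 1
      have h1 := hdiv i j hij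
      zify
      have h2 : (i : ℤ) < j := hij
      rw [Int.toNat_of_nonneg (by omega), Int.toNat_of_nonneg (by omega)]
      rw [hidx i, hidx j, Int.mul_ediv_cancel_left _ hn', Int.mul_ediv_cancel_left _ hn']
      ring
    · rw [hij, Int.add_ediv_of_dvd_right dvd_rfl, Int.ediv_self hn', smul_smul]
      congr 1
      change _ = w⁻¹ * _
      rw [neg_add_rev, zpow_add, zpow_neg_one]
  obtain ⟨C, hC, -⟩ := hchain.exists_full_chain (r := r) hn (Set.singleton_nonempty 0)
    (fun i => span_smul_top hspan) (fun i => by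
      rw [← hr]
      exact colength_smul_eq_of_span_eq (fg_smul hfg) hfg ((span_smul_top hspan).trans hspan.symm)
        (hstab _).2 hM.2)
  exact ⟨_, (X.forget π F r (Set.subset_univ I) ⟨C, hC⟩).2⟩

end Refinement

/-! ### Bounded and unit parts of a semilinear automorphism -/

section Parts

variable {p : ℕ} [hp : Fact p.Prime] {K : IntermediateField ℚ_[p] (PadicAlgCl p)}
  {N : Type*} [AddCommGroup N] [Module (L K) N] {ϖ : L K}

theorem restrictScalars_smul_eq {U : Submodule (L K) N} {g : semiAut ϖ N}
    (hU : ∀ x, g • x ∈ U ↔ x ∈ U) :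
    g • U.restrictScalars (OL K) = U.restrictScalars (OL K) := by
  ext x
  rw [mem_smul_iff]
  change g⁻¹ • x ∈ U ↔ x ∈ U
  rw [← hU, smul_inv_smul]

variable [hϖ : IsLUniformizer ϖ]

variable (ϖ) in
/-- A class of `O_L`-submodules containing `⊥` and stable under sums and under multiplication by
powers of `ϖ`. -/
structure IsLatticeClass (P : Submodule (OL K) N → Prop) : Prop where
  bot : P ⊥
  sup : ∀ {M M'}, P M → P M' → P (M ⊔ M')
  zpow_smul : ∀ {M} (k : ℤ), P M → P (unifAut ϖ N ^ k • M)

/-- The union of the finitely generated submodules in a lattice class. -/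
def IsLatticeClass.union {P : Submodule (OL K) N → Prop} (hP : IsLatticeClass ϖ P) :
    Submodule (L K) N where
  carrier := {x | ∃ M : Submodule (OL K) N, M.FG ∧ P M ∧ x ∈ M}
  zero_mem' := ⟨⊥, Submodule.fg_bot, hP.bot, Submodule.zero_mem _⟩
  add_mem' := by
    rintro x y ⟨M, h1, h2, h3⟩ ⟨M', h1', h2', h3'⟩
    exact ⟨M ⊔ M', h1.sup h1', hP.sup h2 h2', Submodule.add_mem _ (Submodule.mem_sup_left h3)
      (Submodule.mem_sup_right h3')⟩
  smul_mem' := by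
    rintro c x ⟨M, h1, h2, h3⟩
    by_cases hc : c = 0
    · rw [hc, zero_smul]
      exact ⟨M, h1, h2, Submodule.zero_mem _⟩
    obtain ⟨k, u, hu, rfl⟩ := exists_eq_unif_zpow_mul ϖ hc
    refine ⟨unifAut ϖ N ^ k • M, fg_smul h1, hP.zpow_smul k h2, ?_⟩
    rw [mul_smul, ← unifAut_zpow_smul]
    exact smul_mem_smul.mpr (M.smul_mem (⟨u, hu.le⟩ : OL K) h3)

theorem IsLatticeClass.le_union {P : Submodule (OL K) N → Prop} (hP : IsLatticeClass ϖ P)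
    {M : Submodule (OL K) N} (hM : M.FG) (hPM : P M) :
    M ≤ hP.union.restrictScalars (OL K) := fun _ hx => ⟨M, hM, hPM, hx⟩

theorem IsLatticeClass.exists_le {P : Submodule (OL K) N → Prop} (hP : IsLatticeClass ϖ P)
    {C : Submodule (OL K) N} (hC : C.FG) (h : C ≤ hP.union.restrictScalars (OL K)) :
    ∃ M : Submodule (OL K) N, M.FG ∧ P M ∧ C ≤ M := by
  induction C, hC using Submodule.fg_induction with
  | singleton x =>
    obtain ⟨M, h1, h2, h3⟩ := h (Submodule.mem_span_singleton_self x)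
    exact ⟨M, h1, h2, (Submodule.span_singleton_le_iff_mem _ _).mpr h3⟩
  | sup C C' _ _ ih ih' =>
    obtain ⟨M, h1, h2, h3⟩ := ih (le_sup_left.trans h)
    obtain ⟨M', h1', h2', h3'⟩ := ih' (le_sup_right.trans h)
    exact ⟨M ⊔ M', h1.sup h1', hP.sup h2 h2', sup_le_sup h3 h3'⟩

/-- In finite dimension the union is spanned by a single lattice of the class. -/
theorem IsLatticeClass.exists_span_eq [FiniteDimensional (L K) N]
    {P : Submodule (OL K) N → Prop} (hP : IsLatticeClass ϖ P) :
    ∃ M : Submodule (OL K) N, M.FG ∧ P M ∧ Submodule.span (L K) (M : Set N) = hP.union := by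
  obtain ⟨s, hs⟩ := (IsNoetherian.noetherian hP.union : hP.union.FG)
  have hsU : Submodule.span (OL K) (s : Set N) ≤ hP.union.restrictScalars (OL K) :=
    Submodule.span_le.mpr fun x hx => by
      change x ∈ hP.union
      rw [← hs]; exact Submodule.subset_span hx
  obtain ⟨M, h1, h2, h3⟩ := hP.exists_le ⟨s, rfl⟩ hsU
  refine ⟨M, h1, h2, le_antisymm (Submodule.span_le.mpr (hP.le_union h1 h2)) ?_⟩
  rw [← hs]
  exact Submodule.span_mono fun x hx => h3 (Submodule.subset_span hx)

theorem IsLatticeClass.smul_mem_union_iff {P : Submodule (OL K) N → Prop}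
    (hP : IsLatticeClass ϖ P) {g : semiAut ϖ N} (hg : ∀ M, P (g • M) ↔ P M) {x : N} :
    g • x ∈ hP.union ↔ x ∈ hP.union := by
  constructor
  · rintro ⟨M, h1, h2, h3⟩
    refine ⟨g⁻¹ • M, fg_smul h1, ?_, mem_smul_iff.mpr (by rwa [inv_inv])⟩
    rw [← hg, smul_inv_smul]
    exact h2
  · rintro ⟨M, h1, h2, h3⟩
    exact ⟨g • M, fg_smul h1, (hg M).mpr h2, smul_mem_smul.mpr h3⟩

theorem isLatticeClass_le (g : semiAut ϖ N) :
    IsLatticeClass ϖ fun M : Submodule (OL K) N => g • M ≤ M where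
  bot := (smul_bot' g).le
  sup h h' := by rw [smul_sup']; exact sup_le_sup h h'
  zpow_smul k h := by
    rw [smul_smul, ((unifAut_commute g).zpow_right k).eq, mul_smul]
    exact smul_le_smul.mpr h

theorem isLatticeClass_eq (g : semiAut ϖ N) :
    IsLatticeClass ϖ fun M : Submodule (OL K) N => g • M = M where
  bot := smul_bot' g
  sup h h' := by rw [smul_sup', h, h']
  zpow_smul k h := by
    rw [smul_smul, ((unifAut_commute g).zpow_right k).eq, mul_smul, h]

/-- The vectors with bounded forward orbit under `g`. -/
def boundedPart (g : semiAut ϖ N) : Submodule (L K) N := (isLatticeClass_le g).union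

/-- The vectors contained in a lattice fixed by `g`. -/
def unitPart (g : semiAut ϖ N) : Submodule (L K) N := (isLatticeClass_eq g).union

theorem smul_mem_boundedPart_iff {g h : semiAut ϖ N} (hgh : Commute g h) {x : N} :
    h • x ∈ boundedPart g ↔ x ∈ boundedPart g :=
  (isLatticeClass_le g).smul_mem_union_iff fun M => by
    rw [smul_smul, hgh.eq, mul_smul, smul_le_smul]

theorem smul_mem_unitPart_iff {g h : semiAut ϖ N} (hgh : Commute g h) {x : N} :
    h • x ∈ unitPart g ↔ x ∈ unitPart g :=
  (isLatticeClass_eq g).smul_mem_union_iff fun M => by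
    rw [smul_smul, hgh.eq, mul_smul, smul_left_cancel_iff]

theorem mem_boundedPart_of_forall [IsDiscreteValuationRing (OL K)] {g : semiAut ϖ N}
    {M : Submodule (OL K) N} (hM : M.FG) {x : N} (h : ∀ k : ℕ, g ^ k • x ∈ M) :
    x ∈ boundedPart g := by
  have hle : Submodule.span (OL K) (Set.range fun k : ℕ => g ^ k • x) ≤ M :=
    Submodule.span_le.mpr (by rintro _ ⟨k, rfl⟩; exact h k)
  refine ⟨_, hM.of_le hle, ?_, Submodule.subset_span ⟨0, by simp⟩⟩
  change g • _ ≤ _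
  rw [smul_span', Submodule.span_le]
  rintro _ ⟨_, ⟨k, rfl⟩, rfl⟩
  exact Submodule.subset_span ⟨k + 1, by simp [pow_succ', mul_smul]⟩

/-- On the unit part of `g` the map `g` is an isometry for some norm, so that it does not meet the
part on which `g` is contracting. -/
theorem disjoint_unitPart [IsDiscreteValuationRing (OL K)] (g : semiAut ϖ N) :
    Disjoint (unitPart g) (boundedPart ((unifAut ϖ N)⁻¹ * g)) := by
  rw [Submodule.disjoint_def]
  rintro x ⟨M, hM, hgM, hxM⟩ hx
  have hcomm : Commute ((unifAut ϖ N)⁻¹ * g) g :=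
    ((unifAut_commute g).symm.inv_left).mul_left (Commute.refl g)
  set V := (boundedPart ((unifAut ϖ N)⁻¹ * g)).restrictScalars (OL K) with hV
  have hgV : g • V = V := restrictScalars_smul_eq fun x => smul_mem_boundedPart_iff hcomm
  have hE : (M ⊓ V).FG := hM.of_le inf_le_left
  have hgE : ∀ j : ℕ, g ^ j • (M ⊓ V) = M ⊓ V := by
    intro j
    induction j with
    | zero => simp
    | succ j ih => rw [pow_succ, mul_smul, smul_inf', hgM, hgV, ih]
  obtain ⟨M', hM', hgM', hEM'⟩ := (isLatticeClass_le _).exists_le hE inf_le_right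
  refine eq_zero_of_forall_mem_pow hM' (ϖ := ϖ) fun j => ?_
  have h1 : x ∈ g ^ j • (M ⊓ V) := by rw [hgE]; exact ⟨hxM, hx⟩
  have h2 : g ^ j = unifAut ϖ N ^ j * ((unifAut ϖ N)⁻¹ * g) ^ j := by
    rw [((unifAut_commute g).symm.inv_left).mul_pow, ← mul_assoc, inv_pow, mul_inv_cancel, one_mul]
  have h3 : g ^ j • M' ≤ unifAut ϖ N ^ j • M' := by
    rw [h2, mul_smul]
    exact smul_le_smul.mpr (pow_smul_le hgM' j)
  exact h3 (smul_le_smul.mpr hEM' h1)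

end Parts

/-! ### Completeness and linear compactness -/

section Decomposition

variable {p : ℕ} [hp : Fact p.Prime] {K : IntermediateField ℚ_[p] (PadicAlgCl p)}
  {N : Type*} [AddCommGroup N] [Module (L K) N] {ϖ : L K} [hϖ : IsLUniformizer ϖ]

/-- A finitely generated module is complete: backward iteration of a contracting semilinear map
converges. -/
theorem exists_contracting_tails [IsDiscreteValuationRing (OL K)] {c : semiAut ϖ N}
    {B : Submodule (OL K) N} (hB : B.FG) (hc : c • B ≤ unifAut ϖ N • B) {b : ℕ → N}
    (hb : ∀ j, b j ∈ B) : ∃ s : ℕ → N, (∀ j, s j ∈ B) ∧ ∀ j, s j = c • (b j + s (j + 1)) := by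
  have hcB : c • B ≤ B := hc.trans (unifAut_smul_le B)
  have hck : ∀ k : ℕ, c ^ k • B ≤ unifAut ϖ N ^ k • B := by
    intro k
    induction k with
    | zero => simp
    | succ k ih =>
      rw [pow_succ', mul_smul, pow_succ, mul_smul]
      refine (smul_le_smul.mpr ih).trans ?_
      rw [smul_smul, ((unifAut_commute c).pow_right k).eq, mul_smul]
      exact smul_le_smul.mpr hc
  -- the partial sums of `s j = ∑ i, c ^ (i + 1) • b (j + i)`
  let y : ℕ → ℕ → N := fun j k => ∑ i ∈ Finset.range k, c ^ (i + 1) • b (j + i)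
  have hyS : ∀ j k, y j (k + 1) = c • (b j + y (j + 1) k) := by
    intro j k
    simp only [y]
    rw [Finset.sum_range_succ', smul_add, Finset.smul_sum, add_comm]
    refine congrArg₂ (· + ·) ?_ ?_
    · rw [zero_add, pow_one, add_zero]
    · refine Finset.sum_congr rfl fun i _ => ?_
      rw [smul_smul, ← pow_succ', add_assoc j 1 i, add_comm 1 i]
  have hlim : ∀ j, ∃ s ∈ B, ∀ k, s - y j k ∈ unifAut ϖ N ^ k • B := fun j => by
    refine exists_limit hB (by simp [y]) fun k => ?_
    simp only [y]
    rw [Finset.sum_range_succ, add_sub_cancel_left]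
    refine hck k ?_
    rw [pow_succ, mul_smul]
    exact smul_mem_smul.mpr (hcB (smul_mem_smul.mpr (hb _)))
  choose s hs1 hs2 using hlim
  refine ⟨s, hs1, fun j => sub_eq_zero.mp (eq_zero_of_forall_mem_pow hB (ϖ := ϖ) fun k => ?_)⟩
  have h1 : s j - y j (k + 1) ∈ unifAut ϖ N ^ k • B :=
    pow_smul_anti (unifAut_smul_le B) k.le_succ (hs2 j (k + 1))
  have h2 : c • (s (j + 1) - y (j + 1) k) ∈ unifAut ϖ N ^ k • B := by
    have := smul_mem_smul (g := c).mpr (hs2 (j + 1) k)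
    rw [smul_smul, ((unifAut_commute c).pow_right k).eq, mul_smul] at this
    exact smul_le_smul.mpr hcB this
  have := Submodule.sub_mem _ h1 h2
  rw [hyS] at this
  convert this using 1
  simp only [smul_add, smul_sub]
  abel

theorem exists_fg_le_sup {C P S : Submodule (OL K) N} (hC : C.FG) (h : C ≤ P ⊔ S) :
    ∃ B : Submodule (OL K) N, B.FG ∧ B ≤ S ∧ C ≤ P ⊔ B := by
  induction C, hC using Submodule.fg_induction with
  | singleton x =>
    obtain ⟨y, hy, z, hz, rfl⟩ := Submodule.mem_sup.mp (h (Submodule.mem_span_singleton_self x))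
    refine ⟨Submodule.span (OL K) {z}, Submodule.fg_span_singleton z,
      (Submodule.span_singleton_le_iff_mem _ _).mpr hz,
      (Submodule.span_singleton_le_iff_mem _ _).mpr ?_⟩
    exact Submodule.add_mem_sup hy (Submodule.mem_span_singleton_self z)
  | sup C C' _ _ ih ih' =>
    obtain ⟨B, h1, h2, h3⟩ := ih (le_sup_left.trans h)
    obtain ⟨B', h1', h2', h3'⟩ := ih' (le_sup_right.trans h)
    exact ⟨B ⊔ B', h1.sup h1', sup_le h2 h2', sup_le (h3.trans (sup_le_sup_left le_sup_left _))
      (h3'.trans (sup_le_sup_left le_sup_right _))⟩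

variable [IsDiscreteValuationRing (OL K)]

/-- Submodules of a finitely generated module are closed for the `ϖ`-adic topology. -/
theorem mem_of_forall_mem_sup {G M : Submodule (OL K) N} (hM : M.FG) (hGM : G ≤ M) {x : N}
    (hx : ∀ k : ℕ, x ∈ G ⊔ unifAut ϖ N ^ k • M) : x ∈ G := by
  have hfin : Module.Finite (OL K) M := Module.Finite.iff_fg.mpr hM
  have hxM : x ∈ M := by
    have := hx 0
    rwa [pow_zero, one_smul, sup_eq_right.mpr hGM] at this
  have h1 : (G.submoduleOf M).mkQ ⟨x, hxM⟩ ∈ (⨅ i : ℕ,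
      IsLocalRing.maximalIdeal (OL K) ^ i • ⊤ : Submodule (OL K) (M ⧸ G.submoduleOf M)) := by
    refine Submodule.mem_iInf _ |>.mpr fun k => ?_
    obtain ⟨g, hg, z, hz, hgz⟩ := Submodule.mem_sup.mp (hx k)
    obtain ⟨m, hm, rfl⟩ := mem_unifAut_pow_smul_iff.mp hz
    have h2 : (G.submoduleOf M).mkQ ⟨x, hxM⟩ = unif ϖ ^ k • (G.submoduleOf M).mkQ ⟨m, hm⟩ := by
      rw [← map_smul]
      refine mkQ_eq_iff.mpr ?_
      change x - ϖ ^ k • m ∈ G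
      rwa [← hgz, add_sub_cancel_right]
    rw [h2]
    refine Submodule.smul_mem_smul (Ideal.pow_mem_pow ?_ k) trivial
    exact (mem_maximalIdeal_iff_unif_dvd ϖ).mpr dvd_rfl
  rw [Ideal.iInf_pow_smul_eq_bot_of_isLocalRing _ (Ideal.IsPrime.ne_top inferInstance)] at h1
  exact mkQ_eq_zero_iff.mp h1

/-- Linear compactness of finitely generated modules (Chevalley's theorem). -/
theorem exists_le_smul_sup_iInf {M : Submodule (OL K) N} (hM : M.FG)
    {G : ℕ → Submodule (OL K) N} (hG : Antitone G) (hGM : ∀ k, G k ≤ M) :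
    ∃ k, G k ≤ unifAut ϖ N • M ⊔ ⨅ k, G k := by
  have hstab : ∀ n : ℕ, ∃ k, ∀ k', k ≤ k' → G k ≤ G k' ⊔ unifAut ϖ N ^ n • M := by
    intro n
    have hfun : ∀ k, ∃ j, colength (unifAut ϖ N ^ n • M) (G k ⊔ unifAut ϖ N ^ n • M) = (j : ℕ) :=
      fun k => ENat.ne_top_iff_exists.mp (ne_top_of_le_ne_top (by
        rw [colength_unifAut_pow_smul hM, ← Nat.cast_mul]; exact ENat.natCast_ne_top _)
        (colength_mono_right le_sup_right (sup_le (hGM k) (pow_smul_le (unifAut_smul_le M) n))))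
        |>.imp fun _ h => h.symm
    choose ℓ hℓ using hfun
    obtain ⟨k, -, hk⟩ := WellFounded.has_min (measure ℓ).wf Set.univ ⟨0, trivial⟩
    refine ⟨k, fun k' hkk' => ?_⟩
    have h1 : ¬ ℓ k' < ℓ k := hk k' trivial
    have h2 := colength_add (A := unifAut ϖ N ^ n • M) (B := G k' ⊔ unifAut ϖ N ^ n • M)
      (C := G k ⊔ unifAut ϖ N ^ n • M) le_sup_right (sup_le_sup_right (hG hkk') _)
    rw [hℓ, hℓ] at h2
    refine le_sup_left.trans (b := G k ⊔ unifAut ϖ N ^ n • M) (colength_eq_zero_iff.mp ?_)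
    obtain ⟨j, hj⟩ := ENat.ne_top_iff_exists.mp (ne_top_of_le_ne_top (ENat.natCast_ne_top (ℓ k))
      (h2 ▸ le_add_self))
    rw [← hj] at h2 ⊢
    have h3 : ℓ k = ℓ k' + j := by exact_mod_cast h2
    have : j = 0 := by omega
    simp [this]
  choose k hk using hstab
  -- the stages, made increasing
  let e : ℕ → ℕ := fun n => ∑ i ∈ Finset.range (n + 1), k i
  have he : ∀ n, k n ≤ e n := fun n =>
    Finset.single_le_sum (f := k) (fun _ _ => Nat.zero_le _) (Finset.self_mem_range_succ n)
  have hstep : ∀ n k', G (e n) ≤ G k' ⊔ unifAut ϖ N ^ n • M := fun n k' =>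
    (hG (he n)).trans <| (hk n (max (k n) k') (le_max_left _ _)).trans
      (sup_le_sup_right (hG (le_max_right _ _)) _)
  refine ⟨e 1, fun x hx => ?_⟩
  have hnext : ∀ (n : ℕ) (y : {y // y ∈ G (e n)}), ∃ z : {z // z ∈ G (e (n + 1))},
      (z : N) - y ∈ unifAut ϖ N ^ n • M := by
    rintro n ⟨y, hy⟩
    obtain ⟨z, hz, m, hm, rfl⟩ := Submodule.mem_sup.mp (hstep n (e (n + 1)) hy)
    exact ⟨⟨z, hz⟩, by rw [sub_add_cancel_left]; exact Submodule.neg_mem _ hm⟩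
  choose u hu using hnext
  let z : ∀ n : ℕ, {y // y ∈ G (e (n + 1))} := fun n =>
    Nat.rec (motive := fun n => {y // y ∈ G (e (n + 1))}) ⟨x, hx⟩ (fun n y => u (n + 1) y) n
  have hz : ∀ n, (z (n + 1) : N) - z n ∈ unifAut ϖ N ^ (n + 1) • M := fun n => hu (n + 1) (z n)
  obtain ⟨y, hyM, hy⟩ := exists_limit (x := fun n => (z n : N)) hM (hGM _ (z 0).2)
    fun n => pow_smul_anti (unifAut_smul_le M) n.le_succ (hz n)
  have hyG : y ∈ ⨅ k, G k := by
    refine Submodule.mem_iInf _ |>.mpr fun k' => mem_of_forall_mem_sup (ϖ := ϖ) hM (hGM k') fun n => ?_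
    rw [← sub_add_cancel y (z n : N)]
    refine Submodule.add_mem _ (Submodule.mem_sup_right (hy n)) ?_
    refine (sup_le_sup_left (pow_smul_anti (unifAut_smul_le M) n.le_succ) _) (hstep (n + 1) k' (z n).2)
  have h0 : (z 1 : N) - x ∈ unifAut ϖ N • M := by
    have : (z 1 : N) - x ∈ unifAut ϖ N ^ (0 + 1) • M := hz 0
    rwa [zero_add, pow_one] at this
  have h1 : y - z 1 ∈ unifAut ϖ N • M := by simpa using hy 1
  have : x = -(y - z 1 + (z 1 - x)) + y := by abel
  rw [this]
  exact Submodule.add_mem_sup (Submodule.neg_mem _ (Submodule.add_mem _ h1 h0)) hyG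

end Decomposition

/-! ### Splitting off the bounded part -/

section SlopeSplitting

variable {p : ℕ} [hp : Fact p.Prime] {K : IntermediateField ℚ_[p] (PadicAlgCl p)}
  {N : Type*} [AddCommGroup N] [Module (L K) N] {ϖ : L K}

/-- The vectors `x` with `g ^ j • x ∈ X` for all `j < k`. -/
def initialPart (g : semiAut ϖ N) (X : Submodule (OL K) N) (k : ℕ) : Submodule (OL K) N :=
  ⨅ (j : ℕ) (_ : j < k), (g ^ j)⁻¹ • X

theorem mem_initialPart {g : semiAut ϖ N} {X : Submodule (OL K) N} {k : ℕ} {x : N} :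
    x ∈ initialPart g X k ↔ ∀ j < k, g ^ j • x ∈ X := by
  simp only [initialPart, Submodule.mem_iInf, mem_smul_iff, inv_inv]

theorem initialPart_antitone (g : semiAut ϖ N) (X : Submodule (OL K) N) :
    Antitone (initialPart g X) := fun _ _ h _ hx =>
  mem_initialPart.mpr fun j hj => mem_initialPart.mp hx j (hj.trans_le h)

variable [hϖ : IsLUniformizer ϖ]

theorem unifAut_smul_restrictScalars (k : ℤ) (U : Submodule (L K) N) :
    unifAut ϖ N ^ k • U.restrictScalars (OL K) = U.restrictScalars (OL K) :=
  restrictScalars_smul_eq fun x => by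
    rw [unifAut_zpow_smul]
    exact U.smul_mem_iff (zpow_ne_zero _ hϖ.ne_zero)

variable [IsDiscreteValuationRing (OL K)] {g : semiAut ϖ N} {U : Submodule (L K) N}
  {M : Submodule (OL K) N}

/-- If `x` stays at bounded distance of the bounded part of `g`, then `x` is in the bounded part. -/
theorem mem_boundedPart_of_forall_mem_sup (hM : M.FG) {S : Submodule (OL K) N}
    (hS : S ≤ (boundedPart g).restrictScalars (OL K)) (hgS : g • S ≤ S) {x : N}
    (hx : ∀ j : ℕ, g ^ j • x ∈ M ⊔ S) : x ∈ boundedPart g := by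
  let T : Submodule (OL K) N := ⨅ k, initialPart g (M ⊔ S) k
  have hT : ∀ {x}, x ∈ T ↔ ∀ j : ℕ, g ^ j • x ∈ M ⊔ S := by
    intro x
    simp only [T, Submodule.mem_iInf, mem_initialPart]
    exact ⟨fun h j => h (j + 1) j j.lt_succ_self, fun h _ j _ => h j⟩
  have hST : S ≤ T := fun s hs => hT.mpr fun j =>
    Submodule.mem_sup_right (pow_smul_le hgS j (smul_mem_smul.mpr hs))
  have hTsup : T ≤ (M ⊓ T) ⊔ S := by
    intro x hx
    have h0 : x ∈ M ⊔ S := by simpa using hT.mp hx 0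
    obtain ⟨m, hm, s, hs, rfl⟩ := Submodule.mem_sup.mp h0
    refine Submodule.add_mem_sup ⟨hm, ?_⟩ hs
    have := T.sub_mem hx (hST hs)
    rwa [add_sub_cancel_right] at this
  have hgT : g • T ≤ T := by
    rw [smul_le_iff_le_inv_smul]
    intro x hx
    rw [mem_smul_iff, inv_inv]
    refine hT.mpr fun j => ?_
    rw [smul_smul, ← pow_succ]
    exact hT.mp hx (j + 1)
  have hP : (M ⊓ T).FG := hM.of_le inf_le_left
  obtain ⟨B₀, hB₀, hB₀S, hPB₀⟩ := exists_fg_le_sup (fg_smul (g := g) hP)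
    ((smul_le_smul.mpr inf_le_right).trans (hgT.trans hTsup))
  obtain ⟨B, hB, hgB, hB₀B⟩ := (isLatticeClass_le g).exists_le hB₀ (hB₀S.trans hS)
  have hPle : (M ⊓ T) ⊔ B ≤ (boundedPart g).restrictScalars (OL K) := by
    refine (isLatticeClass_le g).le_union (hP.sup hB) ?_
    rw [smul_sup']
    exact sup_le (hPB₀.trans (sup_le_sup_left hB₀B _)) (hgB.trans le_sup_right)
  exact sup_le (le_sup_left.trans hPle) hS (hTsup (hT.mpr hx))

/-- Outside the bounded part `S` of `g`, the map `g⁻¹` is topologically nilpotent, hence some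
negative power of `g` is contracting modulo `S`. -/
theorem exists_contracting_lattice (hU : ∀ x, g • x ∈ U ↔ x ∈ U) (hM : M.FG)
    (hspan : Submodule.span (L K) (M : Set N) = U) :
    ∃ (k : ℕ) (G : Submodule (OL K) N),
      (U ⊓ boundedPart g).restrictScalars (OL K) ≤ G ∧
      G ≤ M ⊔ (U ⊓ boundedPart g).restrictScalars (OL K) ∧
      (∀ x ∈ U, ∃ c : ℕ, ϖ ^ c • x ∈ G) ∧ ((unifAut ϖ N)⁻¹ * (g ^ k)⁻¹) • G ≤ G := by
  set S := (U ⊓ boundedPart g).restrictScalars (OL K) with hSdef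
  set X := M ⊔ S with hX
  have hw : ∀ V : Submodule (OL K) N, unifAut ϖ N • V ≤ V := unifAut_smul_le
  have hUpow : ∀ (j : ℕ) x, x ∈ U → g ^ j • x ∈ U := by
    intro j x hx
    induction j with
    | zero => simpa using hx
    | succ j ih => rw [pow_succ', mul_smul]; exact (hU _).mpr ih
  have hUinv : ∀ x, x ∈ U → g⁻¹ • x ∈ U := fun x hx => by rwa [← hU, smul_inv_smul]
  have hgS : g • S = S := restrictScalars_smul_eq fun x =>
    and_congr (hU x) (smul_mem_boundedPart_iff (Commute.refl g))
  have hwS : unifAut ϖ N • S = S := by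
    have := unifAut_smul_restrictScalars (ϖ := ϖ) 1 (U ⊓ boundedPart g)
    rwa [zpow_one] at this
  have hMU : M ≤ U.restrictScalars (OL K) := by rw [← hspan]; exact Submodule.subset_span
  have hXU : X ≤ U.restrictScalars (OL K) := sup_le hMU fun _ h => h.1
  have hSG : ∀ k, S ≤ initialPart g X k := fun k s hs => mem_initialPart.mpr fun j _ =>
    Submodule.mem_sup_right (pow_smul_le hgS.le j (smul_mem_smul.mpr hs))
  -- a long initial segment of the orbit in `X` forces `x ∈ ϖ X`
  obtain ⟨k, hk⟩ : ∃ k, ∀ x, x ∈ initialPart g X (k + 1) → x ∈ unifAut ϖ N • X := by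
    obtain ⟨k, hk⟩ := exists_le_smul_sup_iInf (ϖ := ϖ) hM (G := fun k => M ⊓ initialPart g X k)
      (fun _ _ h => inf_le_inf_left _ (initialPart_antitone g X h)) (fun _ => inf_le_left)
    refine ⟨k, fun x hx => ?_⟩
    have hxX : x ∈ X := by simpa using mem_initialPart.mp hx 0 k.succ_pos
    have hx' := initialPart_antitone g X k.le_succ hx
    obtain ⟨m, hm, s, hs, rfl⟩ := Submodule.mem_sup.mp hxX
    have hmG : m ∈ initialPart g X k := by
      have := Submodule.sub_mem _ hx' (hSG k hs)
      rwa [add_sub_cancel_right] at this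
    rw [hX, smul_sup', hwS]
    refine Submodule.add_mem _ ?_ (Submodule.mem_sup_right hs)
    refine (show _ ≤ unifAut ϖ N • M ⊔ S from sup_le_sup_left (fun y hy => ?_) _) (hk ⟨hm, hmG⟩)
    have hyM : ∀ i, y ∈ M ⊓ initialPart g X i := fun i => (Submodule.mem_iInf _).mp hy i
    refine ⟨hMU (hyM 0).1, mem_boundedPart_of_forall_mem_sup hM (S := S) (fun _ h => h.2) hgS.le
      fun j => mem_initialPart.mp (hyM (j + 1)).2 j j.lt_succ_self⟩
  have habs : ∀ y ∈ U, ∃ c : ℕ, ∀ d, c ≤ d → ϖ ^ d • y ∈ X := by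
    intro y hy
    obtain ⟨c, hc⟩ := exists_pow_smul_mem (ϖ := ϖ) (hspan.symm ▸ hy)
    refine ⟨c, fun d hd => Submodule.mem_sup_left ?_⟩
    obtain ⟨e, rfl⟩ := Nat.exists_eq_add_of_le' hd
    rw [pow_add, mul_smul]
    exact M.smul_mem (unif ϖ ^ e) hc
  have hk' : ∀ x ∈ U, (∀ j, 1 ≤ j → j < k + 1 → g ^ j • x ∈ X) → x ∈ X := by
    intro x hxU hx
    obtain ⟨c, hc⟩ := habs x hxU
    have hc' := hc c le_rfl
    clear hxU hc
    induction c generalizing x with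
    | zero => simpa using hc'
    | succ c ih =>
      refine ih x hx ?_
      have h1 : ∀ j, g ^ j • unifAut ϖ N • ϖ ^ c • x = ϖ ^ (c + 1) • g ^ j • x := by
        intro j
        rw [← unifAut_pow_smul, ← unifAut_pow_smul, smul_smul, smul_smul, smul_smul]
        congr 1
        rw [mul_assoc, ← pow_succ', ((unifAut_commute (g ^ j)).pow_right (c + 1)).eq]
      have h2 : unifAut ϖ N • ϖ ^ c • x ∈ unifAut ϖ N • X := by
        refine hk _ (mem_initialPart.mpr fun j hj => ?_)
        rw [h1]
        rcases Nat.eq_zero_or_pos j with rfl | hj0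
        · simpa using hc'
        · exact X.smul_mem (unif ϖ ^ (c + 1)) (hx j hj0 hj)
      exact smul_mem_smul.mp h2
  let G := initialPart g X (k + 1)
  have hGX : G ≤ X := fun x hx => by simpa using mem_initialPart.mp hx 0 k.succ_pos
  have hshift : ∀ x ∈ G, g⁻¹ • x ∈ G := by
    intro x hx
    have h1 : ∀ j, 1 ≤ j → j < k + 1 → g ^ j • g⁻¹ • x ∈ X := by
      intro j hj hjk
      obtain ⟨i, rfl⟩ := Nat.exists_eq_add_of_le' hj
      rw [pow_succ, mul_smul, smul_inv_smul]
      exact mem_initialPart.mp hx i (by omega)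
    have h2 := hk' _ (hUinv x (hXU (hGX hx))) h1
    refine mem_initialPart.mpr fun j hj => ?_
    rcases Nat.eq_zero_or_pos j with rfl | hj0
    · simpa using h2
    · exact h1 j hj0 hj
  have hshift' : ∀ (i : ℕ), ∀ x ∈ G, (g ^ i)⁻¹ • x ∈ G := by
    intro i
    induction i with
    | zero => intro x hx; simpa using hx
    | succ i ih =>
      intro x hx
      rw [pow_succ, mul_inv_rev, mul_smul]
      exact hshift _ (ih x hx)
  refine ⟨k + 1, G, hSG _, hGX, fun x hx => ?_, ?_⟩
  · choose c hc using fun j : ℕ => habs _ (hUpow j x hx)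
    refine ⟨∑ j ∈ Finset.range (k + 1), c j, mem_initialPart.mpr fun j hj => ?_⟩
    rw [← unifAut_pow_smul, smul_smul, ((unifAut_commute (g ^ j)).pow_right _).eq, mul_smul,
      unifAut_pow_smul]
    exact hc j _ (Finset.single_le_sum (f := c) (fun _ _ => Nat.zero_le _)
      (Finset.mem_range.mpr hj))
  · rw [smul_le_iff_le_inv_smul]
    intro x hx
    rw [mem_smul_iff, inv_inv]
    refine mem_initialPart.mpr fun j hj => ?_
    have h1 : (g ^ (k - j))⁻¹ • x ∈ G := hshift' _ x hx
    have h2 : (g ^ j * ((unifAut ϖ N)⁻¹ * (g ^ (k + 1))⁻¹)) =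
        (unifAut ϖ N)⁻¹ * (g⁻¹ * (g ^ (k - j))⁻¹) := by
      have h3 : g ^ (k + 1) = g ^ (k - j) * g * g ^ j := by
        rw [← pow_succ, ← pow_add]
        congr 1
        omega
      rw [← mul_assoc, ((unifAut_commute (g ^ j)).inv_right).eq, mul_assoc, h3, mul_inv_rev,
        mul_inv_rev, mul_inv_cancel_left]
    rw [smul_smul, h2, mul_smul, mul_smul, ← mem_smul_iff]
    refine hk _ (mem_initialPart.mpr fun i hi => ?_)
    exact mem_initialPart.mp (hshift _ h1) i hi

/-- A space on which `g` acts is the sum of its bounded part and of the bounded part of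
`ϖ⁻¹ g⁻ᵏ`, for some `k`. -/
theorem exists_le_boundedPart_sup (hU : ∀ x, g • x ∈ U ↔ x ∈ U) (hM : M.FG)
    (hspan : Submodule.span (L K) (M : Set N) = U) :
    ∃ k : ℕ, U ≤ (U ⊓ boundedPart g) ⊔ (U ⊓ boundedPart ((unifAut ϖ N)⁻¹ * (g ^ k)⁻¹)) := by
  obtain ⟨k, G, hSG, hGM, habs, hG⟩ := exists_contracting_lattice hU hM hspan
  refine ⟨k, ?_⟩
  set S := (U ⊓ boundedPart g).restrictScalars (OL K) with hS
  set a := (unifAut ϖ N)⁻¹ * (g ^ k)⁻¹ with ha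
  -- for `x` in a lattice, subtracting the sum of a convergent series in the bounded part of `g`
  -- removes the components of the orbit `aʲ x` which do not stay bounded
  suffices h : ∀ x ∈ G, x ∈ (U ⊓ boundedPart g) ⊔ (U ⊓ boundedPart a) by
    intro x hx
    obtain ⟨c, hc⟩ := habs x hx
    have := Submodule.smul_mem _ (ϖ ^ c)⁻¹ (h _ hc)
    rwa [inv_smul_smul₀ (pow_ne_zero _ hϖ.ne_zero)] at this
  have hMU : M ≤ U.restrictScalars (OL K) := by rw [← hspan]; exact Submodule.subset_span
  have hSU : S ≤ U.restrictScalars (OL K) := fun _ h => h.1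
  have hD : (M ⊓ G).FG := hM.of_le inf_le_left
  have hGD : G ≤ (M ⊓ G) ⊔ S := by
    intro x hx
    obtain ⟨m, hm, s, hs, rfl⟩ := Submodule.mem_sup.mp (hGM hx)
    refine Submodule.add_mem_sup ⟨hm, ?_⟩ hs
    have := G.sub_mem hx (hSG hs)
    rwa [add_sub_cancel_right] at this
  obtain ⟨B₀, hB₀, hB₀S, hDB₀⟩ := exists_fg_le_sup (fg_smul (g := a) hD)
    ((smul_le_smul.mpr inf_le_right).trans (hG.trans hGD))
  obtain ⟨B₁, hB₁, hgB₁, hB₀B₁⟩ := (isLatticeClass_le g).exists_le hB₀ (hB₀S.trans fun _ h => h.2)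
  have hgU : g • U.restrictScalars (OL K) = U.restrictScalars (OL K) := restrictScalars_smul_eq hU
  -- a lattice in `S` which is stable under `g` and absorbs the defect of stability of `M ⊓ G`
  set B := B₁ ⊓ U.restrictScalars (OL K) with hB
  have hBfg : B.FG := hB₁.of_le inf_le_left
  have hgB : g • B ≤ B := by
    rw [smul_inf', hgU]
    exact inf_le_inf_right _ hgB₁
  have hBS : B ≤ S := fun x hx => ⟨hx.2, (isLatticeClass_le g).le_union hB₁ hgB₁ hx.1⟩
  have hDB : a • (M ⊓ G) ≤ (M ⊓ G) ⊔ B :=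
    hDB₀.trans (sup_le_sup_left (le_inf hB₀B₁ (hB₀S.trans hSU)) _)
  have haB : a⁻¹ • B ≤ unifAut ϖ N • B := by
    rw [ha, mul_inv_rev, inv_inv, inv_inv, (unifAut_commute _).eq, mul_smul]
    exact smul_le_smul.mpr (pow_smul_le hgB k)
  have hnext : ∀ x : {x // x ∈ M ⊓ G}, ∃ y : {x // x ∈ M ⊓ G}, a • (x : N) - y ∈ B := by
    intro x
    obtain ⟨y, hy, b, hb, hyb⟩ := Submodule.mem_sup.mp (hDB (smul_mem_smul.mpr x.2))
    exact ⟨⟨y, hy⟩, by rw [← hyb, add_sub_cancel_left]; exact hb⟩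
  choose u hu using hnext
  have hmain : ∀ x ∈ M ⊓ G, ∃ s ∈ B, x - s ∈ boundedPart a := by
    intro x hx
    let z : ℕ → {x // x ∈ M ⊓ G} := fun j => u^[j] ⟨x, hx⟩
    have hz : ∀ j, z (j + 1) = u (z j) := fun j => Function.iterate_succ_apply' u j _
    obtain ⟨s, hs, hs'⟩ := exists_contracting_tails hBfg haB (b := fun j => a • (z j : N) - z (j + 1))
      fun j => by rw [hz]; exact hu (z j)
    refine ⟨s 0, hs 0, mem_boundedPart_of_forall (hD.sup hBfg) fun j => ?_⟩
    have h1 : ∀ j, a ^ j • (x - s 0) = z j - s j := by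
      intro j
      induction j with
      | zero => rw [pow_zero, one_smul]; rfl
      | succ j ih =>
        have := hs' j
        rw [eq_inv_smul_iff] at this
        rw [pow_succ', mul_smul, ih, smul_sub, this]
        abel
    rw [h1, sub_eq_add_neg]
    exact Submodule.add_mem_sup (z j).2 (Submodule.neg_mem _ (hs j))
  intro x hx
  obtain ⟨m, hm, s', hs', rfl⟩ := Submodule.mem_sup.mp (hGD hx)
  obtain ⟨s, hs, hms⟩ := hmain m hm
  have h1 : m + s' = (s + s') + (m - s) := by abel
  rw [h1]
  refine Submodule.add_mem_sup (Submodule.add_mem _ (hBS hs) hs') ⟨?_, hms⟩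
  exact Submodule.sub_mem _ (hMU hm.1) (hSU (hBS hs))

end SlopeSplitting

/-! ### Existence of the slope decomposition -/

section SlopeParts

variable {p : ℕ} [hp : Fact p.Prime] {K : IntermediateField ℚ_[p] (PadicAlgCl p)}
  {N : Type*} [AddCommGroup N] [Module (L K) N] {ϖ : L K} [hϖ : IsLUniformizer ϖ]

/-- The automorphism `ϖ⁻ᵈ fʰ`, for `s = d / h` in lowest terms. -/
def slopeAut (f : semiAut ϖ N) (s : ℚ) : semiAut ϖ N :=
  (unifAut ϖ N ^ s.num)⁻¹ * f ^ s.den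

theorem slopeAut_commute (f : semiAut ϖ N) (s : ℚ) : Commute (slopeAut f s) f :=
  (((unifAut_commute f).symm.zpow_left _).inv_left).mul_left ((Commute.refl f).pow_left _)

theorem slopeAut_smul_le_iff {f : semiAut ϖ N} {s : ℚ} {M : Submodule (OL K) N} :
    slopeAut f s • M ≤ M ↔ f ^ s.den • M ≤ unifAut ϖ N ^ s.num • M := by
  rw [slopeAut, mul_smul, smul_le_iff_le_inv_smul, inv_inv]

theorem slopeAut_smul_eq_iff {f : semiAut ϖ N} {s : ℚ} {M : Submodule (OL K) N} :
    slopeAut f s • M = M ↔ f ^ s.den • M = unifAut ϖ N ^ s.num • M := by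
  rw [slopeAut, mul_smul, inv_smul_eq_iff]

/-- The part of slope `s` of `N`. -/
def slopePart (f : semiAut ϖ N) (s : ℚ) : Submodule (L K) N := unitPart (slopeAut f s)

theorem smul_mem_slopePart_iff {f : semiAut ϖ N} {s : ℚ} {x : N} :
    f • x ∈ slopePart f s ↔ x ∈ slopePart f s :=
  smul_mem_unitPart_iff (slopeAut_commute f s)

/-- The lattice of a stable subspace cut out by a lattice of `N`. -/
theorem span_inf_eq (ϖ : L K) [hϖ : IsLUniformizer ϖ] {M : Submodule (OL K) N} (hM : Submodule.span (L K) (M : Set N) = ⊤)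
    (U : Submodule (L K) N) :
    Submodule.span (L K) ((M ⊓ U.restrictScalars (OL K) : Submodule (OL K) N) : Set N) = U := by
  refine le_antisymm (Submodule.span_le.mpr fun x hx => hx.2) fun x hx => ?_
  obtain ⟨c, hc⟩ := exists_pow_smul_mem (ϖ := ϖ) (A := M) (x := x) (hM ▸ Submodule.mem_top)
  have h1 : ϖ ^ c • x ∈ Submodule.span (L K)
      ((M ⊓ U.restrictScalars (OL K) : Submodule (OL K) N) : Set N) :=
    Submodule.subset_span ⟨hc, U.smul_mem _ hx⟩
  have := Submodule.smul_mem _ (ϖ ^ c)⁻¹ h1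
  rwa [inv_smul_smul₀ (pow_ne_zero _ hϖ.ne_zero)] at this

variable [IsDiscreteValuationRing (OL K)]

/-- The smallest `f`-stable lattice containing the lattice `B`. It inherits the stability properties
of `B` under elements which commute with `f`. -/
theorem exists_stable_hull {f : semiAut ϖ N} {M B : Submodule (OL K) N} (hM : M.FG) (hB : B.FG)
    (hspan : Submodule.span (L K) (B : Set N) = Submodule.span (L K) (M : Set N))
    (hfM : f • M ≤ M) :
    ∃ D : Submodule (OL K) N, D.FG ∧
      Submodule.span (L K) (D : Set N) = Submodule.span (L K) (M : Set N) ∧ f • D ≤ D ∧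
      (∀ g, Commute g f → g • B ≤ B → g • D ≤ D) ∧
      ∀ g, Commute g f → g • B = B → g • D = D := by
  obtain ⟨c, hc⟩ := exists_unifAut_pow_smul_le (ϖ := ϖ) (A := M) hB
    (hspan ▸ Submodule.subset_span)
  have hle : ⨆ i : ℕ, f ^ i • B ≤ (unifAut ϖ N ^ c)⁻¹ • M := by
    refine iSup_le fun i => ?_
    rw [← smul_le_iff_le_inv_smul, smul_smul,
      ← ((unifAut_commute (f ^ i)).pow_right c).eq, mul_smul]
    exact (smul_le_smul.mpr hc).trans (pow_smul_le hfM i)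
  have hgD : ∀ g, Commute g f → g • ⨆ i : ℕ, f ^ i • B = ⨆ i : ℕ, f ^ i • g • B := by
    intro g hg
    rw [smul_iSup']
    refine iSup_congr fun i => ?_
    rw [smul_smul, (hg.pow_right i).eq, mul_smul]
  refine ⟨⨆ i : ℕ, f ^ i • B, (fg_smul hM).of_le hle, le_antisymm ?_ ?_, ?_, ?_, ?_⟩
  · refine Submodule.span_le.mpr fun x hx => ?_
    have h1 := hle hx
    have h2 : (unifAut ϖ N ^ c)⁻¹ • M ≤
        (Submodule.span (L K) (M : Set N)).restrictScalars (OL K) := by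
      have := unifAut_smul_restrictScalars (ϖ := ϖ) (-(c : ℤ)) (Submodule.span (L K) (M : Set N))
      rw [zpow_neg, zpow_natCast] at this
      rw [← this]
      exact smul_le_smul.mpr Submodule.subset_span
    exact h2 h1
  · rw [← hspan]
    refine Submodule.span_mono ?_
    have := le_iSup (fun i : ℕ => f ^ i • B) 0
    rwa [pow_zero, one_smul] at this
  · rw [smul_iSup']
    refine iSup_le fun i => ?_
    rw [smul_smul, ← pow_succ']
    exact le_iSup (fun i : ℕ => f ^ i • B) (i + 1)
  · intro g hg hgB
    rw [hgD g hg]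
    exact iSup_mono fun i => smul_le_smul.mpr hgB
  · intro g hg hgB
    rw [hgD g hg, hgB]

/-- If the commuting operators `f` and `a` are separately bounded on `U`, then they have a common
stable lattice in `U`. -/
theorem exists_bounded_lattice {f a : semiAut ϖ N} (ha : Commute a f) {U : Submodule (L K) N}
    (haU : ∀ x, a • x ∈ U ↔ x ∈ U) {M : Submodule (OL K) N}
    (hM : M.FG) (hspan : Submodule.span (L K) (M : Set N) = U) (hfM : f • M ≤ M)
    (hUa : U ≤ boundedPart a) :
    ∃ D : Submodule (OL K) N, D.FG ∧ Submodule.span (L K) (D : Set N) = U ∧ f • D ≤ D ∧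
      a • D ≤ D := by
  have hMU : M ≤ U.restrictScalars (OL K) := by rw [← hspan]; exact Submodule.subset_span
  obtain ⟨B, hB, haB, hMB⟩ := (isLatticeClass_le a).exists_le hM (hMU.trans fun _ h => hUa h)
  have hBU : Submodule.span (L K) ((B ⊓ U.restrictScalars (OL K) : Submodule (OL K) N) : Set N) =
      Submodule.span (L K) (M : Set N) := by
    refine le_antisymm ?_ (Submodule.span_mono (le_inf hMB hMU))
    rw [hspan]
    exact Submodule.span_le.mpr fun x hx => hx.2
  obtain ⟨D, h1, h2, h3, h4, -⟩ := exists_stable_hull hM (hB.of_le inf_le_left) hBU hfM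
  refine ⟨D, h1, h2.trans hspan, h3, h4 a ha ?_⟩
  rw [smul_inf', restrictScalars_smul_eq haU]
  exact inf_le_inf_right _ haB

theorem exists_colength_smul_eq {f : semiAut ϖ N} {M : Submodule (OL K) N} (hM : M.FG)
    (hU : ∀ x, f • x ∈ Submodule.span (L K) (M : Set N) ↔ x ∈ Submodule.span (L K) (M : Set N))
    (hfM : f • M ≤ M) : ∃ e : ℕ, colength (f • M) M = e := by
  have : colength (f • M) M ≠ ⊤ := by
    refine colength_ne_top ϖ hfM hM fun x hx => ?_
    rw [← smul_inv_smul f x]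
    refine smul_mem_span_smul ?_
    rw [← hU, smul_inv_smul]
    exact Submodule.subset_span hx
  obtain ⟨e, he⟩ := ENat.ne_top_iff_exists.mp this
  exact ⟨e, he.symm⟩

/-- One step of the slope decomposition: a space with mean slope `s` is of slope `s`, or the sum of
two proper subspaces. -/
theorem le_slopePart_or_split {f : semiAut ϖ N} {U : Submodule (L K) N} [FiniteDimensional (L K) U]
    (hU : ∀ x, f • x ∈ U ↔ x ∈ U) {M : Submodule (OL K) N} (hM : M.FG)
    (hspan : Submodule.span (L K) (M : Set N) = U) (hfM : f • M ≤ M) (hU0 : U ≠ ⊥) :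
    (∃ s, U ≤ slopePart f s) ∨ ∃ S Q : Submodule (L K) N, S < U ∧ Q < U ∧ U ≤ S ⊔ Q ∧
      (∀ x, f • x ∈ S ↔ x ∈ S) ∧ ∀ x, f • x ∈ Q ↔ x ∈ Q := by
  obtain ⟨e, he⟩ := exists_colength_smul_eq hM (by rw [hspan]; exact hU) hfM
  set m := Module.finrank (L K) U with hm
  have hm0 : 0 < m := Submodule.one_le_finrank_iff.mpr hU0
  set s : ℚ := e / m with hs
  have hnum : (0 : ℤ) ≤ s.num := Rat.num_nonneg.mpr (by positivity)
  obtain ⟨d, hd⟩ := Int.eq_ofNat_of_zero_le hnum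
  have hdm : d * m = s.den * e := by
    have h1 : (s.num : ℚ) / s.den = e / m := by rw [Rat.num_div_den]
    have h2 : (m : ℚ) ≠ 0 := by exact_mod_cast hm0.ne'
    rw [div_eq_div_iff (by exact_mod_cast s.den_nz) h2, hd] at h1
    push_cast at h1
    have h3 : ((d * m : ℕ) : ℚ) = (s.den * e : ℕ) := by push_cast; linarith
    exact_mod_cast h3
  set g := slopeAut f s with hg
  have hgf : Commute g f := slopeAut_commute f s
  have hwU : ∀ x, unifAut ϖ N • x ∈ U ↔ x ∈ U := fun x => by
    rw [unifAut_smul]; exact U.smul_mem_iff hϖ.ne_zero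
  have hmulU : ∀ {a b : semiAut ϖ N}, (∀ x, a • x ∈ U ↔ x ∈ U) → (∀ x, b • x ∈ U ↔ x ∈ U) →
      ∀ x, (a * b) • x ∈ U ↔ x ∈ U := fun ha hb x => by rw [mul_smul, ha, hb]
  have hinvU : ∀ {a : semiAut ϖ N}, (∀ x, a • x ∈ U ↔ x ∈ U) → ∀ x, a⁻¹ • x ∈ U ↔ x ∈ U :=
    fun ha x => by rw [← ha, smul_inv_smul]
  have hpowU : ∀ {a : semiAut ϖ N}, (∀ x, a • x ∈ U ↔ x ∈ U) → ∀ k : ℕ, ∀ x,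
      a ^ k • x ∈ U ↔ x ∈ U := by
    intro a ha k
    induction k with
    | zero => intro x; rw [pow_zero, one_smul]
    | succ k ih => rw [pow_succ]; exact hmulU ih ha
  have hgU : ∀ x, g • x ∈ U ↔ x ∈ U := by
    rw [hg, slopeAut, hd]
    exact hmulU (hinvU (hpowU hwU d)) (hpowU hU s.den)
  -- in every `f`-stable lattice of `U`, multiplication by `f` has the same colength
  have hlen : ∀ {D : Submodule (OL K) N}, D.FG → Submodule.span (L K) (D : Set N) = U →
      f • D ≤ D → ∀ i : ℕ, colength (f ^ i • D) D = (i * e : ℕ) := by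
    intro D h1 h2 h3 i
    rw [colength_pow_smul h3, colength_smul_eq_of_span_eq h1 hM (h2.trans hspan.symm) h3 hfM, he]
    push_cast; rfl
  have hlen' : ∀ {D : Submodule (OL K) N}, D.FG → Submodule.span (L K) (D : Set N) = U →
      ∀ i : ℕ, colength (unifAut ϖ N ^ i • D) D = (i * m : ℕ) := by
    intro D h1 h2 i
    rw [colength_unifAut_pow_smul h1, h2]
    push_cast; rfl
  obtain ⟨k, hk⟩ := exists_le_boundedPart_sup hgU hM hspan
  set a := (unifAut ϖ N)⁻¹ * (g ^ k)⁻¹ with ha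
  have haf : Commute a f :=
    ((unifAut_commute f).symm.inv_left).mul_left ((hgf.pow_left k).inv_left)
  by_cases hUg : U ≤ boundedPart g
  · left
    obtain ⟨D, h1, h2, h3, h4⟩ := exists_bounded_lattice hgf hgU hM hspan hfM hUg
    refine ⟨s, ?_⟩
    have h5 : f ^ s.den • D = unifAut ϖ N ^ d • D := by
      have h6 := slopeAut_smul_le_iff.mp h4
      rw [hd] at h6
      refine eq_of_colength_eq h6 (pow_smul_le (unifAut_smul_le D) d) ?_ ?_
      · rw [hlen h1 h2 h3, hlen' h1 h2]
        exact congrArg _ hdm.symm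
      · rw [hlen' h1 h2]
        exact ENat.natCast_ne_top _
    rw [← h2]
    refine Submodule.span_le.mpr ((isLatticeClass_eq g).le_union h1 (slopeAut_smul_eq_iff.mpr ?_))
    rw [hd, h5]; rfl
  · right
    refine ⟨U ⊓ boundedPart g, U ⊓ boundedPart a, ?_, ?_, hk, ?_, ?_⟩
    · exact inf_lt_left.mpr hUg
    · -- otherwise there is a lattice `D` with `ϖ ^ (d k) D ≤ ϖ f ^ (h k) D`, where `d m = h e`
      refine inf_lt_left.mpr fun hUa => ?_
      have haU : ∀ x, a • x ∈ U ↔ x ∈ U := hmulU (hinvU hwU) (hinvU (hpowU hgU k))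
      obtain ⟨D, h1, h2, h3, h4⟩ := exists_bounded_lattice haf haU hM hspan hfM hUa
      have h5 : unifAut ϖ N ^ (d * k) • D ≤ unifAut ϖ N • f ^ (s.den * k) • D := by
        have h6 : unifAut ϖ N * f ^ (s.den * k) = unifAut ϖ N ^ (d * k) * a⁻¹ := by
          rw [ha, mul_inv_rev, inv_inv, inv_inv, (unifAut_commute (g ^ k)).eq, hg, slopeAut,
            ((unifAut_commute (f ^ s.den)).symm.zpow_left _).inv_left.mul_pow, hd, inv_pow,
            zpow_natCast, ← pow_mul, ← pow_mul, ← mul_assoc, ← mul_assoc,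
            ← pow_succ, pow_succ', mul_inv_cancel_right]
        rw [smul_smul, h6, mul_smul]
        exact smul_le_smul.mpr (smul_le_iff_le_inv_smul.mp h4)
      have h7 := colength_mono_left h5
        ((unifAut_smul_le _).trans (pow_smul_le h3 (s.den * k)))
      rw [colength_add (unifAut_smul_le _) (pow_smul_le h3 (s.den * k)), hlen h1 h2 h3,
        hlen' h1 h2, smul_smul, ← (unifAut_commute (f ^ (s.den * k))).eq, mul_smul,
        colength_smul _ (unifAut_smul_le D)] at h7
      have h8 := hlen' h1 h2 1
      rw [pow_one] at h8
      rw [h8, ← Nat.cast_add, Nat.cast_le] at h7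
      have h9 : d * k * m = s.den * k * e := by
        rw [mul_right_comm, hdm]; ring
      omega
    · exact fun x => and_congr (hU x) (smul_mem_boundedPart_iff hgf)
    · exact fun x => and_congr (hU x) (smul_mem_boundedPart_iff haf)

/-- Existence of the slope decomposition, for Frobenius structures with a stable lattice. -/
theorem le_iSup_slopePart [FiniteDimensional (L K) N] {f : semiAut ϖ N}
    {M : Submodule (OL K) N} (hM : M.FG) (hspan : Submodule.span (L K) (M : Set N) = ⊤)
    (hfM : f • M ≤ M) {U : Submodule (L K) N} (hU : ∀ x, f • x ∈ U ↔ x ∈ U) :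
    U ≤ ⨆ s, slopePart f s := by
  induction hm : Module.finrank (L K) U using Nat.strong_induction_on generalizing U with
  | _ m ih =>
    by_cases hU0 : U = ⊥
    · rw [hU0]; exact bot_le
    have hfMU : f • (M ⊓ U.restrictScalars (OL K)) ≤ M ⊓ U.restrictScalars (OL K) := by
      rw [smul_inf', restrictScalars_smul_eq hU]
      exact inf_le_inf_right _ hfM
    rcases le_slopePart_or_split hU (hM.of_le inf_le_left) (span_inf_eq ϖ hspan U) hfMU hU0
      with ⟨s, hs⟩ | ⟨S, Q, hS, hQ, hle, hfS, hfQ⟩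
    · exact hs.trans (le_iSup _ s)
    · refine hle.trans (sup_le (ih _ ?_ hfS rfl) (ih _ ?_ hfQ rfl))
      · rw [← hm]; exact Submodule.finrank_lt_finrank_of_lt hS
      · rw [← hm]; exact Submodule.finrank_lt_finrank_of_lt hQ

end SlopeParts

/-! ### Independence of the slope parts, and colengths -/

section SlopeIndependence

variable {p : ℕ} [hp : Fact p.Prime] {K : IntermediateField ℚ_[p] (PadicAlgCl p)}
  {N : Type*} [AddCommGroup N] [Module (L K) N] {ϖ : L K} [hϖ : IsLUniformizer ϖ]

theorem unitPart_le_pow (g : semiAut ϖ N) (e : ℕ) : unitPart g ≤ unitPart (g ^ e) := by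
  rintro x ⟨M, hM, hgM, hx⟩
  refine ⟨M, hM, ?_, hx⟩
  induction e with
  | zero => simp
  | succ e ih =>
    change g ^ (e + 1) • M = M
    rw [pow_succ, mul_smul, hgM]; exact ih

theorem slopePart_le_unitPart (f : semiAut ϖ N) (s : ℚ) (e : ℕ) :
    slopePart f s ≤ unitPart ((unifAut ϖ N ^ (s.num * e))⁻¹ * f ^ (s.den * e)) := by
  have h : slopeAut f s ^ e = (unifAut ϖ N ^ (s.num * e))⁻¹ * f ^ (s.den * e) := by
    rw [slopeAut, (((unifAut_commute (f ^ s.den)).symm.zpow_left _).inv_left).mul_pow, inv_pow,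
      ← zpow_natCast, ← zpow_mul, ← pow_mul]
  rw [← h]
  exact unitPart_le_pow _ _

/-- If `g` acts on a lattice like `ϖ ^ i`, then `ϖ ^ (-j) g` is contracting for `j < i`. -/
theorem unitPart_le_boundedPart {g : semiAut ϖ N} {i j : ℤ} (hij : j < i) :
    unitPart ((unifAut ϖ N ^ i)⁻¹ * g) ≤
      boundedPart ((unifAut ϖ N)⁻¹ * ((unifAut ϖ N ^ j)⁻¹ * g)) := by
  rintro x ⟨M, hM, hgM, hx⟩
  refine ⟨M, hM, ?_, hx⟩
  obtain ⟨k, hk⟩ := Int.eq_ofNat_of_zero_le (show 0 ≤ i - j - 1 by omega)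
  have h1 : (unifAut ϖ N)⁻¹ * ((unifAut ϖ N ^ j)⁻¹ * g) =
      unifAut ϖ N ^ k * ((unifAut ϖ N ^ i)⁻¹ * g) := by
    rw [← mul_assoc, ← mul_assoc]
    congr 1
    rw [← zpow_natCast, ← zpow_neg, ← zpow_neg, ← zpow_neg_one, ← zpow_add, ← zpow_add]
    congr 1
    omega
  rw [h1, mul_smul, hgM]
  exact pow_smul_le (unifAut_smul_le M) k

/-- The parts of different slopes are independent: in a linear relation, the component of smallest
slope lies both in the unit part and in the contracting part of a suitable operator. -/
theorem iSupIndep_slopePart [IsDiscreteValuationRing (OL K)] (f : semiAut ϖ N) :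
    iSupIndep (slopePart f) := by
  classical
  rw [iSupIndep_iff_finsetSum_eq_zero_imp_eq_zero]
  intro T
  induction T using Finset.induction_on_min with
  | empty => simp
  | insert a T haT ih =>
    intro v hv hsum
    have ha : a ∉ T := fun h => (haT a h).false
    rw [Finset.sum_insert ha] at hsum
    -- a common multiple of the denominators
    let H : ℕ := a.den * ∏ t ∈ T, t.den
    have hle : ∀ t, t.den ∣ H → slopePart f t ≤
        unitPart ((unifAut ϖ N ^ (t.num * (H / t.den : ℕ)))⁻¹ * f ^ H) := by
      intro t ht
      have := slopePart_le_unitPart f t (H / t.den)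
      rwa [Nat.mul_div_cancel' ht] at this
    have hH : 0 < H := Nat.mul_pos a.den_pos (Finset.prod_pos fun t _ => t.den_pos)
    have hcast : ∀ t : ℚ, t.den ∣ H → ((t.num * (H / t.den : ℕ) : ℤ) : ℚ) = t * H := by
      intro t ht
      have h0 : (t.den : ℚ) ≠ 0 := by exact_mod_cast t.den_nz
      rw [Int.cast_mul, Int.cast_natCast, Nat.cast_div ht h0, mul_div_assoc', mul_div_right_comm, Rat.num_div_den]
    have haH : a.den ∣ H := Dvd.intro _ rfl
    have hTH : ∀ t ∈ T, t.den ∣ H := fun t ht =>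
      (Finset.dvd_prod_of_mem (fun t : ℚ => t.den) ht).mul_left _
    have h1 := hle a haH (hv a (Finset.mem_insert_self a T))
    have h2 : v a ∈ boundedPart ((unifAut ϖ N)⁻¹ *
        ((unifAut ϖ N ^ (a.num * (H / a.den : ℕ)))⁻¹ * f ^ H)) := by
      rw [eq_neg_of_add_eq_zero_left hsum]
      refine Submodule.neg_mem _ (Submodule.sum_mem _ fun t ht => ?_)
      refine unitPart_le_boundedPart ?_ (hle t (hTH t ht) (hv t (Finset.mem_insert_of_mem ht)))
      have h3 : (a : ℚ) * H < t * H :=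
        mul_lt_mul_of_pos_right (haT t ht) (by exact_mod_cast hH)
      rw [← hcast a haH, ← hcast t (hTH t ht)] at h3
      exact_mod_cast h3
    have h0 : v a = 0 := Submodule.disjoint_def.mp (disjoint_unitPart _) _ h1 h2
    rw [h0, zero_add] at hsum
    intro t ht
    rcases Finset.mem_insert.mp ht with rfl | ht
    · exact h0
    · exact ih v (fun t ht => hv t (Finset.mem_insert_of_mem ht)) hsum t ht

end SlopeIndependence

section Lengths

variable {p : ℕ} [hp : Fact p.Prime] {K : IntermediateField ℚ_[p] (PadicAlgCl p)}
  {N : Type*} [AddCommGroup N] [Module (L K) N]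

theorem colength_sup_of_disjoint {A A' B B' : Submodule (OL K) N} (hA : A' ≤ A) (hB : B' ≤ B)
    (h : Disjoint A B) :
    colength (A' ⊔ B') (A ⊔ B) = colength A' A + colength B' B := by
  have key : ∀ {A A' C : Submodule (OL K) N}, A' ≤ A → Disjoint A C →
      colength (A' ⊔ C) (A ⊔ C) = colength A' A := by
    intro A A' C hA h
    have h1 : A ⊓ (A' ⊔ C) = A' := by
      rw [inf_comm, sup_inf_assoc_of_le C hA, inf_comm, h.eq_bot, sup_bot_eq]
    have h2 : A ⊔ (A' ⊔ C) = A ⊔ C := by rw [← sup_assoc, sup_eq_left.mpr hA]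
    rw [← h2, ← colength_inf_left, h1]
  rw [colength_add (sup_le_sup_right hA B') (sup_le_sup_left hB A),
    key hA (h.mono_right hB), sup_comm A B', sup_comm A B, key hB h.symm]

variable {ϖ : L K}

theorem finset_sup_smul_le {ι : Type*} {g : semiAut ϖ N} {M : ι → Submodule (OL K) N}
    (hgM : ∀ s, g • M s ≤ M s) (T : Finset ι) : g • T.sup M ≤ T.sup M := by
  classical
  induction T using Finset.induction_on with
  | empty => rw [Finset.sup_empty, smul_bot']
  | insert a T ha ih =>
    rw [Finset.sup_insert, smul_sup']
    exact sup_le_sup (hgM a) ih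

theorem colength_finset_sup {ι : Type*} {g : semiAut ϖ N} {W : ι → Submodule (L K) N}
    (hW : iSupIndep W) {M : ι → Submodule (OL K) N}
    (hMW : ∀ s, Submodule.span (L K) (M s : Set N) = W s)
    (hgM : ∀ s, g • M s ≤ M s) (T : Finset ι) :
    colength (g • T.sup M) (T.sup M) = ∑ s ∈ T, colength (g • M s) (M s) := by
  classical
  induction T using Finset.induction_on with
  | empty => rw [Finset.sup_empty, smul_bot', colength_self, Finset.sum_empty]
  | insert a T ha ih =>
    have hle : ∀ s, M s ≤ (W s).restrictScalars (OL K) := fun s => by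
      rw [← hMW]; exact Submodule.subset_span
    have hTW : T.sup M ≤ (⨆ t ∈ (T : Set ι), W t).restrictScalars (OL K) :=
      Finset.sup_le fun t ht => (hle t).trans fun x hx => by
        have : W t ≤ ⨆ t ∈ (T : Set ι), W t := le_biSup W (Finset.mem_coe.mpr ht)
        exact this hx
    have hdisj : Disjoint (M a) (T.sup M) := Submodule.disjoint_def.mpr fun x h1 h2 =>
      Submodule.disjoint_def.mp (hW.disjoint_biSup (y := (T : Set ι)) (by simpa using ha)) x
        (hle a h1) (hTW h2)
    rw [Finset.sup_insert, smul_sup',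
      colength_sup_of_disjoint (hgM a) (finset_sup_smul_le hgM T) hdisj, ih, Finset.sum_insert ha]

theorem span_finset_sup {ι : Type*} {W : ι → Submodule (L K) N} {M : ι → Submodule (OL K) N}
    (hMW : ∀ s, Submodule.span (L K) (M s : Set N) = W s) (hW : ⨆ s, W s = ⊤) {T : Finset ι}
    (hT : ∀ s, W s ≠ ⊥ → s ∈ T) : Submodule.span (L K) ((T.sup M : Submodule (OL K) N) : Set N) = ⊤ := by
  refine eq_top_iff.mpr (hW.ge.trans (iSup_le fun s => ?_))
  by_cases hs : W s = ⊥
  · rw [hs]; exact bot_le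
  · rw [← hMW]
    exact Submodule.span_mono (Finset.le_sup (f := M) (hT s hs))

variable [hϖ : IsLUniformizer ϖ]

/-- The step common to stability under `f` and under `ϖ f⁻¹`, which is used with `u` and `v`
exchanged. -/
theorem smul_hull_le {u v : semiAut ϖ N} (huv : u * v = unifAut ϖ N) {h : ℕ}
    {B : Submodule (OL K) N} (hB : u ^ h • B ≤ B) :
    u • ⨆ i : Fin h, (u ^ (i : ℕ) • B ⊔ v ^ (i : ℕ) • B) ≤
      ⨆ i : Fin h, (u ^ (i : ℕ) • B ⊔ v ^ (i : ℕ) • B) := by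
  have hle : ∀ i : Fin h, u ^ (i : ℕ) • B ⊔ v ^ (i : ℕ) • B ≤
      ⨆ i : Fin h, (u ^ (i : ℕ) • B ⊔ v ^ (i : ℕ) • B) := le_iSup _
  have hu : ∀ i : ℕ, i < h → u • u ^ i • B ≤
      ⨆ i : Fin h, (u ^ (i : ℕ) • B ⊔ v ^ (i : ℕ) • B) := by
    intro i hi
    rw [smul_smul, ← pow_succ']
    rcases lt_or_eq_of_le (Nat.succ_le_of_lt hi) with h1 | h1
    · exact le_sup_left.trans (hle ⟨i + 1, h1⟩)
    · have h2 := le_sup_left.trans (hle ⟨0, by omega⟩)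
      rw [pow_zero, one_smul] at h2
      have h3 : u ^ (i + 1) • B ≤ B := by rw [← Nat.succ_eq_add_one, h1]; exact hB
      exact h3.trans h2
  rw [smul_iSup']
  refine iSup_le fun i => ?_
  rw [smul_sup']
  refine sup_le (hu i i.2) ?_
  obtain ⟨i, hi⟩ := i
  cases i with
  | zero => simpa using hu 0 hi
  | succ j =>
    change u • v ^ (j + 1) • B ≤ _
    rw [smul_smul, pow_succ', ← mul_assoc, huv, mul_smul]
    exact (unifAut_smul_le _).trans (le_sup_right.trans (hle ⟨j, by omega⟩))

/-- For `0 ≤ s ≤ 1` an isoclinic space of slope `s` contains a lattice which is stable under `f` and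
`ϖ f⁻¹`. -/
theorem exists_isStable_of_slopeAut_smul_eq {f : semiAut ϖ N} {s : ℚ} (hs0 : 0 ≤ s) (hs1 : s ≤ 1)
    {B : Submodule (OL K) N} (hB : B.FG) (hs : slopeAut f s • B = B)
    (hf : ∀ x ∈ Submodule.span (L K) (B : Set N), f • x ∈ Submodule.span (L K) (B : Set N)) :
    ∃ D : Submodule (OL K) N, D.FG ∧
      Submodule.span (L K) (D : Set N) = Submodule.span (L K) (B : Set N) ∧ IsStable f D ∧
      slopeAut f s • D = D := by
  set U := Submodule.span (L K) (B : Set N) with hU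
  have hs' := slopeAut_smul_eq_iff.mp hs
  obtain ⟨d, hd⟩ := Int.eq_ofNat_of_zero_le (Rat.num_nonneg.mpr hs0)
  rw [hd] at hs'
  have hs' : f ^ s.den • B = unifAut ϖ N ^ d • B := by rw [hs']; rfl
  have hdh : d ≤ s.den := by
    have : s.num ≤ s.den := Rat.num_le_denom_iff.mpr hs1
    omega
  have hvf : versch f * f = unifAut ϖ N := by rw [versch, inv_mul_cancel_right]
  have hfv : f * versch f = unifAut ϖ N := by rw [versch_eq, mul_inv_cancel_left]
  have hcv : Commute f (versch f) := hfv.trans hvf.symm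
  have hfB : f ^ s.den • B ≤ B := by rw [hs']; exact pow_smul_le (unifAut_smul_le B) d
  have hvB : versch f ^ s.den • B ≤ B := by
    have h1 : versch f ^ s.den * f ^ s.den = unifAut ϖ N ^ s.den := by
      rw [← hcv.symm.mul_pow, hvf]
    have h2 : versch f ^ s.den • unifAut ϖ N ^ d • B = unifAut ϖ N ^ s.den • B := by
      rw [← hs', smul_smul, h1]
    obtain ⟨c, hc⟩ := Nat.exists_eq_add_of_le hdh
    have h3 : versch f ^ s.den • B = unifAut ϖ N ^ c • B := by
      refine smul_left_cancel (unifAut ϖ N ^ d) ?_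
      rw [smul_smul _ (unifAut ϖ N ^ c), ← pow_add, ← hc, ← h2, smul_smul, smul_smul,
        ((unifAut_commute (versch f ^ s.den)).pow_right d).eq]
    rw [h3]
    exact pow_smul_le (unifAut_smul_le B) c
  have hBU : B ≤ U.restrictScalars (OL K) := Submodule.subset_span
  have hfU : f • U.restrictScalars (OL K) ≤ U.restrictScalars (OL K) := by
    intro x hx
    have := hf _ (mem_smul_iff.mp hx)
    rwa [smul_inv_smul] at this
  have hinvB : f⁻¹ • B ≤ U.restrictScalars (OL K) := by
    have h1 : unifAut ϖ N ^ d • f⁻¹ • B = f ^ (s.den - 1) • B := by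
      rw [smul_smul, ← ((unifAut_commute f⁻¹).pow_right d).eq, mul_smul, ← hs', smul_smul]
      congr 1
      rw [inv_mul_eq_iff_eq_mul, ← pow_succ', Nat.sub_add_cancel s.den_pos]
    have h2 := unifAut_smul_restrictScalars (ϖ := ϖ) (d : ℤ) U
    rw [zpow_natCast] at h2
    rw [← smul_le_smul (g := unifAut ϖ N ^ d), h1, h2]
    exact (smul_le_smul.mpr hBU).trans (pow_smul_le hfU _)
  have hvU : versch f • U.restrictScalars (OL K) ≤ U.restrictScalars (OL K) := by
    rw [versch, mul_smul]
    refine (unifAut_smul_le _).trans fun x hx => ?_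
    have h1 := smul_mem_span_smul (g := f⁻¹) (M := B) (mem_smul_iff.mp hx)
    rw [inv_inv, inv_smul_smul] at h1
    exact (Submodule.span_le (R := L K) (p := U)).mpr hinvB h1
  refine ⟨⨆ i : Fin s.den, (f ^ (i : ℕ) • B ⊔ versch f ^ (i : ℕ) • B),
    Submodule.fg_iSup _ fun i => (fg_smul hB).sup (fg_smul hB), le_antisymm ?_ ?_, ?_, ?_⟩
  · refine Submodule.span_le.mpr (show _ ≤ U.restrictScalars (OL K) from
      iSup_le fun i => sup_le ?_ ?_)
    · exact (smul_le_smul.mpr hBU).trans (pow_smul_le hfU _)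
    · exact (smul_le_smul.mpr hBU).trans (pow_smul_le hvU _)
  · refine Submodule.span_mono ?_
    have := le_iSup (fun i : Fin s.den => f ^ (i : ℕ) • B ⊔ versch f ^ (i : ℕ) • B) ⟨0, s.den_pos⟩
    dsimp only at this
    rw [pow_zero, pow_zero, one_smul, sup_idem] at this
    exact this
  · rw [isStable_iff]
    refine ⟨?_, smul_hull_le hfv hfB⟩
    have := smul_hull_le hvf hvB
    simpa only [sup_comm] using this
  · have hc := slopeAut_commute f s
    have hcv : Commute (slopeAut f s) (versch f) :=
      (unifAut_commute _).mul_right hc.inv_right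
    rw [smul_iSup']
    refine iSup_congr fun i => ?_
    rw [smul_sup', smul_smul, smul_smul, (hc.pow_right _).eq, (hcv.pow_right _).eq, mul_smul,
      mul_smul, hs]

variable [IsDiscreteValuationRing (OL K)]

/-- On an isoclinic space of slope `s` and dimension `m`, the colength of `f` is `s m`. -/
theorem colength_eq_slope_mul {f : semiAut ϖ N} {s : ℚ} {D : Submodule (OL K) N} (hD : D.FG)
    (hfD : f • D ≤ D) (hs : slopeAut f s • D = D) {e : ℕ} (he : colength (f • D) D = e) :
    (e : ℚ) = s * Module.finrank (L K) (Submodule.span (L K) (D : Set N)) := by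
  set m := Module.finrank (L K) (Submodule.span (L K) (D : Set N)) with hm
  rw [slopeAut_smul_eq_iff] at hs
  have h1 : colength (f ^ s.den • D) D = (s.den * e : ℕ) := by
    rw [colength_pow_smul hfD, he]; push_cast; rfl
  have hw : ∀ i : ℕ, colength (unifAut ϖ N ^ i • D) D = (i * m : ℕ) := fun i => by
    rw [colength_unifAut_pow_smul hD]; push_cast; rfl
  have hden : (s.den : ℚ) ≠ 0 := by exact_mod_cast s.den_nz
  rcases Int.le_total 0 s.num with h0 | h0
  · obtain ⟨d, hd⟩ := Int.eq_ofNat_of_zero_le h0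
    rw [hs, hd] at h1
    have h2 : colength (unifAut ϖ N ^ d • D) D = (s.den * e : ℕ) := by exact_mod_cast h1
    rw [hw, Nat.cast_inj] at h2
    have h3 : (d : ℚ) * m = s.den * e := by exact_mod_cast h2
    have h4 : s * s.den = d := by rw [Rat.mul_den_eq_num, hd]; rfl
    have : (s.den : ℚ) * e = s.den * (s * m) := by rw [← h3, ← h4]; ring
    exact mul_left_cancel₀ hden this
  · -- `fʰ D = ϖᵈ D` contains `D` for negative `d`, so that both are equal to `D`
    obtain ⟨d, hd⟩ := Int.eq_ofNat_of_zero_le (neg_nonneg.mpr h0)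
    have hd' : s.num = -(d : ℤ) := by rw [← hd, neg_neg]
    have h2 : f ^ s.den • D = (unifAut ϖ N ^ d)⁻¹ • D := by rw [hs, hd', zpow_neg, zpow_natCast]
    have h3 : D ≤ f ^ s.den • D := by
      rw [h2, ← smul_le_iff_le_inv_smul]
      exact pow_smul_le (unifAut_smul_le D) d
    have h4 : D ≤ unifAut ϖ N ^ d • D := by
      have := pow_smul_le hfD s.den
      rw [h2] at this
      rwa [smul_le_iff_le_inv_smul, inv_inv] at this
    have h5 := hw d
    rw [colength_eq_zero_iff.mpr h4] at h5
    rw [colength_eq_zero_iff.mpr h3] at h1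
    have h6 : d * m = 0 := by exact_mod_cast h5.symm
    have h7 : s.den * e = 0 := by exact_mod_cast h1.symm
    have h8 : e = 0 := (Nat.mul_eq_zero.mp h7).resolve_left s.den_nz
    rw [h8]
    rcases Nat.mul_eq_zero.mp h6 with h | h
    · rw [h] at hd'
      have : s = 0 := Rat.num_eq_zero.mp (by simpa using hd')
      simp [this]
    · simp [h]

end Lengths

/-! ### Slope vectors and stable lattices -/

section SlopeVectors

theorem sum_eq_sum_mul_card {n : ℕ} (ν : Fin n → ℚ) {T : Finset ℚ} (hT : ∀ i, ν i ∈ T) :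
    ∑ i, ν i = ∑ s ∈ T, s * (Finset.univ.filter fun i => ν i = s).card := by
  rw [← Finset.sum_fiberwise_of_maps_to fun i _ => hT i]
  refine Finset.sum_congr rfl fun s _ => ?_
  rw [Finset.sum_congr rfl fun i hi => (Finset.mem_filter.mp hi).2, Finset.sum_const, nsmul_eq_mul,
    mul_comm]

/-- A decreasing sequence with prescribed multiplicities. -/
theorem exists_antitone_of_card {T : Finset ℚ} {m : ℚ → ℕ} (hm : ∀ s, s ∉ T → m s = 0) {n : ℕ}
    (hn : ∑ s ∈ T, m s = n) : ∃ ν : Fin n → ℚ, Antitone ν ∧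
      ∀ s, (Finset.univ.filter fun i => ν i = s).card = m s := by
  classical
  have hcard : Fintype.card (Fin n) = Fintype.card (Σ s : T, Fin (m s)) := by
    rw [Fintype.card_fin, Fintype.card_sigma]
    simp only [Fintype.card_fin]
    rw [← hn, Finset.sum_coe_sort T m]
  let e := Fintype.equivOfCardEq hcard
  let μ : Fin n → ℚ := fun i => (e i).1
  let τ : Equiv.Perm (Fin n) := Fin.revPerm.trans (Tuple.sort μ)
  refine ⟨μ ∘ τ, fun i j hij => Tuple.monotone_sort μ (Fin.rev_le_rev.mpr hij), fun s => ?_⟩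
  have h1 : (Finset.univ.filter fun i => (μ ∘ τ) i = s).card =
      (Finset.univ.filter fun x : Σ s : T, Fin (m s) => (x.1 : ℚ) = s).card := by
    refine Finset.card_equiv (τ.trans e) fun i => ?_
    simp [μ]
  rw [h1]
  by_cases hs : s ∈ T
  · have h2 : (Finset.univ.filter fun x : Σ s : T, Fin (m s) => (x.1 : ℚ) = s) =
        (Finset.univ : Finset (Fin (m s))).map
          ⟨fun i => (⟨⟨s, hs⟩, i⟩ : Σ s : T, Fin (m s)), fun i j h => by simpa using h⟩ := by
      ext ⟨⟨t, ht⟩, i⟩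
      simp only [Finset.mem_filter, Finset.mem_univ, true_and, Finset.mem_map]
      constructor
      · rintro rfl
        exact ⟨i, rfl⟩
      · rintro ⟨j, hj⟩
        exact (congrArg (fun x : Σ s : T, Fin (m s) => (x.1 : ℚ)) hj).symm
    rw [h2, Finset.card_map, Finset.card_univ, Fintype.card_fin]
  · rw [hm s hs, Finset.card_eq_zero, Finset.filter_eq_empty_iff]
    rintro ⟨t, i⟩ - rfl
    exact hs t.2

variable {p : ℕ} [hp : Fact p.Prime] {K : IntermediateField ℚ_[p] (PadicAlgCl p)}
  {N : Type*} [AddCommGroup N] [Module (L K) N] [FiniteDimensional (L K) N]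

section
variable {ϖ : L K} [hϖ : IsLUniformizer ϖ] [IsDiscreteValuationRing (OL K)]

/-- A lattice which is stable under `f` cuts out a lattice of the expected colength in each slope
part. -/
theorem exists_colength_inf_slopePart {f : semiAut ϖ N} {M : Submodule (OL K) N} (hM : M.FG)
    (hspan : Submodule.span (L K) (M : Set N) = ⊤) (hfM : f • M ≤ M) (s : ℚ) :
    f • (M ⊓ (slopePart f s).restrictScalars (OL K)) ≤
        M ⊓ (slopePart f s).restrictScalars (OL K) ∧
      ∃ e : ℕ, colength (f • (M ⊓ (slopePart f s).restrictScalars (OL K)))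
          (M ⊓ (slopePart f s).restrictScalars (OL K)) = e ∧
        (e : ℚ) = s * Module.finrank (L K) (slopePart f s) := by
  set W := slopePart f s with hW
  have hfW : ∀ x, f • x ∈ W ↔ x ∈ W := fun x => smul_mem_slopePart_iff
  have hstab : f • (M ⊓ W.restrictScalars (OL K)) ≤ M ⊓ W.restrictScalars (OL K) := by
    rw [smul_inf', restrictScalars_smul_eq hfW]
    exact inf_le_inf_right _ hfM
  have hMs : (M ⊓ W.restrictScalars (OL K)).FG := hM.of_le inf_le_left
  have hspW := span_inf_eq ϖ hspan W
  obtain ⟨B, hB, hgB, hBW⟩ := (isLatticeClass_eq (slopeAut f s)).exists_span_eq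
  obtain ⟨D, hD, hDW, hfD, -, hgD⟩ := exists_stable_hull hMs hB (hBW.trans hspW.symm) hstab
  obtain ⟨e, he⟩ := exists_colength_smul_eq hMs (by rw [hspW]; exact hfW) hstab
  refine ⟨hstab, e, he, ?_⟩
  have h1 := colength_eq_slope_mul hD hfD (hgD _ (slopeAut_commute f s) hgB)
    ((colength_smul_eq_of_span_eq hD hMs hDW hfD hstab).trans he)
  rwa [hDW, hspW] at h1

end

variable {π : K} [hϖ : IsLUniformizer (inclL K π)] {σ : RelFrobenius K} {F : Isocrystal σ N}
  {n r : ℕ}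

theorem isIsoclinic_slopePart (s : ℚ) :
    IsIsoclinic π F (slopePart (F.aut (π := π)) s) s := by
  refine ⟨fun x hx => (smul_mem_slopePart_iff (f := F.aut (π := π))).mpr hx, ?_⟩
  obtain ⟨B, hB, hgB, hBW⟩ := (isLatticeClass_eq (slopeAut (F.aut (π := π)) s)).exists_span_eq
  refine ⟨B, hB, hBW, ?_⟩
  rw [F.image_iterate_eq (π := π), scale_unif_zpow]
  exact slopeAut_smul_eq_iff.mp hgB

/-- An isocrystal with a stable lattice of colength `r` is minuscule of weight `r`. -/
theorem isMinuscule_of_lattice (hN : Module.finrank (L K) N = n) {M : Submodule (OL K) N}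
    (hM : M.FG) (hspan : Submodule.span (L K) (M : Set N) = ⊤)
    (hst : IsStable (F.aut (π := π)) M) (hr : colength (F.aut (π := π) • M) M = r) :
    IsMinuscule π F n r := by
  classical
  have : IsDiscreteValuationRing (OL K) := isDiscreteValuationRing_OL (inclL K π)
  set f := F.aut (π := π) with hf
  have hind := iSupIndep_slopePart f
  have htop : ⨆ s, slopePart f s = ⊤ := top_le_iff.mp
    (le_iSup_slopePart hM hspan hst.2 (U := ⊤) fun x => by simp)
  let A : ℚ → Submodule (OL K) N := fun s => M ⊓ (slopePart f s).restrictScalars (OL K)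
  have hA : ∀ s, (A s).FG := fun s => hM.of_le inf_le_left
  have hAspan : ∀ s, Submodule.span (L K) (A s : Set N) = slopePart f s :=
    fun s => span_inf_eq (inclL K π) hspan _
  choose hfA e he hes using exists_colength_inf_slopePart hM hspan hst.2
  have hwA : ∀ s, unifAut (inclL K π) N • A s ≤ f • A s := fun s => by
    have h1 := unifAut_smul_restrictScalars (ϖ := inclL K π) 1 (slopePart f s)
    rw [zpow_one] at h1
    rw [smul_inf', smul_inf', h1, restrictScalars_smul_eq fun x => smul_mem_slopePart_iff]
    exact inf_le_inf_right _ hst.1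
  have hwlen : ∀ s, colength (unifAut (inclL K π) N • A s) (A s) =
      Module.finrank (L K) (slopePart f s) := fun s => by
    rw [colength_unifAut_smul (hA s), hAspan]
  have hem : ∀ s, e s ≤ Module.finrank (L K) (slopePart f s) := fun s => by
    have := colength_mono_left (hwA s) (hfA s)
    rw [he, hwlen] at this
    exact_mod_cast this
  let T : Finset ℚ := (WellFoundedGT.finite_ne_bot_of_iSupIndep hind).toFinset
  have hT : ∀ s, slopePart f s ≠ ⊥ → s ∈ T := fun s hs => by simpa [T] using hs
  have hTfg : (T.sup A).FG := Submodule.fg_finset_sup T A fun s _ => hA s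
  have hTspan := span_finset_sup hAspan htop hT
  have hsumn : ∑ s ∈ T, Module.finrank (L K) (slopePart f s) = n := by
    have h1 := colength_finset_sup hind hAspan (fun s => unifAut_smul_le (ϖ := inclL K π) (A s)) T
    rw [colength_unifAut_smul hTfg, hTspan, finrank_top, hN,
      Finset.sum_congr rfl fun s _ => hwlen s] at h1
    exact_mod_cast h1.symm
  have hsumr : ∑ s ∈ T, e s = r := by
    have h1 := colength_finset_sup hind hAspan hfA T
    rw [colength_smul_eq_of_span_eq hTfg hM (hTspan.trans hspan.symm) (finset_sup_smul_le hfA T)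
      hst.2, hr, Finset.sum_congr rfl fun s _ => he s] at h1
    exact_mod_cast h1.symm
  have hm0 : ∀ s, s ∉ T → Module.finrank (L K) (slopePart f s) = 0 := fun s hs => by
    have : slopePart f s = ⊥ := by
      by_contra h
      exact hs (hT s h)
    rw [this, finrank_bot]
  obtain ⟨ν, hν, hcard⟩ := exists_antitone_of_card hm0 hsumn
  have hpos : ∀ i, 0 < Module.finrank (L K) (slopePart f (ν i)) := fun i => by
    rw [← hcard]
    exact Finset.card_pos.mpr ⟨i, by simp⟩
  have hνT : ∀ i, ν i ∈ T := fun i => by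
    by_contra h
    exact (hpos i).ne' (hm0 _ h)
  refine ⟨ν, ⟨hν, slopePart f, DirectSum.isInternal_submodule_of_iSupIndep_of_iSup_eq_top hind htop,
    fun s => ⟨isIsoclinic_slopePart s, (hcard s).symm⟩⟩, fun i => ?_, ?_⟩
  · have h1 := hes (ν i)
    have h2 : (0 : ℚ) < Module.finrank (L K) (slopePart f (ν i)) := by exact_mod_cast hpos i
    have h3 : (e (ν i) : ℚ) ≤ Module.finrank (L K) (slopePart f (ν i)) := by
      exact_mod_cast hem (ν i)
    have h4 : (0 : ℚ) ≤ e (ν i) := Nat.cast_nonneg _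
    constructor
    · by_contra! h
      nlinarith
    · by_contra! h
      nlinarith
  · rw [sum_eq_sum_mul_card ν hνT, ← hsumr, Nat.cast_sum]
    exact Finset.sum_congr rfl fun s _ => by rw [hcard, hes]

/-- A minuscule isocrystal of weight `r` contains a stable lattice of colength `r`. -/
theorem IsMinuscule.exists_lattice (h : IsMinuscule π F n r) :
    ∃ M : Submodule (OL K) N, M.FG ∧ Submodule.span (L K) (M : Set N) = ⊤ ∧
      IsStable (F.aut (π := π)) M ∧ colength (F.aut (π := π) • M) M = r := by
  classical
  have : IsDiscreteValuationRing (OL K) := isDiscreteValuationRing_OL (inclL K π)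
  set f := F.aut (π := π) with hf
  obtain ⟨ν, ⟨-, W, hW, hiso⟩, hν, hsum⟩ := h
  have hlat : ∀ s, ∃ (A : Submodule (OL K) N) (e : ℕ), A.FG ∧
      Submodule.span (L K) (A : Set N) = W s ∧ IsStable f A ∧ colength (f • A) A = e ∧
      (e : ℚ) = s * Module.finrank (L K) (W s) := by
    intro s
    obtain ⟨⟨hFW, B, hB, hBW, hFB⟩, hcard⟩ := hiso s
    by_cases hs : ∃ i, ν i = s
    · obtain ⟨i, rfl⟩ := hs
      rw [F.image_iterate_eq (π := π), scale_unif_zpow] at hFB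
      obtain ⟨D, hD, hDB, hst, hgD⟩ := exists_isStable_of_slopeAut_smul_eq (f := f) (hν i).1 (hν i).2
        hB (slopeAut_smul_eq_iff.mpr hFB) (by rw [hBW]; exact hFW)
      have hfin : colength (f • D) D ≠ ⊤ := by
        have h1 := colength_mono_left hst.1 hst.2
        rw [colength_unifAut_smul hD] at h1
        exact ne_top_of_le_ne_top (ENat.natCast_ne_top _) h1
      obtain ⟨e, he⟩ := ENat.ne_top_iff_exists.mp hfin
      have h2 := colength_eq_slope_mul hD hst.2 hgD he.symm
      rw [hDB, hBW] at h2
      exact ⟨D, e, hD, hDB.trans hBW, hst, he.symm, h2⟩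
    · have h0 : Module.finrank (L K) (W s) = 0 := by
        rw [hcard, Finset.card_eq_zero, Finset.filter_eq_empty_iff]
        exact fun i _ hi => hs ⟨i, hi⟩
      refine ⟨⊥, 0, Submodule.fg_bot, ?_, ?_, ?_, ?_⟩
      · rw [Submodule.finrank_eq_zero.mp h0]
        simp
      · simp [IsStable, smul_bot']
      · rw [smul_bot', colength_self]; rfl
      · simp [h0]
  choose A e hA hAW hst he hes using hlat
  let T : Finset ℚ := Finset.univ.image ν
  have hνT : ∀ i, ν i ∈ T := fun i => Finset.mem_image_of_mem ν (Finset.mem_univ i)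
  have hT : ∀ s, W s ≠ ⊥ → s ∈ T := fun s hs => by
    have h1 : 0 < Module.finrank (L K) (W s) := Submodule.one_le_finrank_iff.mpr hs
    rw [(hiso s).2] at h1
    obtain ⟨i, hi⟩ := Finset.card_pos.mp h1
    rw [← (Finset.mem_filter.mp hi).2]
    exact hνT i
  refine ⟨T.sup A, Submodule.fg_finset_sup T A fun s _ => hA s,
    span_finset_sup hAW hW.submodule_iSup_eq_top hT, ?_, ?_⟩
  · rw [isStable_iff]
    exact ⟨finset_sup_smul_le (fun s => (isStable_iff.mp (hst s)).1) T,
      finset_sup_smul_le (fun s => (hst s).2) T⟩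
  · rw [colength_finset_sup hW.submodule_iSupIndep hAW (fun s => (hst s).2) T,
      Finset.sum_congr rfl fun s _ => he s, ← Nat.cast_sum]
    congr 1
    have h1 : ((∑ s ∈ T, e s : ℕ) : ℚ) = r := by
      rw [← hsum, sum_eq_sum_mul_card ν hνT, Nat.cast_sum]
      exact Finset.sum_congr rfl fun s _ => by rw [hes, (hiso s).2]
    exact_mod_cast h1

end SlopeVectors

end KR

end

theorem proposition1p1 {p : ℕ} [Fact p.Prime]
    (K : IntermediateField ℚ_[p] (PadicAlgCl p)) [FiniteDimensional ℚ_[p] K]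
    (π : K) (hπ : KR.IsUniformizer π) (σ : KR.RelFrobenius K)
    {N : Type*} [AddCommGroup N] [Module (KR.L K) N] [FiniteDimensional (KR.L K) N]
    (F : KR.Isocrystal σ N) (n : ℕ) (hn : Module.finrank (KR.L K) N = n) (hn0 : 0 < n)
    (r : ℕ) (hr : r ≤ n) :
    (∀ I : Set (ZMod n), I.Nonempty → ((KR.X π F r I).Nonempty ↔ KR.IsMinuscule π F n r)) ∧
    (∀ (I J : Set (ZMod n)) (h : J ⊆ I), J.Nonempty →
      Function.Surjective (KR.X.forget π F r h)) := by
  have hϖ := hπ.isLUniformizer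
  refine ⟨fun I hI => ⟨?_, fun h => ?_⟩, fun I J h hJ => KR.X.forget_surjective hn0 h hJ⟩
  · rintro ⟨C, hC⟩
    obtain ⟨i, -⟩ := KR.exists_next_index hn0 hI 0
    have hst := (KR.isStableChain_of_mem hC).stable i
    refine KR.isMinuscule_of_lattice hn (C.isLattice i).fg (C.isLattice i).span_eq_top hst ?_
    rw [← F.image_eq]
    exact (hC i).2.2
  · obtain ⟨M, hM, hspan, hst, hlen⟩ := h.exists_lattice
    exact KR.X.nonempty_of_lattice hn0 hn hM hspan hst hlen I
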